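/- Let $k\ge 1$ be an integer and let $A_1,\dots,A_{k+1}\in\mathbb R^{2\times 2}$ be diagonal matrices with $$\operatorname{rank}(A_1-A_2)=1,\qquad \operatorname{rank}(A_j-A_{j'})=2\quad\text{for all } j\ne j',\ j,j'\ge 2.$$ Let $J_3,\dots,J_{k+1}$ be iterated laminates of these wells: $$J_3=\lambda_3A_1+(1-\lambda_3)A_2,\qquad J_{j+1}=\lambda_{j+1}A_j+(1-\lambda_{j+1})J_j\quad(3\le j\le k),$$ with $\lambda_3,\dots,\lambda_{k+1}\in(0,1)$ and $\operatorname{rank}(A_j-J_j)=1$ for $3\le j\le k+1$. For some $\lambda\in(0,1)$ let $$F=\begin{cases}\lambda A_1+(1-\lambda)A_2,& k=1,\\ \lambda A_{k+1}+(1-\lambda)J_{k+1},& k\ge 2,\end{cases}$$ and let $K=\{A_1,\dots,A_{k+1}\}$, $\Omega=(0,1)^2$. For $p\in[1,\infty)$, $\epsilon>0$, $u\in W^{1,\infty}(\Omega;\mathbb R^2)$ and $\chi\in BV(\Omega;K)$, with $\chi_j$ the characteristic function of $\{\chi=A_j\}$, put $$E_\epsilon(u,\chi)=\int_\Omega|\nabla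 u-\chi|^p\,dx+\epsilon\sum_{j=1}^{k+1}\|D\chi_j\|_{TV(\Omega)},\qquad E_\epsilon(u)=\int_\Omega\operatorname{dist}^p(\nabla u,K)\,dx+\epsilon\|D^2u\|_{TV(\Omega)}.$$ Then for every $p\in[1,\infty)$ there is a constant $C>0$, independent of $\epsilon$ (it may depend on $k$, the wells $A_j$, the weights $\lambda_j,\lambda$ and $p$), such that for every $\epsilon\in(0,1)$ there exist a continuous $u_\epsilon\in W^{1,\infty}_{\mathrm{loc}}(\mathbb R^2;\mathbb R^2)$ whose restriction to $\Omega$ lies in $W^{1,\infty}(\Omega;\mathbb R^2)$, a vector $b\in\mathbb R^2$ and $\chi_\epsilon\in BV(\Omega;K)$ with $$u_\epsilon(x)=Fx+b\quad\text{for every }x\in\mathbb R^2\setminus\Omega,$$ and $$E_\epsilon(u_\epsilon,\chi_\epsilon)\le C\,\epsilon^{\frac{p}{k+p}},\qquad E_\epsilon(u_\epsilon)\le C\,\epsilon^{\frac{p}{k+p}}.$$ -/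

import Mathlib

open Set MeasureTheory
open scoped ENNReal ContDiff

noncomputable section

-- The norm on matrices is the Frobenius (Euclidean) norm.
attribute [local instance] Matrix.frobeniusNormedAddCommGroup

/-- The plane `ℝ²` with its Euclidean structure and Lebesgue measure. -/
abbrev Plane : Type := EuclideanSpace ℝ (Fin 2)

/-- Real `2 × 2` matrices. -/
abbrev Mat2 : Type := Matrix (Fin 2) (Fin 2) ℝ

/-- The open unit square `(0,1)²`. -/
def unitSquare : Set Plane := {x | ∀ i, x i ∈ Ioo (0 : ℝ) 1}

/-- The partial derivative `∂ᵢ g (x)` of a differentiable function. -/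
def partialDeriv (i : Fin 2) (g : Plane → ℝ) (x : Plane) : ℝ :=
  fderiv ℝ g x (EuclideanSpace.single i 1)

/-- Smooth real functions on the plane with compact support contained in `Ω`. -/
def IsTestFun (Ω : Set Plane) (φ : Plane → ℝ) : Prop :=
  ContDiff ℝ ∞ φ ∧ HasCompactSupport φ ∧ tsupport φ ⊆ Ω

/-- `G` is the weak (distributional) gradient of the vector field `u` in the open set `Ω`:
`u` and `G` are locally integrable in `Ω` and `G a i = ∂ᵢ uₐ` weakly. -/
def IsWeakGradient (Ω : Set Plane) (u : Plane → Plane) (G : Plane → Mat2) : Prop :=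
  (∀ a, LocallyIntegrableOn (fun x => u x a) Ω volume) ∧
  (∀ a i, LocallyIntegrableOn (fun x => G x a i) Ω volume) ∧
  ∀ a i, ∀ φ : Plane → ℝ, IsTestFun Ω φ →
    ∫ x in Ω, u x a * partialDeriv i φ x = - ∫ x in Ω, G x a i * φ x

/-- `u ∈ W^{1,∞}(Ω; ℝ²)` with weak gradient `G`. -/
def MemW1Infty (Ω : Set Plane) (u : Plane → Plane) (G : Plane → Mat2) : Prop :=
  IsWeakGradient Ω u G ∧
  (∀ a, MemLp (fun x => u x a) ⊤ (volume.restrict Ω)) ∧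
  ∀ a i, MemLp (fun x => G x a i) ⊤ (volume.restrict Ω)

/-- The total variation `‖Df‖_{TV(Ω)}` of the distributional derivative of a (locally integrable)
function with finitely many real components, by duality: the supremum of
`∫_Ω ∑ₐ fₐ div φₐ` over smooth `φ`, compactly supported in `Ω`, with `|φ| ≤ 1` pointwise. -/
def totalVar {ι : Type} [Fintype ι] (Ω : Set Plane) (f : Plane → ι → ℝ) : ℝ≥0∞ :=
  ⨆ (φ : ι → Fin 2 → Plane → ℝ)
    (_ : (∀ a i, IsTestFun Ω (φ a i)) ∧ ∀ x, ∑ a, ∑ i, φ a i x ^ 2 ≤ 1),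
    ENNReal.ofReal (∫ x in Ω, ∑ a, ∑ i, f x a * partialDeriv i (φ a i) x)

/-- Total variation of the derivative of a real function. -/
def totalVarReal (Ω : Set Plane) (f : Plane → ℝ) : ℝ≥0∞ :=
  totalVar Ω (fun x (_ : Unit) => f x)

/-- Total variation of the derivative of a matrix field. -/
def totalVarMat (Ω : Set Plane) (M : Plane → Mat2) : ℝ≥0∞ :=
  totalVar Ω (fun x (q : Fin 2 × Fin 2) => M x q.1 q.2)

/-- `χ ∈ BV(Ω; K)`. -/
def MemBV (Ω : Set Plane) (K : Set Mat2) (χ : Plane → Mat2) : Prop :=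
  (∀ x ∈ Ω, χ x ∈ K) ∧
  (∀ a i, IntegrableOn (fun x => χ x a i) Ω volume) ∧
  totalVarMat Ω χ < ⊤

/-- The wells `K = {A₁, …, A_{k+1}}`. -/
def wells (k : ℕ) (A : ℕ → Mat2) : Set Mat2 := A '' Icc 1 (k + 1)

/-- `∫_Ω |∇u - χ|^p dx + ε ∑_{j=1}^{k+1} ‖Dχⱼ‖_{TV(Ω)}`, where `G = ∇u` and `χⱼ` is the
characteristic function of the phase `{χ = Aⱼ}`. -/
def phaseEnergy (Ω : Set Plane) (k : ℕ) (A : ℕ → Mat2) (p ε : ℝ)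
    (G χ : Plane → Mat2) : ℝ≥0∞ :=
  (∫⁻ x in Ω, ‖G x - χ x‖ₑ ^ p) +
    ENNReal.ofReal ε *
      ∑ j ∈ Finset.Icc 1 (k + 1), totalVarReal Ω ({x | χ x = A j}.indicator fun _ => (1 : ℝ))

/-- `∫_Ω dist(∇u, K)^p dx + ε ‖D²u‖_{TV(Ω)}`, where `G = ∇u`. -/
def gradientEnergy (Ω : Set Plane) (K : Set Mat2) (p ε : ℝ) (G : Plane → Mat2) : ℝ≥0∞ :=
  (∫⁻ x in Ω, Metric.infEDist (G x) K ^ p) + ENNReal.ofReal ε * totalVarMat Ω G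

end

open Set MeasureTheory
open scoped ENNReal ContDiff

attribute [local instance] Matrix.frobeniusNormedAddCommGroup

/-! All matrices involved are diagonal, so two of them whose difference has rank one differ in
exactly one diagonal entry, and every lamination runs in a coordinate direction. The proof is an
induction on the order of lamination in which one dyadic scale 2⁻ⁿ serves all levels. The inductive
statement `HasScaling K F p k` provides, for every n, a Lipschitz perturbation of x ↦ Fx vanishing
outside the square, with elastic energy at most C·2⁻ᵖⁿ, whose gradient and phases have variation at
most C·2ᵏⁿ. The choice 2ⁿ ≈ ε^(-1/(k+p)) balances 2⁻ᵖⁿ against ε·2ᵏⁿ; both are then of order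
ε^(p/(k+p)) (`exists_scale`, `HasScaling.exists_energy_le`).

A well has order 0, with zero perturbation. The step (`HasScaling.laminate`) treats F = λA + (1-λ)J
with A a well and J of order k. A branched simple laminate of A and J is built at scale 2⁻ⁿ. Its
J-strips are cut into sheared rectangles with aspect ratio between one and two, and each receives an
affinely rescaled copy of the microstructure of J (`Lamination.fill`). Since J and the wells are
diagonal, a diagonal rescaling multiplies the residual ∇u - χ by a bounded factor only, and a shear
of slope s adds O(|s|) (`Cell.norm_cell_gradient_le`). Hence the new energy is bounded by the old
one plus Σ area·|s|^p plus the volume of a bad set. Variation scales like length: a copy in a cell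
of width w costs about w times the old variation, and Σ w ≲ 2ⁿ, which raises the exponent k by one.

What remains is a branched laminate with Σ area·|s|^p and bad volume of order 2⁻ᵖⁿ, and Σ w of order
2ⁿ (`exists_lamination`). The laminate oscillates in x i and refines as x j approaches 0 or 1: at
distance (1-(2M)⁻ˡ)/2 from the middle its period is 2⁻ⁿM⁻ˡ. Layer l has volume of order (2M)⁻ˡ and
slopes of order 2^(l-n), so its elastic energy is of order 2⁻ᵖⁿ(2^p/(2M))ˡ; its strips have total
length of order M·2ⁿ·2⁻ˡ. For M ≥ 2^p both series converge geometrically. At l = n the period equals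
(2M)⁻ⁿ, comparable to the distance left, so a smooth cut-off there keeps the gradient bounded on a
set of volume at most (2M)⁻ⁿ ≤ 2⁻ᵖⁿ.

Variation is measured on the whole plane, after extension by zero (`VarBound`). Jumps across
boundaries of cells are thereby counted, and the bound is additive and behaves well under affine
maps. -/

/-- `f` is integrable and its distributional partial derivatives are measures of mass `≤ B`. -/
def VarBound (f : Plane → ℝ) (B : ℝ) : Prop :=
  Integrable f ∧ ∀ (i : Fin 2) (φ : Plane → ℝ), ContDiff ℝ ∞ φ → HasCompactSupport φ →
    (∀ x, |φ x| ≤ 1) → |∫ x, f x * partialDeriv i φ x| ≤ B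

/-! ### Variation on the whole plane, tested against smooth functions -/

section PartialDeriv

lemma ContDiff.partialDeriv {φ : Plane → ℝ} (h : ContDiff ℝ ∞ φ) (i : Fin 2) :
    ContDiff ℝ ∞ (_root_.partialDeriv i φ) := by
  unfold _root_.partialDeriv
  exact (h.fderiv_right (m := ∞) le_rfl).clm_apply contDiff_const

lemma HasCompactSupport.partialDeriv {φ : Plane → ℝ} (h : HasCompactSupport φ) (i : Fin 2) :
    HasCompactSupport (_root_.partialDeriv i φ) :=
  h.fderiv_apply (𝕜 := ℝ) _

lemma tsupport_partialDeriv_subset (φ : Plane → ℝ) (i : Fin 2) :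
    tsupport (partialDeriv i φ) ⊆ tsupport φ :=
  tsupport_fderiv_apply_subset ℝ _

lemma exists_bound_partialDeriv {φ : Plane → ℝ} (h : ContDiff ℝ ∞ φ) (hc : HasCompactSupport φ)
    (i : Fin 2) : ∃ C, ∀ x, ‖partialDeriv i φ x‖ ≤ C :=
  (h.partialDeriv i).continuous.bounded_above_of_compact_support (hc.partialDeriv i)

lemma MeasureTheory.Integrable.mul_partialDeriv {f φ : Plane → ℝ} (hf : Integrable f) (h : ContDiff ℝ ∞ φ)
    (hc : HasCompactSupport φ) (i : Fin 2) :
    Integrable (fun x => f x * partialDeriv i φ x) := by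
  obtain ⟨C, hC⟩ := exists_bound_partialDeriv h hc i
  exact hf.mul_bdd (h.partialDeriv i).continuous.aestronglyMeasurable (.of_forall hC)

end PartialDeriv

namespace VarBound

variable {f g : Plane → ℝ} {B B' : ℝ}

lemma nonneg (h : VarBound f B) : 0 ≤ B := by
  have := h.2 0 (fun _ => 0) contDiff_const HasCompactSupport.zero (by simp)
  exact (abs_nonneg _).trans this

lemma mono (h : VarBound f B) (hB : B ≤ B') : VarBound f B' :=
  ⟨h.1, fun i φ h1 h2 h3 => (h.2 i φ h1 h2 h3).trans hB⟩

lemma congr_ae (h : VarBound f B) (hfg : f =ᵐ[volume] g) : VarBound g B := by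
  refine ⟨h.1.congr hfg, fun i φ h1 h2 h3 => ?_⟩
  rw [integral_congr_ae (g := fun x => f x * partialDeriv i φ x)]
  · exact h.2 i φ h1 h2 h3
  · filter_upwards [hfg] with x hx
    rw [hx]

lemma zero : VarBound (fun _ => 0) 0 :=
  ⟨integrable_zero _ _ _, fun i φ h1 h2 h3 => by simp⟩

lemma add (hf : VarBound f B) (hg : VarBound g B') : VarBound (fun x => f x + g x) (B + B') := by
  refine ⟨hf.1.add hg.1, fun i φ h1 h2 h3 => ?_⟩
  simp only [add_mul]
  rw [integral_add (hf.1.mul_partialDeriv h1 h2 i) (hg.1.mul_partialDeriv h1 h2 i)]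
  exact (abs_add_le _ _).trans (add_le_add (hf.2 i φ h1 h2 h3) (hg.2 i φ h1 h2 h3))

lemma const_mul (hf : VarBound f B) (c : ℝ) : VarBound (fun x => c * f x) (|c| * B) := by
  refine ⟨hf.1.const_mul c, fun i φ h1 h2 h3 => ?_⟩
  simp only [mul_assoc]
  rw [integral_const_mul, abs_mul]
  exact mul_le_mul_of_nonneg_left (hf.2 i φ h1 h2 h3) (abs_nonneg c)

lemma sub (hf : VarBound f B) (hg : VarBound g B') : VarBound (fun x => f x - g x) (B + B') := by
  have := hf.add (hg.const_mul (-1))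
  simpa [sub_eq_add_neg] using this

lemma sum {ι : Type*} (s : Finset ι) {F : ι → Plane → ℝ} {b : ι → ℝ}
    (h : ∀ c ∈ s, VarBound (F c) (b c)) : VarBound (fun x => ∑ c ∈ s, F c x) (∑ c ∈ s, b c) := by
  classical
  induction s using Finset.induction_on with
  | empty => simpa using zero
  | insert a s ha ih =>
    simp only [Finset.sum_insert ha]
    exact (h a (Finset.mem_insert_self _ _)).add
      (ih fun c hc => h c (Finset.mem_insert_of_mem hc))

/-- Multiplication by a smooth function bounded by one. -/
lemma smooth_mul {η b : Plane → ℝ} (hf : VarBound f B) (hη : ContDiff ℝ ∞ η)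
    (hη1 : ∀ x, |η x| ≤ 1) (hb : Integrable b)
    (hfb : ∀ i, ∀ᵐ x, |f x * partialDeriv i η x| ≤ b x) (hbB : ∫ x, b x ≤ B') :
    VarBound (fun x => η x * f x) (B + B') := by
  refine ⟨hf.1.bdd_mul hη.continuous.aestronglyMeasurable (.of_forall hη1),
    fun i φ h1 h2 h3 => ?_⟩
  have hηφ : ContDiff ℝ ∞ (fun x => η x * φ x) := hη.mul h1
  have hηφc : HasCompactSupport (fun x => η x * φ x) := h2.mul_left
  have hd : ∀ x, partialDeriv i (fun x => η x * φ x) x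
      = η x * partialDeriv i φ x + φ x * partialDeriv i η x := by
    intro x
    unfold partialDeriv
    rw [fderiv_fun_mul (hη.differentiable (by simp) x) (h1.differentiable (by simp) x)]
    simp
  have hle : ∀ᵐ x, ‖f x * (φ x * partialDeriv i η x)‖ ≤ b x := by
    filter_upwards [hfb i] with x hx
    rw [Real.norm_eq_abs]
    calc |f x * (φ x * partialDeriv i η x)| = |φ x| * |f x * partialDeriv i η x| := by
          rw [← abs_mul]; ring_nf
      _ ≤ 1 * |f x * partialDeriv i η x| := by gcongr; exact h3 x
      _ ≤ b x := by rw [one_mul]; exact hx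
  have hint2 : Integrable (fun x => f x * (φ x * partialDeriv i η x)) := by
    refine hb.mono' (hf.1.aestronglyMeasurable.mul ?_) hle
    exact (h1.continuous.mul (hη.partialDeriv i).continuous).aestronglyMeasurable
  -- Product rule η ∂φ = ∂(ηφ) - φ ∂η; since |η| ≤ 1, the product ηφ is again an admissible test
  -- function for `f`.
  have key : ∫ x, (η x * f x) * partialDeriv i φ x
      = (∫ x, f x * partialDeriv i (fun x => η x * φ x) x)
        - ∫ x, f x * (φ x * partialDeriv i η x) := by
    rw [← integral_sub (hf.1.mul_partialDeriv hηφ hηφc i) hint2]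
    refine integral_congr_ae (.of_forall fun x => ?_)
    simp only [hd]
    ring
  rw [key]
  refine (abs_sub _ _).trans (add_le_add (hf.2 i _ hηφ hηφc fun x => ?_) ?_)
  · rw [abs_mul]
    exact mul_le_one₀ (hη1 x) (abs_nonneg _) (h3 x)
  · exact (norm_integral_le_of_norm_le hb hle).trans hbB

end VarBound

/-- Integration by parts for a Lipschitz function whose partial derivative is known a.e. -/
lemma LipschitzWith.integral_mul_partialDeriv {L : NNReal} {f g : Plane → ℝ}
    (hf : LipschitzWith L f) (i : Fin 2)
    (hg : ∀ᵐ x, HasLineDerivAt ℝ f (g x) x (EuclideanSpace.single i 1)) {φ : Plane → ℝ}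
    (h1 : ContDiff ℝ ∞ φ) (h2 : HasCompactSupport φ) :
    ∫ x, f x * partialDeriv i φ x = - ∫ x, g x * φ x := by
  obtain ⟨D, hD⟩ := h1.lipschitzWith_of_hasCompactSupport h2 (by simp)
  have := LipschitzWith.integral_lineDeriv_mul_eq (μ := volume) hf hD h2
    (EuclideanSpace.single i (1 : ℝ))
  have e1 : ∫ x, lineDeriv ℝ f x (EuclideanSpace.single i 1) * φ x = ∫ x, g x * φ x := by
    refine integral_congr_ae ?_
    filter_upwards [hg] with x hx
    rw [hx.lineDeriv]
  have e2 : ∫ x, lineDeriv ℝ φ x (-EuclideanSpace.single i 1) * f x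
      = - ∫ x, f x * partialDeriv i φ x := by
    rw [← integral_neg]
    refine integral_congr_ae (.of_forall fun x => ?_)
    simp only [partialDeriv, (h1.differentiable (by simp) x).lineDeriv_eq_fderiv, map_neg]
    ring
  rw [e1, e2] at this
  linarith

/-- Integration by parts puts the derivative on `f`, where `b` dominates it. The Lipschitz constant
does not enter the bound, so it may depend on the scale in an uncontrolled way. -/
lemma LipschitzWith.varBound {L : NNReal} {f : Plane → ℝ} {g : Fin 2 → Plane → ℝ} {b : Plane → ℝ}
    {B : ℝ} (hf : LipschitzWith L f) (hc : HasCompactSupport f)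
    (hg : ∀ i, ∀ᵐ x, HasLineDerivAt ℝ f (g i x) x (EuclideanSpace.single i 1))
    (hb : Integrable b) (hgb : ∀ i, ∀ᵐ x, |g i x| ≤ b x) (hbB : ∫ x, b x ≤ B) :
    VarBound f B := by
  refine ⟨hf.continuous.integrable_of_hasCompactSupport hc, fun i φ h1 h2 h3 => ?_⟩
  rw [hf.integral_mul_partialDeriv i (hg i) h1 h2, abs_neg]
  refine (norm_integral_le_of_norm_le (f := fun x => g i x * φ x) hb ?_).trans hbB
  filter_upwards [hgb i] with x hx
  rw [norm_mul]
  calc ‖g i x‖ * ‖φ x‖ ≤ b x * 1 := by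
        gcongr
        · exact (abs_nonneg _).trans hx
        · exact hx
        · exact h3 x
    _ = b x := mul_one _

/-- Admissible fields are supported in Ω, so `f` may be replaced by an extension `F` to the plane.
Each entry of such a field is at most one in absolute value; the factor 2 counts the two partial
derivatives. -/
lemma totalVar_le {ι : Type} [Fintype ι] {Ω : Set Plane} (hΩ : MeasurableSet Ω)
    {f F : Plane → ι → ℝ} {B : ι → ℝ} (hF : ∀ a, VarBound (fun x => F x a) (B a))
    (hfF : ∀ x ∈ Ω, f x = F x) :
    totalVar Ω f ≤ ENNReal.ofReal (2 * ∑ a, B a) := by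
  unfold totalVar
  refine iSup₂_le fun φ hφ => ENNReal.ofReal_le_ofReal ?_
  have habs : ∀ a i x, |φ a i x| ≤ 1 := by
    intro a i x
    have h1 : φ a i x ^ 2 ≤ ∑ i, φ a i x ^ 2 :=
      Finset.single_le_sum (f := fun i => φ a i x ^ 2) (fun _ _ => sq_nonneg _) (Finset.mem_univ i)
    have h2 : ∑ i, φ a i x ^ 2 ≤ ∑ a, ∑ i, φ a i x ^ 2 :=
      Finset.single_le_sum (f := fun a => ∑ i, φ a i x ^ 2)
        (fun _ _ => Finset.sum_nonneg fun _ _ => sq_nonneg _) (Finset.mem_univ a)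
    exact (sq_le_one_iff_abs_le_one _).1 ((h1.trans h2).trans (hφ.2 x))
  have e1 : ∫ x in Ω, ∑ a, ∑ i, f x a * partialDeriv i (φ a i) x
      = ∫ x, ∑ a, ∑ i, F x a * partialDeriv i (φ a i) x := by
    rw [← setIntegral_eq_integral_of_forall_compl_eq_zero (s := Ω)
      (f := fun x => ∑ a, ∑ i, F x a * partialDeriv i (φ a i) x)]
    · refine setIntegral_congr_fun hΩ fun x hx => ?_
      simp only [hfF x hx]
    · intro x hx
      refine Finset.sum_eq_zero fun a _ => Finset.sum_eq_zero fun i _ => ?_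
      have : x ∉ tsupport (partialDeriv i (φ a i)) := fun h =>
        hx ((hφ.1 a i).2.2 (tsupport_partialDeriv_subset _ _ h))
      rw [image_eq_zero_of_notMem_tsupport this, mul_zero]
  have hint : ∀ a i, Integrable (fun x => F x a * partialDeriv i (φ a i) x) := fun a i =>
    (hF a).1.mul_partialDeriv (hφ.1 a i).1 (hφ.1 a i).2.1 i
  rw [e1, integral_finsetSum _ fun a _ => integrable_finsetSum _ fun i _ => hint a i,
    Finset.mul_sum]
  refine Finset.sum_le_sum fun a _ => ?_
  rw [integral_finsetSum _ fun i _ => hint a i, Fin.sum_univ_two, two_mul]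
  exact add_le_add
    ((le_abs_self _).trans ((hF a).2 0 _ (hφ.1 a 0).1 (hφ.1 a 0).2.1 (habs a 0)))
    ((le_abs_self _).trans ((hF a).2 1 _ (hφ.1 a 1).1 (hφ.1 a 1).2.1 (habs a 1)))

/-! ### The unit square: volume, Fubini, perimeter -/

lemma isOpen_unitSquare : IsOpen unitSquare := by
  have : unitSquare = ⋂ i : Fin 2, (fun x : Plane => x i) ⁻¹' Ioo (0 : ℝ) 1 := by
    ext x; simp [unitSquare]
  rw [this]
  exact isOpen_iInter_of_finite fun i => isOpen_Ioo.preimage (by fun_prop)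

lemma measurableSet_unitSquare : MeasurableSet unitSquare := isOpen_unitSquare.measurableSet

/-- The measurable equivalence of the plane with `ℝ × ℝ`. -/
noncomputable def planeEquivProd : Plane ≃ᵐ ℝ × ℝ :=
  (MeasurableEquiv.toLp 2 (Fin 2 → ℝ)).symm.trans MeasurableEquiv.finTwoArrow

lemma measurePreserving_planeEquivProd : MeasurePreserving planeEquivProd volume volume :=
  (volume_preserving_finTwoArrow ℝ).comp
    (EuclideanSpace.volume_preserving_symm_measurableEquiv_toLp (Fin 2))

lemma planeEquivProd_symm_apply (z : ℝ × ℝ) : planeEquivProd.symm z = !₂[z.1, z.2] := rfl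

lemma planeEquivProd_preimage_box (s t : Set ℝ) :
    planeEquivProd ⁻¹' (s ×ˢ t) = {x : Plane | x 0 ∈ s ∧ x 1 ∈ t} := rfl

lemma unitSquare_eq_preimage : unitSquare = planeEquivProd ⁻¹' (Ioo 0 1 ×ˢ Ioo 0 1) := by
  ext x
  simp [unitSquare, planeEquivProd_preimage_box, Fin.forall_fin_two]

lemma volume_box (s t : Set ℝ) :
    volume {x : Plane | x 0 ∈ s ∧ x 1 ∈ t} = volume s * volume t := by
  rw [← planeEquivProd_preimage_box, measurePreserving_planeEquivProd.measure_preimage_equiv,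
    Measure.volume_eq_prod, Measure.prod_prod]

lemma volume_unitSquare : volume unitSquare = 1 := by
  rw [unitSquare_eq_preimage, planeEquivProd_preimage_box, volume_box]
  simp

lemma setIntegral_unitSquare {g : Plane → ℝ} (hg : Continuous g) :
    ∫ x in unitSquare, g x = ∫ s in (0 : ℝ)..1, ∫ t in (0 : ℝ)..1, g !₂[s, t] := by
  have hc : Continuous fun z : ℝ × ℝ => g !₂[z.1, z.2] := by
    refine hg.comp ?_
    refine (PiLp.continuous_toLp 2 _).comp (continuous_pi fun i => ?_)
    fin_cases i
    · exact continuous_fst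
    · exact continuous_snd
  rw [unitSquare_eq_preimage]
  have h := measurePreserving_planeEquivProd.setIntegral_preimage_emb
    planeEquivProd.measurableEmbedding (fun z => g (planeEquivProd.symm z))
    (Ioo (0 : ℝ) 1 ×ˢ Ioo (0 : ℝ) 1)
  simp only [MeasurableEquiv.symm_apply_apply] at h
  rw [h]
  simp only [planeEquivProd_symm_apply]
  rw [Measure.volume_eq_prod, setIntegral_prod]
  · simp only [intervalIntegral.integral_of_le zero_le_one, integral_Ioc_eq_integral_Ioo]
  · exact (hc.continuousOn.integrableOn_compact (isCompact_Icc.prod isCompact_Icc)).mono_set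
      (prod_mono Ioo_subset_Icc_self Ioo_subset_Icc_self)

/-- By the fundamental theorem of calculus each line parallel to the i-th axis contributes a
difference of two values in [-1, 1]. -/
lemma abs_integral_partialDeriv_le {φ : Plane → ℝ} (h1 : ContDiff ℝ ∞ φ) (h3 : ∀ x, |φ x| ≤ 1)
    (i : Fin 2) : |∫ x in unitSquare, partialDeriv i φ x| ≤ 2 := by
  have hc : Continuous (partialDeriv i φ) := (h1.partialDeriv i).continuous
  have hline : ∀ γ : ℝ → Plane, (∀ t, HasDerivAt γ (EuclideanSpace.single i 1) t) →
      |∫ t in (0 : ℝ)..1, partialDeriv i φ (γ t)| ≤ 2 := by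
    intro γ hγ
    have hγc : Continuous γ := continuous_iff_continuousAt.2 fun t => (hγ t).continuousAt
    have : ∫ t in (0 : ℝ)..1, partialDeriv i φ (γ t) = φ (γ 1) - φ (γ 0) := by
      refine intervalIntegral.integral_eq_sub_of_hasDerivAt (f := fun t => φ (γ t)) (fun t _ => ?_)
        (hc.comp hγc).continuousOn.intervalIntegrable
      exact (h1.differentiable (by simp) (γ t)).hasFDerivAt.comp_hasDerivAt t (hγ t)
    rw [this]
    have := h3 (γ 1)
    have := h3 (γ 0)
    rw [abs_le] at *
    constructor <;> linarith
  rw [setIntegral_unitSquare hc]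
  have hcc : Continuous fun z : ℝ × ℝ => partialDeriv i φ !₂[z.1, z.2] := by
    refine hc.comp ((PiLp.continuous_toLp 2 _).comp (continuous_pi fun i => ?_))
    fin_cases i
    · exact continuous_fst
    · exact continuous_snd
  have hfin : ∀ F : ℝ → ℝ, (∀ s, |F s| ≤ 2) → |∫ s in (0 : ℝ)..1, F s| ≤ 2 := by
    intro F hF
    have := intervalIntegral.norm_integral_le_of_norm_le_const (a := (0 : ℝ)) (b := 1) (f := F)
      (C := 2) fun s _ => hF s
    simpa using this
  fin_cases i
  · have hsw : ∫ s in (0 : ℝ)..1, ∫ t in (0 : ℝ)..1, partialDeriv 0 φ !₂[s, t]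
        = ∫ t in (0 : ℝ)..1, ∫ s in (0 : ℝ)..1, partialDeriv 0 φ !₂[s, t] := by
      refine intervalIntegral_intervalIntegral_swap ?_
      exact (hcc.continuousOn.integrableOn_compact (isCompact_uIcc.prod isCompact_uIcc)).mono_set
          (prod_mono uIoc_subset_uIcc uIoc_subset_uIcc)
    change |∫ s in (0 : ℝ)..1, ∫ t in (0 : ℝ)..1, partialDeriv 0 φ !₂[s, t]| ≤ 2
    rw [hsw]
    refine hfin _ fun t => hline (fun s => !₂[s, t]) fun s => ?_
    have h : (fun s : ℝ => !₂[s, t]) = fun s => s • EuclideanSpace.single 0 1 + !₂[0, t] := by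
      funext s; ext k; fin_cases k <;> simp
    rw [h]
    simpa using ((hasDerivAt_id s).smul_const (EuclideanSpace.single (0 : Fin 2) (1 : ℝ))).add_const
      !₂[0, t]
  · refine hfin _ fun s => hline (fun t => !₂[s, t]) fun t => ?_
    have h : (fun t : ℝ => !₂[s, t]) = fun t => t • EuclideanSpace.single 1 1 + !₂[s, 0] := by
      funext t; ext k; fin_cases k <;> simp
    rw [h]
    simpa using ((hasDerivAt_id t).smul_const (EuclideanSpace.single (1 : Fin 2) (1 : ℝ))).add_const
      !₂[s, 0]

lemma VarBound.indicator_unitSquare : VarBound (unitSquare.indicator fun _ => (1 : ℝ)) 2 := by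
  refine ⟨(integrable_indicator_iff measurableSet_unitSquare).2
    (integrableOn_const (by simp [volume_unitSquare])), fun i φ h1 h2 h3 => ?_⟩
  have : ∀ x, unitSquare.indicator (fun _ => (1 : ℝ)) x * partialDeriv i φ x
      = unitSquare.indicator (fun x => partialDeriv i φ x) x := by
    intro x
    by_cases hx : x ∈ unitSquare <;> simp [hx]
  simp only [this]
  rw [integral_indicator measurableSet_unitSquare]
  exact abs_integral_partialDeriv_le h1 h3 i

/-- The affine map `x ↦ T (x - o)`. -/
noncomputable def affMap (T : Mat2) (o : Plane) (x : Plane) : Plane :=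
  Matrix.toEuclideanCLM (𝕜 := ℝ) T (x - o)

/-! ### Change of variables under affine maps -/

section AffMap

variable {T : Mat2} {o : Plane}

lemma det_toEuclideanCLM (T : Mat2) :
    LinearMap.det (Matrix.toEuclideanCLM (𝕜 := ℝ) T : Plane →ₗ[ℝ] Plane) = T.det := by
  rw [Matrix.coe_toEuclideanCLM_eq_toEuclideanLin, Matrix.toEuclideanLin, Matrix.toLpLin_eq_toLin,
    LinearMap.det_toLin]

/-- `affMap T o` as a homeomorphism. -/
noncomputable def affHomeo (T : Mat2) (o : Plane) (hT : T.det ≠ 0) : Plane ≃ₜ Plane where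
  toFun := affMap T o
  invFun y := Matrix.toEuclideanCLM (𝕜 := ℝ) T⁻¹ y + o
  left_inv x := by
    have : T⁻¹ * T = 1 := Matrix.nonsing_inv_mul T (isUnit_iff_ne_zero.2 hT)
    have h2 := congrArg (fun S => Matrix.toEuclideanCLM (𝕜 := ℝ) S (x - o)) this
    simp only [map_mul, map_one] at h2
    simp only [affMap]
    rw [← mul_apply_eq_comp, h2]
    simp
  right_inv y := by
    have : T * T⁻¹ = 1 := Matrix.mul_nonsing_inv T (isUnit_iff_ne_zero.2 hT)
    have h2 := congrArg (fun S => Matrix.toEuclideanCLM (𝕜 := ℝ) S y) this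
    simp only [map_mul, map_one] at h2
    simp only [affMap, add_sub_cancel_right]
    rw [← mul_apply_eq_comp, h2]
    simp
  continuous_toFun := by unfold affMap; fun_prop
  continuous_invFun := by fun_prop

lemma measurableEmbedding_affMap (hT : T.det ≠ 0) : MeasurableEmbedding (affMap T o) :=
  (affHomeo T o hT).measurableEmbedding

lemma map_affMap_volume (hT : T.det ≠ 0) :
    Measure.map (affMap T o) volume = ENNReal.ofReal |T.det⁻¹| • (volume : Measure Plane) := by
  have h1 : affMap T o = (Matrix.toEuclideanCLM (𝕜 := ℝ) T : Plane →ₗ[ℝ] Plane) ∘ fun x => x - o :=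
    rfl
  rw [h1, ← Measure.map_map, map_sub_right_eq_self,
    Measure.map_linearMap_addHaar_eq_smul_addHaar, det_toEuclideanCLM]
  · rwa [det_toEuclideanCLM]
  · exact (Matrix.toEuclideanCLM (𝕜 := ℝ) T).continuous.measurable
  · fun_prop

lemma integral_comp_affMap (hT : T.det ≠ 0) (g : Plane → ℝ) :
    ∫ x, g (affMap T o x) = |T.det⁻¹| * ∫ x, g x := by
  rw [← (measurableEmbedding_affMap hT).integral_map, map_affMap_volume hT, integral_smul_measure,
    ENNReal.toReal_ofReal (abs_nonneg _), smul_eq_mul]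

lemma integrable_comp_affMap (hT : T.det ≠ 0) {g : Plane → ℝ} (hg : Integrable g) :
    Integrable fun x => g (affMap T o x) := by
  have : Integrable g (Measure.map (affMap T o) volume) := by
    rw [map_affMap_volume hT]
    exact hg.smul_measure ENNReal.ofReal_ne_top
  exact (measurableEmbedding_affMap hT).integrable_map_iff.1 this

lemma setLIntegral_comp_affMap (hT : T.det ≠ 0) (s : Set Plane) (g : Plane → ℝ≥0∞) :
    ∫⁻ x in affMap T o ⁻¹' s, g (affMap T o x) = ENNReal.ofReal |T.det⁻¹| * ∫⁻ x in s, g x := by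
  rw [← (measurableEmbedding_affMap hT).lintegral_map, ← (measurableEmbedding_affMap hT).restrict_map,
    map_affMap_volume hT, Measure.restrict_smul, lintegral_smul_measure, smul_eq_mul]

lemma volume_preimage_affMap (hT : T.det ≠ 0) (s : Set Plane) :
    volume (affMap T o ⁻¹' s) = ENNReal.ofReal |T.det⁻¹| * volume s := by
  rw [← (measurableEmbedding_affMap hT).map_apply, map_affMap_volume hT]
  rfl

lemma ae_comp_affMap (hT : T.det ≠ 0) {P : Plane → Prop} (h : ∀ᵐ x, P x) :
    ∀ᵐ x, P (affMap T o x) := by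
  refine (measurableEmbedding_affMap hT).ae_map_iff.1 ?_
  rw [map_affMap_volume hT]
  exact Measure.ae_smul_measure h _

lemma hasFDerivAt_affMap (x : Plane) :
    HasFDerivAt (affMap T o) (Matrix.toEuclideanCLM (𝕜 := ℝ) T) x := by
  have := (Matrix.toEuclideanCLM (𝕜 := ℝ) T).hasFDerivAt.comp x ((hasFDerivAt_id x).sub_const o)
  exact this

lemma partialDeriv_comp_affMap {φ : Plane → ℝ} (h1 : ContDiff ℝ ∞ φ) (i : Fin 2) (x : Plane) :
    partialDeriv i (fun x => φ (affMap T o x)) x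
      = ∑ b, T b i * partialDeriv b φ (affMap T o x) := by
  unfold partialDeriv
  have := (h1.differentiable (by simp) (affMap T o x)).hasFDerivAt.comp x
    (hasFDerivAt_affMap (T := T) (o := o) x)
  have e : Matrix.toEuclideanCLM (𝕜 := ℝ) T (EuclideanSpace.single i (1 : ℝ))
      = ∑ b, T b i • EuclideanSpace.single b (1 : ℝ) := by
    ext k
    fin_cases k <;> simp [Matrix.ofLp_toEuclideanCLM]
  rw [show (fun x => φ (affMap T o x)) = φ ∘ affMap T o from rfl, this.fderiv,
    ContinuousLinearMap.comp_apply, e, map_sum]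
  simp

/-- The test function is transported by the inverse map. The chain rule brings in the i-th column of
`T`, the change of variables the inverse determinant. -/
lemma VarBound.comp_affMap {f : Plane → ℝ} {B B' : ℝ} (hT : T.det ≠ 0) (hf : VarBound f B)
    (hB : ∀ i, |T.det⁻¹| * ((|T 0 i| + |T 1 i|) * B) ≤ B') :
    VarBound (fun x => f (affMap T o x)) B' := by
  refine ⟨integrable_comp_affMap hT hf.1, fun i φ h1 h2 h3 => ?_⟩
  let ψ : Plane → ℝ := fun y => φ ((affHomeo T o hT).symm y)
  have hψ1 : ContDiff ℝ ∞ ψ := by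
    refine h1.comp ?_
    change ContDiff ℝ ∞ fun y => Matrix.toEuclideanCLM (𝕜 := ℝ) T⁻¹ y + o
    fun_prop
  have hψ2 : HasCompactSupport ψ := h2.comp_homeomorph (affHomeo T o hT).symm
  have hψ3 : ∀ x, |ψ x| ≤ 1 := fun x => h3 _
  have hφψ : φ = fun x => ψ (affMap T o x) := by
    funext x
    exact congrArg φ ((affHomeo T o hT).symm_apply_apply x).symm
  have hint := fun b => hf.1.mul_partialDeriv hψ1 hψ2 b
  have e : ∫ x, f (affMap T o x) * partialDeriv i φ x
      = |T.det⁻¹| * ((T 0 i * ∫ y, f y * partialDeriv 0 ψ y)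
        + T 1 i * ∫ y, f y * partialDeriv 1 ψ y) := by
    rw [← integral_const_mul, ← integral_const_mul,
      ← integral_add ((hint 0).const_mul _) ((hint 1).const_mul _), ← integral_comp_affMap hT]
    refine integral_congr_ae (.of_forall fun x => ?_)
    simp only
    rw [hφψ, partialDeriv_comp_affMap hψ1, Fin.sum_univ_two]
    ring
  rw [e, abs_mul, abs_abs]
  refine le_trans ?_ (hB i)
  gcongr
  rw [add_mul]
  refine (abs_add_le _ _).trans ?_
  rw [abs_mul, abs_mul]
  gcongr
  · exact hf.2 0 ψ hψ1 hψ2 hψ3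
  · exact hf.2 1 ψ hψ1 hψ2 hψ3

end AffMap

/-! ### Null hyperplanes and truncated linear ramps -/

lemma volume_level_set (L : Plane →L[ℝ] ℝ) (hL : L ≠ 0) (c : ℝ) : volume {x | L x = c} = 0 := by
  by_cases hne : ∃ x₀, L x₀ = c
  · obtain ⟨x₀, hx₀⟩ := hne
    have : {x | L x = c} = (fun x => x - x₀) ⁻¹' (LinearMap.ker (L : Plane →ₗ[ℝ] ℝ) : Set Plane) := by
      ext x
      simp [sub_eq_zero, hx₀]
    simp only [sub_eq_add_neg] at this
    rw [this, measure_preimage_add_right]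
    refine Measure.addHaar_submodule _ _ fun h => hL ?_
    ext x
    exact LinearMap.congr_fun (LinearMap.ker_eq_top.1 h) x
  · convert measure_empty (μ := (volume : Measure Plane))
    ext x
    simp only [mem_ofPred_eq, mem_empty_iff_false, iff_false]
    exact fun h => hne ⟨x, h⟩

lemma LipschitzWith.mul_of_bounded {X : Type*} [PseudoMetricSpace X] {f g : X → ℝ}
    {K L : NNReal} {a b : ℝ} (hf : LipschitzWith K f) (hg : LipschitzWith L g)
    (hfa : ∀ x, |f x| ≤ a) (hgb : ∀ x, |g x| ≤ b) :
    ∃ D, LipschitzWith D fun x => f x * g x := by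
  refine ⟨Real.toNNReal (a * L + b * K), LipschitzWith.of_dist_le_mul fun x y => ?_⟩
  have ha : 0 ≤ a := (abs_nonneg _).trans (hfa x)
  have hb : 0 ≤ b := (abs_nonneg _).trans (hgb x)
  rw [Real.coe_toNNReal _ (by positivity)]
  have h1 := hf.dist_le_mul x y
  have h2 := hg.dist_le_mul x y
  rw [Real.dist_eq] at *
  calc |f x * g x - f y * g y| = |f x * (g x - g y) + g y * (f x - f y)| := by ring_nf
    _ ≤ |f x| * |g x - g y| + |g y| * |f x - f y| := by
        refine (abs_add_le _ _).trans_eq ?_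
        rw [abs_mul, abs_mul]
    _ ≤ a * (L * dist x y) + b * (K * dist x y) := by
        gcongr
        · exact hfa x
        · exact hgb y
    _ = (a * L + b * K) * dist x y := by ring

/-- The projection of `z` to the interval `[0, W]`. -/
noncomputable def clampR (W z : ℝ) : ℝ := max 0 (min z W)

section clampR

variable {W z : ℝ}

lemma clampR_of_nonpos (hz : z ≤ 0) : clampR W z = 0 :=
  max_eq_left ((min_le_left _ _).trans hz)

lemma clampR_of_ge (hW : 0 ≤ W) (hz : W ≤ z) : clampR W z = W := by
  rw [clampR, min_eq_right hz, max_eq_right hW]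

lemma clampR_of_mem (h0 : 0 ≤ z) (hz : z ≤ W) : clampR W z = z := by
  rw [clampR, min_eq_left hz, max_eq_right h0]

lemma clampR_nonneg : 0 ≤ clampR W z := le_max_left _ _

lemma clampR_le (hW : 0 ≤ W) : clampR W z ≤ W := max_le hW (min_le_right _ _)

lemma clampR_mono : Monotone (clampR W) := fun _ _ h =>
  max_le_max le_rfl (min_le_min h le_rfl)

lemma lipschitzWith_clampR : LipschitzWith 1 (clampR W) :=
  (LipschitzWith.id.min_const W).const_max 0

lemma clampR_add {a b : ℝ} (ha : 0 ≤ a) (hb : 0 ≤ b) (z : ℝ) :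
    clampR a z + clampR b (z - a) = clampR (a + b) z := by
  rcases le_total z 0 with h | h
  · rw [clampR_of_nonpos h, clampR_of_nonpos h, clampR_of_nonpos (by linarith), add_zero]
  rcases le_total z a with h1 | h1
  · rw [clampR_of_mem h h1, clampR_of_nonpos (by linarith), clampR_of_mem h (by linarith), add_zero]
  rcases le_total z (a + b) with h2 | h2
  · rw [clampR_of_ge ha h1, clampR_of_mem (by linarith) (by linarith), clampR_of_mem h h2]
    ring
  · rw [clampR_of_ge ha h1, clampR_of_ge hb (by linarith), clampR_of_ge (by linarith) h2]

/-- Ramps laid end to end form one long ramp. This fuses adjacent strips into a wider one and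
evaluates equally spaced sums. -/
lemma sum_clampR {w : ℝ} (hw : 0 ≤ w) (z : ℝ) (m : ℕ) :
    ∑ k ∈ Finset.range m, clampR w (z - k * w) = clampR (m * w) z := by
  induction m with
  | zero => simp [clampR]
  | succ m ih =>
    rw [Finset.sum_range_succ, ih, clampR_add (by positivity) hw]
    push_cast
    ring_nf

/-- Comparison of a ramp of height `(1 - lam) * H` with the rescaled ramp of height `H`. -/
lemma le_clampR_shrink {lam H : ℝ} (h0 : 0 ≤ lam) (h1 : lam ≤ 1) (hH : 0 ≤ H) (z : ℝ) :
    (1 - lam) * clampR H z ≤ clampR ((1 - lam) * H) z := by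
  have h2 : 0 ≤ (1 - lam) * H := mul_nonneg (by linarith) hH
  rcases le_total z 0 with h | h
  · rw [clampR_of_nonpos h, clampR_of_nonpos h, mul_zero]
  refine le_max_of_le_right (le_min ?_ ?_)
  · rcases le_total z H with h3 | h3
    · rw [clampR_of_mem h h3]; nlinarith
    · rw [clampR_of_ge hH h3]; nlinarith
  · exact mul_le_mul_of_nonneg_left (clampR_le hH) (by linarith)

lemma clampR_shrink_le {lam H : ℝ} (h0 : 0 ≤ lam) (h1 : lam ≤ 1) (hH : 0 ≤ H) (z : ℝ) :
    clampR ((1 - lam) * H) z ≤ (1 - lam) * clampR H (z + lam * H) := by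
  have h2 : 0 ≤ (1 - lam) * H := mul_nonneg (by linarith) hH
  have h3 : 0 ≤ lam * H := mul_nonneg h0 hH
  rcases le_total z 0 with h | h
  · rw [clampR_of_nonpos h]
    exact mul_nonneg (by linarith) clampR_nonneg
  rcases le_total z ((1 - lam) * H) with h4 | h4
  · rw [clampR_of_mem h h4, clampR_of_mem (by linarith) (by linarith)]
    nlinarith
  · rw [clampR_of_ge h2 h4, clampR_of_ge hH (by linarith)]

lemma abs_clampR_sub_le (a b : ℝ) : |clampR W a - clampR W b| ≤ |a - b| := by
  simpa [Real.dist_eq] using lipschitzWith_clampR.dist_le_mul (K := 1) a b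

end clampR

/-- Division with remainder of the index: it groups the finest strips according to the strip of a
coarser layer that contains them. -/
lemma sum_range_mul_eq {α : Type*} [AddCommMonoid α] (F : ℕ → α) (a m : ℕ) :
    ∑ s ∈ Finset.range (a * m), F s
      = ∑ σ ∈ Finset.range a, ∑ k ∈ Finset.range m, F (σ * m + k) := by
  induction a with
  | zero => simp
  | succ a ih => rw [Nat.succ_mul, Finset.sum_range_add, ih, Finset.sum_range_succ]

/-! ### Geometry of the branched lamination -/

section Branching

variable (lam : ℝ) (M n : ℕ)

/-- The distances from the centre at which the branched lamination refines. -/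
noncomputable def node (l : ℕ) : ℝ := (1 - (1 / (2 * M) : ℝ) ^ l) / 2

/-- The height of a layer. -/
noncomputable def layerHeight (l : ℕ) : ℝ := node M (l + 1) - node M l

/-- The period of the lamination at a node. -/
noncomputable def period (l : ℕ) : ℝ := 1 / (2 ^ n * M ^ l)

/-- The number of strips in a layer. -/
def stripCount (l : ℕ) : ℕ := 2 ^ n * M ^ (l + 1)

/-- The width of the strips in a layer. -/
noncomputable def stripWidth (l : ℕ) : ℝ := (1 - lam) * period M n (l + 1)

/-- The coordinate in `[0, 1]` of the distance `r` in a layer. -/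
noncomputable def layerCoord (l : ℕ) (r : ℝ) : ℝ := clampR 1 ((r - node M l) / layerHeight M l)

/-- The shift of the finest strip `s` at a node. -/
noncomputable def stripShift (l s : ℕ) : ℝ := period M n l * ((s / M ^ (n + 1 - l) : ℕ) + 1)

/-- The lower boundary of the finest strip `s`. -/
noncomputable def finePath (s : ℕ) (r : ℝ) : ℝ :=
  s * stripWidth lam M n n + lam * (stripShift M n 0 s
    + ∑ l ∈ Finset.range (n + 1), layerCoord M l r * (stripShift M n (l + 1) s - stripShift M n l s))

/-- The branched sawtooth profile, with slopes `1 - lam` and `-lam`. -/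
noncomputable def profile (r y : ℝ) : ℝ :=
  (1 - lam) * clampR 1 y
    - ∑ s ∈ Finset.range (stripCount M n n), clampR (stripWidth lam M n n) (y - finePath lam M n s r)

/-- The position of a strip at the inner end of a layer. -/
noncomputable def startPos (l σ : ℕ) : ℝ :=
  σ * stripWidth lam M n l + lam * (period M n l * ((σ / M : ℕ) + 1))

/-- The position of a strip at the outer end of a layer. -/
noncomputable def endPos (l σ : ℕ) : ℝ :=
  σ * stripWidth lam M n l + lam * (period M n (l + 1) * (σ + 1))

/-- The slope of a strip in a layer. -/
noncomputable def stripSlope (l σ : ℕ) : ℝ :=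
  (endPos lam M n l σ - startPos lam M n l σ) / layerHeight M l

/-- The lower boundary of a strip in a layer. -/
noncomputable def stripPath (l σ : ℕ) (r : ℝ) : ℝ :=
  startPos lam M n l σ + stripSlope lam M n l σ * (r - node M l)

variable {lam M n}

lemma layerHeight_eq (l : ℕ) :
    layerHeight M l = (1 / (2 * M) : ℝ) ^ l * (1 - 1 / (2 * M)) / 2 := by
  unfold layerHeight node
  ring

lemma inv_two_mul_le (hM : 4 ≤ M) : (1 / (2 * M) : ℝ) ≤ 1 / 8 := by
  have : (4 : ℝ) ≤ M := by exact_mod_cast hM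
  apply one_div_le_one_div_of_le <;> linarith

lemma layerHeight_pos (hM : 4 ≤ M) (l : ℕ) : 0 < layerHeight M l := by
  have h1 := inv_two_mul_le hM
  have : (0 : ℝ) < M := by exact_mod_cast (by omega : 0 < M)
  rw [layerHeight_eq]
  have : (0 : ℝ) < 1 - 1 / (2 * M) := by linarith
  positivity

lemma node_zero : node M 0 = 0 := by simp [node]

lemma node_strictMono (hM : 4 ≤ M) : StrictMono (node M) :=
  strictMono_nat_of_lt_succ fun l => sub_pos.1 (layerHeight_pos hM l)

lemma node_nonneg (hM : 4 ≤ M) (l : ℕ) : 0 ≤ node M l := by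
  rw [← node_zero (M := M)]
  exact (node_strictMono hM).monotone l.zero_le

lemma node_lt_half (hM : 4 ≤ M) (l : ℕ) : node M l < 1 / 2 := by
  have : (0 : ℝ) < M := by exact_mod_cast (by omega : 0 < M)
  have : (0 : ℝ) < (1 / (2 * M)) ^ l := by positivity
  unfold node
  linarith

lemma period_pos (hM : 4 ≤ M) (l : ℕ) : 0 < period M n l := by
  have : (0 : ℝ) < M := by exact_mod_cast (by omega : 0 < M)
  unfold period
  positivity

lemma period_eq_mul (hM : 4 ≤ M) (l : ℕ) : period M n l = M * period M n (l + 1) := by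
  have : (0 : ℝ) < M := by exact_mod_cast (by omega : 0 < M)
  unfold period
  field_simp
  ring

lemma stripCount_mul_period (hM : 4 ≤ M) (l : ℕ) :
    (stripCount M n l : ℝ) * period M n (l + 1) = 1 := by
  have : (0 : ℝ) < M := by exact_mod_cast (by omega : 0 < M)
  unfold period stripCount
  push_cast
  field_simp

lemma layerCoord_eq_one (hM : 4 ≤ M) {l : ℕ} {r : ℝ} (hr : node M (l + 1) ≤ r) :
    layerCoord M l r = 1 := by
  refine clampR_of_ge zero_le_one ?_
  rw [le_div_iff₀ (layerHeight_pos hM l), one_mul]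
  exact sub_le_sub_right hr _

lemma layerCoord_eq_zero (hM : 4 ≤ M) {l : ℕ} {r : ℝ} (hr : r ≤ node M l) :
    layerCoord M l r = 0 :=
  clampR_of_nonpos (div_nonpos_of_nonpos_of_nonneg (by linarith) (layerHeight_pos hM l).le)

lemma layerCoord_eq (hM : 4 ≤ M) {l : ℕ} {r : ℝ} (hr : r ∈ Icc (node M l) (node M (l + 1))) :
    layerCoord M l r = (r - node M l) / layerHeight M l := by
  have := layerHeight_pos hM l
  refine clampR_of_mem (div_nonneg (by linarith [hr.1]) this.le) ?_
  rw [div_le_one this]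
  exact sub_le_sub_right hr.2 _

/-- In a layer the finest strips move in groups. -/
lemma finePath_eq (hM : 4 ≤ M) {l : ℕ} (hl : l ≤ n) {r : ℝ}
    (hr : r ∈ Icc (node M l) (node M (l + 1))) (σ : ℕ) {k : ℕ} (hk : k < M ^ (n - l)) :
    finePath lam M n (σ * M ^ (n - l) + k) r
      = stripPath lam M n l σ r + k * stripWidth lam M n n := by
  have hmono := (node_strictMono hM).monotone
  set s := σ * M ^ (n - l) + k with hs
  have hm : 0 < M ^ (n - l) := by positivity
  -- Layers already crossed contribute their full increments, which telescope; layers not yet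
  -- reached contribute nothing; only layer `l` is partially crossed.
  have htel : ∑ l' ∈ Finset.range (n + 1),
      layerCoord M l' r * (stripShift M n (l' + 1) s - stripShift M n l' s)
      = (stripShift M n l s - stripShift M n 0 s)
        + layerCoord M l r * (stripShift M n (l + 1) s - stripShift M n l s) := by
    have : n + 1 = (l + 1) + (n - l) := by omega
    rw [this, Finset.sum_range_add, Finset.sum_range_succ]
    have h1 : ∑ l' ∈ Finset.range l,
        layerCoord M l' r * (stripShift M n (l' + 1) s - stripShift M n l' s)
        = ∑ l' ∈ Finset.range l, (stripShift M n (l' + 1) s - stripShift M n l' s) := by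
      refine Finset.sum_congr rfl fun l' hl' => ?_
      rw [layerCoord_eq_one hM, one_mul]
      exact (hmono (Finset.mem_range.1 hl')).trans hr.1
    rw [h1]
    have h2 : ∑ x ∈ Finset.range (n - l), layerCoord M (l + 1 + x) r *
        (stripShift M n (l + 1 + x + 1) s - stripShift M n (l + 1 + x) s) = 0 := by
      refine Finset.sum_eq_zero fun x _ => ?_
      rw [layerCoord_eq_zero hM, zero_mul]
      exact hr.2.trans (hmono (by omega))
    rw [h2, add_zero, Finset.sum_range_sub fun l => stripShift M n l s]
  -- The `M ^ (n - l)` finest strips of group `σ` have the same quotient at level `l + 1`, and so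
  -- also at the coarser level `l`: they share their shifts and stay adjacent.
  have hS1 : stripShift M n (l + 1) s = period M n (l + 1) * (σ + 1) := by
    have : s / M ^ (n + 1 - (l + 1)) = σ := by
      rw [show n + 1 - (l + 1) = n - l by omega, hs, mul_comm, Nat.mul_add_div hm,
        Nat.div_eq_of_lt hk, add_zero]
    rw [stripShift, this]
  have hS0 : stripShift M n l s = period M n l * ((σ / M : ℕ) + 1) := by
    have : s / M ^ (n + 1 - l) = σ / M := by
      rw [show n + 1 - l = (n - l) + 1 by omega, pow_succ, ← Nat.div_div_eq_div_mul, hs, mul_comm,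
        Nat.mul_add_div hm, Nat.div_eq_of_lt hk, add_zero]
    rw [stripShift, this]
  have hw : (M : ℝ) ^ (n - l) * stripWidth lam M n n = stripWidth lam M n l := by
    have : (0 : ℝ) < M := by exact_mod_cast (by omega : 0 < M)
    unfold stripWidth period
    rw [show n + 1 = (n - l) + (l + 1) by omega, pow_add (M : ℝ) (n - l) (l + 1)]
    field_simp
  rw [finePath, htel, hS1, hS0, layerCoord_eq hM hr, stripPath, stripSlope, startPos, endPos, ← hw,
    hs]
  push_cast
  ring

lemma stripWidth_pos (h1 : lam < 1) (hM : 4 ≤ M) (l : ℕ) : 0 < stripWidth lam M n l :=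
  mul_pos (by linarith) (period_pos hM _)

/-- The finest strips of a group are adjacent, so their ramps concatenate to one ramp of the layer's
own width. Defining the profile by the finest strips yields one formula for all layers, so nothing
has to be glued at the nodes; the present form serves computations inside a layer. -/
lemma profile_eq (h1 : lam < 1) (hM : 4 ≤ M) {l : ℕ} (hl : l ≤ n) {r : ℝ}
    (hr : r ∈ Icc (node M l) (node M (l + 1))) (y : ℝ) :
    profile lam M n r y = (1 - lam) * clampR 1 y
      - ∑ σ ∈ Finset.range (stripCount M n l),
          clampR (stripWidth lam M n l) (y - stripPath lam M n l σ r) := by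
  have hw : ((M ^ (n - l) : ℕ) : ℝ) * stripWidth lam M n n = stripWidth lam M n l := by
    have : (0 : ℝ) < M := by exact_mod_cast (by omega : 0 < M)
    unfold stripWidth period
    rw [show n + 1 = (n - l) + (l + 1) by omega, pow_add (M : ℝ) (n - l) (l + 1)]
    push_cast
    field_simp
  have hc : stripCount M n n = stripCount M n l * M ^ (n - l) := by
    unfold stripCount
    rw [mul_assoc, ← pow_add]
    congr 2
    omega
  rw [profile, hc, sum_range_mul_eq]
  congr 1
  refine Finset.sum_congr rfl fun σ _ => ?_
  rw [← hw, ← sum_clampR (stripWidth_pos h1 hM n).le]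
  refine Finset.sum_congr rfl fun k hk => ?_
  rw [finePath_eq hM hl hr σ (Finset.mem_range.1 hk)]
  congr 1
  ring

/-- Positions in a layer are convex combinations of the positions at its ends. -/
lemma stripPath_eq (hM : 4 ≤ M) {l : ℕ} {r : ℝ}
    (hr : r ∈ Icc (node M l) (node M (l + 1))) :
    ∃ t ∈ Icc (0 : ℝ) 1, ∀ σ, stripPath lam M n l σ r
      = (1 - t) * startPos lam M n l σ + t * endPos lam M n l σ := by
  have := layerHeight_pos hM l
  refine ⟨(r - node M l) / layerHeight M l, ⟨div_nonneg (by linarith [hr.1]) this.le, ?_⟩,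
    fun σ => ?_⟩
  · rw [div_le_one this]
    exact sub_le_sub_right hr.2 _
  · rw [stripPath, stripSlope]
    field_simp
    ring

lemma shift_le (hM : 4 ≤ M) (σ : ℕ) :
    (σ : ℝ) + 1 ≤ M * ((σ / M : ℕ) + 1) ∧ (M : ℝ) * ((σ / M : ℕ) + 1) ≤ σ + M := by
  have h1 := Nat.div_add_mod σ M
  have h2 := Nat.mod_lt σ (by omega : M > 0)
  constructor
  · exact_mod_cast (by rw [mul_add]; omega : σ + 1 ≤ M * (σ / M + 1))
  · exact_mod_cast (by rw [mul_add]; omega : M * (σ / M + 1) ≤ σ + M)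

/-- In units of the finer period: at the inner end the `M` strips with equal quotient `σ / M` touch
each other and together form one strip of the coarser lamination. -/
lemma startPos_eq (hM : 4 ≤ M) (l σ : ℕ) : startPos lam M n l σ
    = period M n (l + 1) * ((1 - lam) * σ + lam * (M * ((σ / M : ℕ) + 1))) := by
  rw [startPos, stripWidth, period_eq_mul hM l]
  ring

/-- At the outer end the strips have separated: strip `σ` fills the last fraction `1 - lam` of the
σ-th period of the finer lamination. -/
lemma endPos_eq (l σ : ℕ) : endPos lam M n l σ = period M n (l + 1) * (σ + lam) := by
  rw [endPos, stripWidth]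
  ring

lemma startPos_bounds (h0 : 0 ≤ lam) (h1 : lam < 1) (hM : 4 ≤ M) (l σ : ℕ) :
    period M n (l + 1) * σ ≤ startPos lam M n l σ ∧
      startPos lam M n l σ ≤ period M n (l + 1) * (σ + M) := by
  have hp := period_pos (n := n) hM (l + 1)
  obtain ⟨h2, h3⟩ := shift_le hM σ
  have hM0 : (0 : ℝ) ≤ M := by positivity
  rw [startPos_eq hM]
  constructor <;> refine mul_le_mul_of_nonneg_left ?_ hp.le <;> nlinarith

lemma endPos_bounds (h0 : 0 ≤ lam) (h1 : lam < 1) (hM : 4 ≤ M) (l σ : ℕ) :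
    period M n (l + 1) * σ ≤ endPos lam M n l σ ∧
      endPos lam M n l σ ≤ period M n (l + 1) * (σ + M) := by
  have hp := period_pos (n := n) hM (l + 1)
  have : (4 : ℝ) ≤ M := by exact_mod_cast hM
  rw [endPos_eq]
  constructor <;> refine mul_le_mul_of_nonneg_left ?_ hp.le <;> linarith

lemma stripPath_bounds (h0 : 0 ≤ lam) (h1 : lam < 1) (hM : 4 ≤ M) {l : ℕ} {r : ℝ}
    (hr : r ∈ Icc (node M l) (node M (l + 1))) (σ : ℕ) :
    period M n (l + 1) * σ ≤ stripPath lam M n l σ r ∧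
      stripPath lam M n l σ r ≤ period M n (l + 1) * (σ + M) := by
  obtain ⟨t, ht, h⟩ := stripPath_eq (lam := lam) (n := n) hM hr
  obtain ⟨a1, a2⟩ := startPos_bounds (n := n) h0 h1 hM l σ
  obtain ⟨b1, b2⟩ := endPos_bounds (n := n) h0 h1 hM l σ
  rw [h]
  have := ht.1
  have := ht.2
  constructor <;> nlinarith

/-- Positions are affine across a layer, so order and separation need checking only at its two ends.
This is what makes the strips disjoint. -/
lemma stripPath_gap (h0 : 0 ≤ lam) (h1 : lam < 1) (hM : 4 ≤ M) {l : ℕ} {r : ℝ}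
    (hr : r ∈ Icc (node M l) (node M (l + 1))) {σ σ' : ℕ} (hσ : σ < σ') :
    stripPath lam M n l σ r + stripWidth lam M n l ≤ stripPath lam M n l σ' r := by
  obtain ⟨t, ht, h⟩ := stripPath_eq (lam := lam) (n := n) hM hr
  have hp := period_pos (n := n) hM (l + 1)
  have hσ' : (σ : ℝ) + 1 ≤ σ' := by exact_mod_cast hσ
  have hdiv : (M : ℝ) * ((σ / M : ℕ) : ℝ) ≤ M * ((σ' / M : ℕ) : ℝ) := by
    gcongr
  have hE : endPos lam M n l σ + stripWidth lam M n l ≤ endPos lam M n l σ' := by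
    rw [endPos_eq, endPos_eq, stripWidth]
    nlinarith
  have hS : startPos lam M n l σ + stripWidth lam M n l ≤ startPos lam M n l σ' := by
    rw [startPos_eq hM, startPos_eq hM, stripWidth, mul_comm (1 - lam) (period M n (l + 1)), ← mul_add]
    refine mul_le_mul_of_nonneg_left ?_ hp.le
    nlinarith
  rw [h, h]
  nlinarith [ht.1, ht.2]

lemma stripPath_add_le_one (h0 : 0 ≤ lam) (h1 : lam < 1) (hM : 4 ≤ M) {l : ℕ} {r : ℝ}
    (hr : r ∈ Icc (node M l) (node M (l + 1))) {σ : ℕ} (hσ : σ < stripCount M n l) :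
    stripPath lam M n l σ r + stripWidth lam M n l ≤ 1 := by
  obtain ⟨t, ht, h⟩ := stripPath_eq (lam := lam) (n := n) hM hr
  have hp := period_pos (n := n) hM (l + 1)
  have hc := stripCount_mul_period (n := n) hM l
  have hσ' : (σ : ℝ) + 1 ≤ stripCount M n l := by exact_mod_cast hσ
  have hdiv : (M : ℝ) * ((σ / M : ℕ) + 1) ≤ stripCount M n l := by
    have h2 : stripCount M n l = M * (2 ^ n * M ^ l) := by unfold stripCount; ring
    have h3 : σ / M < 2 ^ n * M ^ l := Nat.div_lt_of_lt_mul (h2 ▸ hσ)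
    have : M * (σ / M + 1) ≤ stripCount M n l := h2 ▸ Nat.mul_le_mul_left M h3
    exact_mod_cast this
  have hE : endPos lam M n l σ + stripWidth lam M n l ≤ 1 := by
    rw [endPos_eq, stripWidth]
    nlinarith
  have hS : startPos lam M n l σ + stripWidth lam M n l ≤ 1 := by
    rw [startPos_eq hM, stripWidth, mul_comm (1 - lam) (period M n (l + 1)), ← mul_add]
    refine le_of_le_of_eq ?_ ((mul_comm _ _).trans hc)
    refine mul_le_mul_of_nonneg_left ?_ hp.le
    nlinarith
  rw [h]
  nlinarith [ht.1, ht.2]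

lemma pow_ratio_le_layerHeight (hM : 4 ≤ M) (l : ℕ) :
    7 / 16 * (1 / (2 ^ l * M ^ l)) ≤ layerHeight M l := by
  have h1 := inv_two_mul_le hM
  have : (0 : ℝ) < M := by exact_mod_cast (by omega : 0 < M)
  have e : (1 / (2 * M) : ℝ) ^ l = 1 / (2 ^ l * M ^ l) := by
    rw [one_div_pow, mul_pow]
  rw [layerHeight_eq, e]
  have : (0 : ℝ) < 1 / (2 ^ l * M ^ l) := by positivity
  nlinarith

lemma layerHeight_le (hM : 4 ≤ M) (l : ℕ) : layerHeight M l ≤ 1 / (2 ^ l * M ^ l) := by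
  have h1 := inv_two_mul_le hM
  have : (0 : ℝ) < M := by exact_mod_cast (by omega : 0 < M)
  have e : (1 / (2 * M) : ℝ) ^ l = 1 / (2 ^ l * M ^ l) := by
    rw [one_div_pow, mul_pow]
  rw [layerHeight_eq, e]
  have : (0 : ℝ) < 1 / (2 ^ l * M ^ l) := by positivity
  have : (0 : ℝ) < 1 / (2 * M) := by positivity
  nlinarith

/-- Period and layer height are 2⁻ⁿM⁻ˡ and about (2M)⁻ˡ/2, so their ratio grows like 2^(l-n), and
they become comparable at `l = n`. The constant 3 exceeds 16/7, where 7/16 = (1 - 1/8)/2 comes from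
`M ≥ 4`. -/
lemma period_le_layerHeight (hM : 4 ≤ M) (l : ℕ) :
    period M n l ≤ 3 * ((2 : ℝ) ^ l / 2 ^ n) * layerHeight M l := by
  have h := pow_ratio_le_layerHeight hM l
  have hM0 : (0 : ℝ) < M := by exact_mod_cast (by omega : 0 < M)
  have e : period M n l = ((2 : ℝ) ^ l / 2 ^ n) * (1 / (2 ^ l * M ^ l)) := by
    unfold period
    field_simp
  rw [e]
  have : (0 : ℝ) < (2 : ℝ) ^ l / 2 ^ n := by positivity
  have : (0 : ℝ) < 1 / (2 ^ l * M ^ l) := by positivity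
  nlinarith

lemma two_pow_div_le_one {l : ℕ} (hl : l ≤ n) : ((2 : ℝ) ^ l / 2 ^ n) ≤ 1 := by
  rw [div_le_one (by positivity)]
  exact pow_le_pow_right₀ (by norm_num) hl

/-- While crossing the layer a strip moves by at most one period of the coarser lamination. -/
lemma abs_stripSlope_le (h0 : 0 ≤ lam) (h1 : lam < 1) (hM : 4 ≤ M) (l σ : ℕ) :
    |stripSlope lam M n l σ| ≤ 3 * ((2 : ℝ) ^ l / 2 ^ n) := by
  have hh := layerHeight_pos hM l
  have hp := period_pos (n := n) hM (l + 1)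
  obtain ⟨h2, h3⟩ := shift_le hM σ
  have h4 := period_le_layerHeight (n := n) hM l
  have hM4 : (4 : ℝ) ≤ M := by exact_mod_cast hM
  rw [stripSlope, abs_div, abs_of_pos hh, div_le_iff₀ hh]
  refine le_trans ?_ h4
  have e : endPos lam M n l σ - startPos lam M n l σ
      = period M n (l + 1) * (lam * ((σ + 1) - M * ((σ / M : ℕ) + 1))) := by
    rw [endPos_eq, startPos_eq hM]
    ring
  rw [e, abs_mul, abs_of_pos hp, period_eq_mul hM l,
    mul_comm (M : ℝ) (period M n (l + 1))]
  refine mul_le_mul_of_nonneg_left ?_ hp.le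
  rw [abs_le]
  constructor <;> nlinarith

/-- The width is at most the coarser period divided by `M`, hence at most 3/M times the layer
height; `M ≥ 4` suffices. Every strip is therefore long enough for at least one piece of length no
less than its width. -/
lemma stripWidth_le_layerHeight (h0 : 0 ≤ lam) (hM : 4 ≤ M) {l : ℕ} (hl : l ≤ n) :
    stripWidth lam M n l ≤ layerHeight M l := by
  have hp := period_pos (n := n) hM (l + 1)
  have hM4 : (4 : ℝ) ≤ M := by exact_mod_cast hM
  have h2 := period_le_layerHeight (n := n) hM l
  have h3 := two_pow_div_le_one hl
  have hh := layerHeight_pos hM l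
  rw [period_eq_mul hM l] at h2
  rw [stripWidth]
  nlinarith

lemma profile_of_le_zero (h0 : 0 ≤ lam) (h1 : lam < 1) (hM : 4 ≤ M) {l : ℕ} (hl : l ≤ n) {r : ℝ}
    (hr : r ∈ Icc (node M l) (node M (l + 1))) {y : ℝ} (hy : y ≤ 0) : profile lam M n r y = 0 := by
  rw [profile_eq h1 hM hl hr, clampR_of_nonpos hy, mul_zero, zero_sub, neg_eq_zero]
  refine Finset.sum_eq_zero fun σ _ => clampR_of_nonpos ?_
  have h2 := (stripPath_bounds (n := n) h0 h1 hM hr σ).1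
  have := (period_pos (n := n) hM (l + 1)).le
  have : 0 ≤ period M n (l + 1) * σ := by positivity
  linarith

/-- Above `y = 1` every ramp is complete, and the widths add up to `1 - lam`, which cancels the
linear term. -/
lemma profile_of_one_le (h0 : 0 ≤ lam) (h1 : lam < 1) (hM : 4 ≤ M) {l : ℕ} (hl : l ≤ n) {r : ℝ}
    (hr : r ∈ Icc (node M l) (node M (l + 1))) {y : ℝ} (hy : 1 ≤ y) : profile lam M n r y = 0 := by
  rw [profile_eq h1 hM hl hr, clampR_of_ge zero_le_one hy]
  have : ∀ σ ∈ Finset.range (stripCount M n l),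
      clampR (stripWidth lam M n l) (y - stripPath lam M n l σ r) = stripWidth lam M n l := by
    intro σ hσ
    refine clampR_of_ge (stripWidth_pos h1 hM l).le ?_
    linarith [stripPath_add_le_one (n := n) h0 h1 hM hr (Finset.mem_range.1 hσ)]
  rw [Finset.sum_congr rfl this, Finset.sum_const, Finset.card_range, nsmul_eq_mul, stripWidth,
    mul_left_comm, stripCount_mul_period hM]
  ring

/-- With `H` the finer period, strip `σ` starts between `σ * H` and `(σ + M) * H`. Comparison with
equally spaced ramps of width `H` squeezes the sum between `(1 - lam) * clampR 1` taken at `y - M *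
H` and at `y + lam * H`; as the ramp is 1-Lipschitz, the error is at most `M * H`, the coarser
period. -/
lemma abs_profile_le (h0 : 0 ≤ lam) (h1 : lam < 1) (hM : 4 ≤ M) {l : ℕ} (hl : l ≤ n) {r : ℝ}
    (hr : r ∈ Icc (node M l) (node M (l + 1))) (y : ℝ) :
    |profile lam M n r y| ≤ period M n l := by
  have hp := period_pos (n := n) hM (l + 1)
  have hM4 : (4 : ℝ) ≤ M := by exact_mod_cast hM
  set H := period M n (l + 1) with hH
  have hW : stripWidth lam M n l = (1 - lam) * H := rfl
  have hsum : ∀ z, ∑ σ ∈ Finset.range (stripCount M n l), clampR H (z - σ * H) = clampR 1 z := by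
    intro z
    rw [sum_clampR hp.le, stripCount_mul_period hM]
  have hup : ∑ σ ∈ Finset.range (stripCount M n l),
      clampR (stripWidth lam M n l) (y - stripPath lam M n l σ r)
      ≤ (1 - lam) * clampR 1 (y + lam * H) := by
    rw [← hsum, Finset.mul_sum]
    refine Finset.sum_le_sum fun σ _ => ?_
    have h2 := (stripPath_bounds (n := n) h0 h1 hM hr σ).1
    rw [hW]
    refine (clampR_shrink_le h0 h1.le hp.le _).trans ?_
    refine mul_le_mul_of_nonneg_left (clampR_mono ?_) (by linarith)
    linarith
  have hlow : (1 - lam) * clampR 1 (y - M * H) ≤ ∑ σ ∈ Finset.range (stripCount M n l),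
      clampR (stripWidth lam M n l) (y - stripPath lam M n l σ r) := by
    rw [← hsum, Finset.mul_sum]
    refine Finset.sum_le_sum fun σ _ => ?_
    have h2 := (stripPath_bounds (n := n) h0 h1 hM hr σ).2
    rw [hW]
    refine le_trans ?_ (le_clampR_shrink h0 h1.le hp.le _)
    refine mul_le_mul_of_nonneg_left (clampR_mono ?_) (by linarith)
    linarith
  have h3 := abs_clampR_sub_le (W := 1) (y + lam * H) y
  have h4 := abs_clampR_sub_le (W := 1) (y - M * H) y
  have h5 : |y + lam * H - y| = lam * H := by
    rw [add_sub_cancel_left, abs_of_nonneg (by positivity)]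
  have h6 : |y - M * H - y| = M * H := by
    rw [sub_sub_cancel_left, abs_neg, abs_of_nonneg (by positivity)]
  rw [h5, abs_le] at h3
  rw [h6, abs_le] at h4
  rw [profile_eq h1 hM hl hr, period_eq_mul hM l, ← hH, abs_le]
  have : lam * H ≤ M * H := by nlinarith
  have : 0 ≤ M * H := by positivity
  constructor <;> nlinarith

end Branching

/-- A sheared rectangle: `x j` runs from `b` to `b + h`, and `x i` exceeds `a + s * (x j - b)` by an
amount between `0` and `w`. -/
structure Cell where
  b : ℝ
  a : ℝ
  h : ℝ
  w : ℝ
  s : ℝ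

/-! ### Sheared rectangles and their maps to the unit square -/

namespace Cell

/-- The linear part of the map from a cell to the unit square. -/
noncomputable def mat (i j : Fin 2) (c : Cell) : Mat2 :=
  Matrix.of fun k m => if k = i then (if m = i then 1 / c.w else -c.s / c.w)
    else (if m = j then 1 / c.h else 0)

/-- The corner of a cell. -/
noncomputable def origin (i : Fin 2) (c : Cell) : Plane :=
  WithLp.toLp 2 fun k => if k = i then c.a else c.b

/-- The affine map from a cell to the unit square. -/
noncomputable def map (i j : Fin 2) (c : Cell) : Plane → Plane := affMap (c.mat i j) (c.origin i)

/-- The open cell. -/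
def set (i j : Fin 2) (c : Cell) : Set Plane := c.map i j ⁻¹' unitSquare

variable {i j : Fin 2} {c : Cell} {x : Plane}

lemma map_i (hij : i ≠ j) : (c.map i j x) i = (x i - c.a - c.s * (x j - c.b)) / c.w := by
  fin_cases i <;> fin_cases j <;>
    simp [map, affMap, mat, origin, Matrix.ofLp_toEuclideanCLM, Matrix.mulVec, dotProduct] at hij ⊢
    <;> ring

lemma map_j (hij : i ≠ j) : (c.map i j x) j = (x j - c.b) / c.h := by
  fin_cases i <;> fin_cases j <;>
    simp [map, affMap, mat, origin, Matrix.ofLp_toEuclideanCLM, Matrix.mulVec, dotProduct] at hij ⊢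
    <;> ring

lemma mem_unitSquare_iff (hij : i ≠ j) :
    x ∈ unitSquare ↔ x i ∈ Ioo (0 : ℝ) 1 ∧ x j ∈ Ioo (0 : ℝ) 1 := by
  fin_cases i <;> fin_cases j <;> simp [unitSquare, Fin.forall_fin_two, and_comm] at hij ⊢

lemma mem_set_iff (hij : i ≠ j) (hw : 0 < c.w) : x ∈ c.set i j ↔
    (0 < x i - c.a - c.s * (x j - c.b) ∧ x i - c.a - c.s * (x j - c.b) < c.w) ∧
      (x j - c.b) / c.h ∈ Ioo (0 : ℝ) 1 := by
  rw [set, mem_preimage, mem_unitSquare_iff hij, map_i hij, map_j hij]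
  simp only [mem_Ioo, div_pos_iff_of_pos_right hw, div_lt_one hw]

lemma det_mat (hij : i ≠ j) : (c.mat i j).det = 1 / (c.w * c.h) := by
  fin_cases i <;> fin_cases j <;> simp [mat, Matrix.det_fin_two] at hij ⊢
  ring

lemma det_mat_ne_zero (hij : i ≠ j) (hw : 0 < c.w) (hh : c.h ≠ 0) : (c.mat i j).det ≠ 0 := by
  rw [det_mat hij]
  positivity

lemma abs_det_inv (hij : i ≠ j) (hw : 0 < c.w) : |((c.mat i j).det)⁻¹| = |c.h| * c.w := by
  rw [det_mat hij, one_div, inv_inv, abs_mul, abs_of_pos hw, mul_comm]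

lemma isOpen_set : IsOpen (c.set i j) := by
  refine isOpen_unitSquare.preimage ?_
  unfold map affMap
  fun_prop

/-- The factor `|h| * w` from the determinant turns column `i`, with entry `1 / w`, into `|h|`, and
column `j`, with entries `-s / w` and `1 / h`, into `|h| * |s| + w`: up to constants the perimeter
of the cell. -/
lemma varBound_comp (hij : i ≠ j) (hw : 0 < c.w) (hh : c.h ≠ 0) (hs : |c.s| ≤ 3)
    {f : Plane → ℝ} {B : ℝ} (hf : VarBound f B) :
    VarBound (fun x => f (c.map i j x)) ((3 * |c.h| + c.w) * B) := by
  have hB := hf.nonneg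
  have hh' : 0 < |c.h| := abs_pos.2 hh
  have e1 : |c.h| * c.w * (|1 / c.w| * B) = |c.h| * B := by
    rw [abs_of_pos (one_div_pos.2 hw)]
    field_simp
  have e2 : |c.h| * c.w * ((|-c.s / c.w| + |1 / c.h|) * B) = (|c.h| * |c.s| + c.w) * B := by
    rw [abs_div, abs_div, abs_neg, abs_of_pos hw, abs_one]
    field_simp
  have b1 : |c.h| * B ≤ (3 * |c.h| + c.w) * B := by gcongr; linarith
  have b2 : (|c.h| * |c.s| + c.w) * B ≤ (3 * |c.h| + c.w) * B := by
    refine mul_le_mul_of_nonneg_right ?_ hB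
    nlinarith
  have hsum : ∀ k, |c.mat i j 0 k| + |c.mat i j 1 k| = |c.mat i j i k| + |c.mat i j j k| := by
    intro k
    fin_cases i <;> fin_cases j <;> simp [add_comm] at hij ⊢
  refine hf.comp_affMap (det_mat_ne_zero hij hw hh) fun k => ?_
  rw [abs_det_inv hij hw, hsum]
  rcases (by fin_cases i <;> fin_cases j <;> fin_cases k <;> simp at hij ⊢ : k = i ∨ k = j)
    with rfl | rfl
  · refine le_trans (le_of_eq ?_) b1
    rw [← e1]
    simp [mat, hij, hij.symm]
  · refine le_trans (le_of_eq ?_) b2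
    rw [← e2]
    simp [mat, hij.symm]

lemma varBound_indicator (hij : i ≠ j) (hw : 0 < c.w) (hh : c.h ≠ 0) (hs : |c.s| ≤ 3) :
    VarBound ((c.set i j).indicator fun _ => (1 : ℝ)) ((3 * |c.h| + c.w) * 2) :=
  varBound_comp hij hw hh hs VarBound.indicator_unitSquare

/-- The `q`-th piece of a cell that is cut into `m` pieces of equal length. -/
noncomputable def sub (c : Cell) (m q : ℕ) : Cell where
  b := c.b + q * (c.h / m)
  a := c.a + c.s * (q * (c.h / m))
  h := c.h / m
  w := c.w
  s := c.s

lemma mem_sub_iff (hij : i ≠ j) (hw : 0 < c.w) (hh : c.h ≠ 0) {m q : ℕ} (hm : 0 < m) :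
    x ∈ (c.sub m q).set i j ↔
      (0 < x i - c.a - c.s * (x j - c.b) ∧ x i - c.a - c.s * (x j - c.b) < c.w) ∧
        m * ((x j - c.b) / c.h) ∈ Ioo (q : ℝ) (q + 1) := by
  have hm' : (0 : ℝ) < m := by exact_mod_cast hm
  rw [mem_set_iff hij (by exact hw)]
  have e1 : x i - (c.sub m q).a - (c.sub m q).s * (x j - (c.sub m q).b)
      = x i - c.a - c.s * (x j - c.b) := by
    simp only [sub]; ring
  have e2 : (x j - (c.sub m q).b) / (c.sub m q).h = m * ((x j - c.b) / c.h) - q := by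
    simp only [sub]
    field_simp
    ring
  rw [e1, e2]
  simp only [sub, mem_Ioo, sub_pos, sub_lt_iff_lt_add, add_comm]

lemma sub_subset (hij : i ≠ j) (hw : 0 < c.w) (hh : c.h ≠ 0) {m q : ℕ} (hq : q < m) :
    (c.sub m q).set i j ⊆ c.set i j := by
  intro x hx
  have hm : 0 < m := by omega
  have hm' : (0 : ℝ) < m := by exact_mod_cast hm
  have hq' : (q : ℝ) + 1 ≤ m := by exact_mod_cast hq
  rw [mem_sub_iff hij hw hh hm] at hx
  rw [mem_set_iff hij hw]
  refine ⟨hx.1, ?_, ?_⟩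
  · have : (0 : ℝ) < m * ((x j - c.b) / c.h) := (Nat.cast_nonneg q).trans_lt hx.2.1
    exact pos_of_mul_pos_right this hm'.le
  · have : m * ((x j - c.b) / c.h) < m * 1 := by linarith [hx.2.2]
    exact lt_of_mul_lt_mul_left this hm'.le

lemma sub_index_unique (hij : i ≠ j) (hw : 0 < c.w) (hh : c.h ≠ 0) {m q q' : ℕ} (hm : 0 < m)
    (hx : x ∈ (c.sub m q).set i j) (hx' : x ∈ (c.sub m q').set i j) : q = q' := by
  rw [mem_sub_iff hij hw hh hm] at hx hx'
  have h1 : (q : ℝ) < q' + 1 := hx.2.1.trans hx'.2.2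
  have h2 : (q' : ℝ) < q + 1 := hx'.2.1.trans hx.2.2
  have h1' : q < q' + 1 := by exact_mod_cast h1
  have h2' : q' < q + 1 := by exact_mod_cast h2
  omega

/-- The piece is found as the integer part of the rescaled longitudinal coordinate; the points
excluded are those on the cuts. -/
lemma exists_mem_sub (hij : i ≠ j) (hw : 0 < c.w) (hh : c.h ≠ 0) {m : ℕ} (hm : 0 < m)
    (hx : x ∈ c.set i j) (hne : ∀ q : ℕ, x j ≠ c.b + q * (c.h / m)) :
    ∃ q < m, x ∈ (c.sub m q).set i j := by
  rw [mem_set_iff hij hw] at hx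
  have hm' : (0 : ℝ) < m := by exact_mod_cast hm
  have h0 : 0 ≤ m * ((x j - c.b) / c.h) := mul_nonneg hm'.le hx.2.1.le
  refine ⟨⌊m * ((x j - c.b) / c.h)⌋₊, ?_, ?_⟩
  · rw [Nat.floor_lt h0]
    nlinarith [hx.2.2]
  · rw [mem_sub_iff hij hw hh hm]
    refine ⟨hx.1, lt_of_le_of_ne (Nat.floor_le h0) fun h => ?_, Nat.lt_floor_add_one _⟩
    apply hne ⌊m * ((x j - c.b) / c.h)⌋₊
    rw [h]
    field_simp
    ring

end Cell

/-! ### Derivatives of ramps and smooth cut-offs -/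

lemma hasFDerivAt_clampR {ℓ : Plane → ℝ} {ℓ' : Plane →L[ℝ] ℝ} {x : Plane} {W : ℝ} (hW : 0 ≤ W)
    (hℓ : HasFDerivAt ℓ ℓ' x) (h0 : ℓ x ≠ 0) (h1 : ℓ x ≠ W) :
    HasFDerivAt (fun x => clampR W (ℓ x)) ((Ioo 0 W).indicator (fun _ => (1 : ℝ)) (ℓ x) • ℓ') x := by
  have hc := hℓ.continuousAt
  rcases lt_or_gt_of_ne h0 with h | h
  · rw [indicator_of_notMem (fun hh => lt_asymm h hh.1), zero_smul]
    refine (hasFDerivAt_const (0 : ℝ) x).congr_of_eventuallyEq ?_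
    filter_upwards [hc.eventually_lt continuousAt_const h] with y hy
    exact clampR_of_nonpos hy.le
  rcases lt_or_gt_of_ne h1 with h' | h'
  · rw [indicator_of_mem (show ℓ x ∈ Ioo 0 W from ⟨h, h'⟩), one_smul]
    refine hℓ.congr_of_eventuallyEq ?_
    filter_upwards [hc.eventually_lt continuousAt_const h',
      continuousAt_const.eventually_lt hc h] with y hy hy'
    exact clampR_of_mem hy'.le hy.le
  · rw [indicator_of_notMem (fun hh => lt_asymm h' hh.2), zero_smul]
    refine (hasFDerivAt_const W x).congr_of_eventuallyEq ?_
    filter_upwards [continuousAt_const.eventually_lt hc h'] with y hy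
    exact clampR_of_ge hW hy.le

/-- Smooth cut-off functions around `1/2` with scale-invariant derivative bounds. -/
lemma exists_cutoff : ∃ C : ℝ, 0 < C ∧ ∀ a b : ℝ, 0 ≤ a → a < b → ∃ η : ℝ → ℝ, ContDiff ℝ ∞ η ∧
    (∀ t, 0 ≤ η t ∧ η t ≤ 1) ∧ (∀ t, |t - 1 / 2| ≤ a → η t = 1) ∧
    (∀ t, b ≤ |t - 1 / 2| → η t = 0) ∧ (∀ t, |deriv η t| ≤ C / (b - a)) ∧
    ∀ t, |deriv (deriv η) t| ≤ C / (b - a) ^ 2 := by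
  set θ := Real.smoothTransition with hθ
  have hθs : ContDiff ℝ ∞ θ := Real.smoothTransition.contDiff
  have hd1 : ContDiff ℝ ∞ (deriv θ) := (contDiff_infty_iff_deriv.1 hθs).2
  have hd2 : ContDiff ℝ ∞ (deriv (deriv θ)) := (contDiff_infty_iff_deriv.1 hd1).2
  have hz : ∀ u, u ∉ Icc (0 : ℝ) 1 → deriv θ u = 0 := by
    intro u hu
    rcases not_and_or.1 hu with h | h
    · have : θ =ᶠ[nhds u] fun _ => 0 := by
        filter_upwards [gt_mem_nhds (not_le.1 h)] with v hv
        exact Real.smoothTransition.zero_of_nonpos hv.le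
      rw [this.deriv_eq, deriv_const]
    · have : θ =ᶠ[nhds u] fun _ => 1 := by
        filter_upwards [lt_mem_nhds (not_le.1 h)] with v hv
        exact Real.smoothTransition.one_of_one_le hv.le
      rw [this.deriv_eq, deriv_const]
  have hc1 : HasCompactSupport (deriv θ) :=
    HasCompactSupport.intro isCompact_Icc hz
  obtain ⟨C1, hC1⟩ := hd1.continuous.bounded_above_of_compact_support hc1
  obtain ⟨C2, hC2⟩ := hd2.continuous.bounded_above_of_compact_support hc1.deriv
  have hC1' : 0 ≤ C1 := (norm_nonneg _).trans (hC1 0)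
  have hC2' : 0 ≤ C2 := (norm_nonneg _).trans (hC2 0)
  -- The cut-off is 1 - θ(u) - θ(v), with one transition on either side of 1/2; since `0 ≤ a`, `u`
  -- and `v` are never both positive. The factor 2 counts the transitions, and the summand 1 makes
  -- the constant positive.
  refine ⟨2 * (C1 + C2) + 1, by positivity, fun a b ha hab => ?_⟩
  have hd : 0 < b - a := sub_pos.2 hab
  set u : ℝ → ℝ := fun t => (t - 1 / 2 - a) / (b - a) with hu
  set v : ℝ → ℝ := fun t => (1 / 2 - t - a) / (b - a) with hv
  have hu' : ∀ t, HasDerivAt u (1 / (b - a)) t := fun t =>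
    (((hasDerivAt_id t).sub_const (1 / 2)).sub_const a).div_const _
  have hv' : ∀ t, HasDerivAt v (-1 / (b - a)) t := fun t =>
    (((hasDerivAt_id t).const_sub (1 / 2)).sub_const a).div_const _
  have hη1 : ∀ t, HasDerivAt (fun t => 1 - θ (u t) - θ (v t))
      (-(1 / (b - a)) * deriv θ (u t) + 1 / (b - a) * deriv θ (v t)) t := by
    intro t
    have h1 := (hθs.differentiable (by simp) (u t)).hasDerivAt.comp t (hu' t)
    have h2 := (hθs.differentiable (by simp) (v t)).hasDerivAt.comp t (hv' t)
    exact (((hasDerivAt_const t (1 : ℝ)).sub h1).sub h2).congr_deriv (by ring)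
  have e1 : deriv (fun t => 1 - θ (u t) - θ (v t))
      = fun t => -(1 / (b - a)) * deriv θ (u t) + 1 / (b - a) * deriv θ (v t) :=
    funext fun t => (hη1 t).deriv
  have e2 : ∀ t, deriv (deriv (fun t => 1 - θ (u t) - θ (v t))) t
      = -(1 / (b - a)) ^ 2 * deriv (deriv θ) (u t) - (1 / (b - a)) ^ 2 * deriv (deriv θ) (v t) := by
    intro t
    rw [e1]
    have h1 := (hd1.differentiable (by simp) (u t)).hasDerivAt.comp t (hu' t)
    have h2 := (hd1.differentiable (by simp) (v t)).hasDerivAt.comp t (hv' t)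
    refine ((h1.const_mul (-(1 / (b - a)))).add (h2.const_mul (1 / (b - a)))).deriv.trans ?_
    ring
  have hup : ∀ t, 0 ≤ u t → v t ≤ 0 := by
    intro t ht
    have : 0 ≤ t - 1 / 2 - a := by
      by_contra h
      exact absurd ht (not_le.2 (div_neg_of_neg_of_pos (not_le.1 h) hd))
    exact div_nonpos_of_nonpos_of_nonneg (by linarith) hd.le
  refine ⟨fun t => 1 - θ (u t) - θ (v t), ?_, fun t => ⟨?_, ?_⟩, fun t ht => ?_, fun t ht => ?_,
    fun t => ?_, fun t => ?_⟩
  · have hus : ContDiff ℝ ∞ u := by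
      simp only [hu]; fun_prop
    have hvs : ContDiff ℝ ∞ v := by
      simp only [hv]; fun_prop
    exact (contDiff_const.sub (hθs.comp hus)).sub (hθs.comp hvs)
  · have := Real.smoothTransition.le_one (u t)
    have := Real.smoothTransition.le_one (v t)
    rcases le_total 0 (u t) with h | h
    · simp only [hθ, Real.smoothTransition.zero_of_nonpos (hup t h)]; linarith
    · simp only [hθ, Real.smoothTransition.zero_of_nonpos h]; linarith
  · have := Real.smoothTransition.nonneg (u t)
    have := Real.smoothTransition.nonneg (v t)
    linarith
  · rw [abs_le] at ht
    have h1 : u t ≤ 0 := div_nonpos_of_nonpos_of_nonneg (by linarith) hd.le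
    have h2 : v t ≤ 0 := div_nonpos_of_nonpos_of_nonneg (by linarith) hd.le
    simp only [hθ, Real.smoothTransition.zero_of_nonpos h1, Real.smoothTransition.zero_of_nonpos h2]
    norm_num
  · rcases le_abs.1 ht with h | h
    · have h1 : 1 ≤ u t := by rw [hu, le_div_iff₀ hd]; linarith
      have h2 : v t ≤ 0 := hup t (by linarith)
      simp only [hθ, Real.smoothTransition.one_of_one_le h1, Real.smoothTransition.zero_of_nonpos h2]
      norm_num
    · have h1 : 1 ≤ v t := by rw [hv, le_div_iff₀ hd]; linarith
      have h2 : u t ≤ 0 := div_nonpos_of_nonpos_of_nonneg (by linarith) hd.le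
      simp only [hθ, Real.smoothTransition.one_of_one_le h1, Real.smoothTransition.zero_of_nonpos h2]
      norm_num
  · rw [(hη1 t).deriv]
    have h1 := hC1 (u t)
    have h2 := hC1 (v t)
    rw [Real.norm_eq_abs] at h1 h2
    have h3 : |-(1 / (b - a)) * deriv θ (u t) + 1 / (b - a) * deriv θ (v t)|
        ≤ 1 / (b - a) * C1 + 1 / (b - a) * C1 := by
      refine (abs_add_le _ _).trans ?_
      rw [abs_mul, abs_mul, abs_neg, abs_of_pos (one_div_pos.2 hd)]
      gcongr
    refine h3.trans ?_
    rw [← add_mul, div_eq_mul_one_div (2 * (C1 + C2) + 1) (b - a)]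
    have := one_div_pos.2 hd
    nlinarith
  · rw [e2]
    have h1 := hC2 (u t)
    have h2 := hC2 (v t)
    rw [Real.norm_eq_abs] at h1 h2
    have hp : 0 < (1 / (b - a)) ^ 2 := by positivity
    have h3 : |-(1 / (b - a)) ^ 2 * deriv (deriv θ) (u t) - (1 / (b - a)) ^ 2 * deriv (deriv θ) (v t)|
        ≤ (1 / (b - a)) ^ 2 * C2 + (1 / (b - a)) ^ 2 * C2 := by
      refine (abs_sub _ _).trans ?_
      rw [abs_mul, abs_mul, abs_neg, abs_of_pos hp]
      gcongr
    refine h3.trans ?_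
    have : (2 * (C1 + C2) + 1) / (b - a) ^ 2 = (2 * (C1 + C2) + 1) * (1 / (b - a)) ^ 2 := by
      rw [one_div_pow]; ring
    rw [this]
    nlinarith

/-- The sign `±1` encoded by a Boolean. -/
def sgn (κ : Bool) : ℝ := if κ then 1 else -1

lemma sgn_mul_self (κ : Bool) : sgn κ * sgn κ = 1 := by cases κ <;> simp [sgn]

lemma sgn_ne_zero (κ : Bool) : sgn κ ≠ 0 := by cases κ <;> simp [sgn]

lemma abs_sgn (κ : Bool) : |sgn κ| = 1 := by cases κ <;> simp [sgn]

lemma ae_sub_mul_ne {i j : Fin 2} (hij : i ≠ j) (s c : ℝ) : ∀ᵐ x : Plane, x i - s * x j ≠ c := by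
  have h := volume_level_set (EuclideanSpace.proj (𝕜 := ℝ) i - s • EuclideanSpace.proj j)
    (fun h => by
      have := congrArg (fun L : Plane →L[ℝ] ℝ => L (EuclideanSpace.single i 1)) h
      simp [hij.symm] at this) c
  rw [ae_iff]
  convert h using 2
  ext x
  simp

lemma ae_coord_ne (i : Fin 2) (c : ℝ) : ∀ᵐ x : Plane, x i ≠ c := by
  have hij : i ≠ i + 1 := by fin_cases i <;> simp
  simpa using ae_sub_mul_ne hij 0 c

/-! ### The sawtooth on the plane and its gradient almost everywhere -/

section Sawtooth

variable (lam : ℝ) (M n : ℕ) (i j : Fin 2)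

/-- A strip of the branched lamination within one layer. -/
noncomputable def longCell (κ : Bool) (l σ : ℕ) : Cell where
  b := 1 / 2 + sgn κ * node M l
  a := startPos lam M n l σ
  h := sgn κ * layerHeight M l
  w := stripWidth lam M n l
  s := sgn κ * stripSlope lam M n l σ

/-- One of the two copies of a layer. -/
def slab (κ : Bool) (l : ℕ) : Set Plane :=
  {x | sgn κ * (x j - 1 / 2) ∈ Ioo (node M l) (node M (l + 1))}

/-- The strips of all layers. -/
abbrev StripIdx : Type := Bool × (Σ l : Fin (n + 1), Fin (stripCount M n l))

/-- The branched sawtooth before it is cut off. -/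
noncomputable def sawtooth (x : Plane) : ℝ := profile lam M n |x j - 1 / 2| (x i)

/-- The derivative of the sawtooth in the direction of lamination. -/
noncomputable def sawtoothDi (x : Plane) : ℝ :=
  (1 - lam) * unitSquare.indicator (fun _ => (1 : ℝ)) x
    - ∑ c : StripIdx M n, ((longCell lam M n c.1 c.2.1 c.2.2).set i j).indicator (fun _ => (1 : ℝ)) x

/-- The derivative of the sawtooth along the layers. -/
noncomputable def sawtoothDj (x : Plane) : ℝ :=
  ∑ c : StripIdx M n, (longCell lam M n c.1 c.2.1 c.2.2).s
    * ((longCell lam M n c.1 c.2.1 c.2.2).set i j).indicator (fun _ => (1 : ℝ)) x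

variable {lam M n i j}

/-- A point sees only the strips of its own layer and half, which links the global sums over all
strips with the sum in `profile_eq`. -/
lemma sum_stripIdx_eq {F : Bool → ℕ → ℕ → ℝ} {κ : Bool} {l : ℕ} (hl : l ≤ n)
    (hF : ∀ κ' l', (κ' ≠ κ ∨ l' ≠ l) → ∀ σ, F κ' l' σ = 0) :
    ∑ c : StripIdx M n, F c.1 c.2.1 c.2.2 = ∑ σ ∈ Finset.range (stripCount M n l), F κ l σ := by
  rw [Fintype.sum_prod_type, Fintype.sum_eq_single κ]
  · simp only
    rw [Fintype.sum_sigma, Fintype.sum_eq_single (⟨l, by omega⟩ : Fin (n + 1))]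
    · rw [Finset.sum_range]
    · intro l' hl'
      refine Finset.sum_eq_zero fun σ _ => hF _ _ (Or.inr fun h => hl' (Fin.ext h)) _
  · intro κ' hκ'
    exact Finset.sum_eq_zero fun c _ => hF _ _ (Or.inl hκ') _

/-- Because the square of the sign is one, the reflected half, whose cells have negative `h`, obeys
the same formula in the distance `sgn κ * (x j - 1 / 2)`. -/
lemma mem_longCell_iff (hij : i ≠ j) (h1 : lam < 1) (hM : 4 ≤ M) {κ : Bool} {l σ : ℕ} {x : Plane} :
    x ∈ (longCell lam M n κ l σ).set i j ↔ x ∈ slab M j κ l ∧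
      x i - stripPath lam M n l σ (sgn κ * (x j - 1 / 2)) ∈ Ioo 0 (stripWidth lam M n l) := by
  have hh := layerHeight_pos hM l
  have hs := sgn_mul_self κ
  rw [Cell.mem_set_iff hij (stripWidth_pos h1 hM l)]
  have e1 : x i - (longCell lam M n κ l σ).a
      - (longCell lam M n κ l σ).s * (x j - (longCell lam M n κ l σ).b)
      = x i - stripPath lam M n l σ (sgn κ * (x j - 1 / 2)) := by
    simp only [longCell, stripPath]
    linear_combination -stripSlope lam M n l σ * node M l * hs * (-1)
  have e2 : (x j - (longCell lam M n κ l σ).b) / (longCell lam M n κ l σ).h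
      = (sgn κ * (x j - 1 / 2) - node M l) / layerHeight M l := by
    simp only [longCell]
    rw [div_eq_div_iff (mul_ne_zero (sgn_ne_zero κ) hh.ne') hh.ne']
    linear_combination (-(x j - 1 / 2)) * layerHeight M l * hs
  rw [e1, e2, and_comm]
  have e3 : (sgn κ * (x j - 1 / 2) - node M l) / layerHeight M l ∈ Ioo (0 : ℝ) 1
      ↔ x ∈ slab M j κ l := by
    rw [mem_Ioo, div_pos_iff_of_pos_right hh, div_lt_one hh, layerHeight, sub_pos,
      sub_lt_sub_iff_right]
    rfl
  rw [e3]
  rfl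

lemma slab_unique (hM : 4 ≤ M) {κ κ' : Bool} {l l' : ℕ} {x : Plane} (h : x ∈ slab M j κ l)
    (h' : x ∈ slab M j κ' l') : κ' = κ ∧ l' = l := by
  have hmono := (node_strictMono hM).monotone
  have hn := node_nonneg hM l
  have hn' := node_nonneg hM l'
  obtain ⟨a1, a2⟩ := h
  obtain ⟨b1, b2⟩ := h'
  have hκ : κ' = κ := by
    cases κ <;> cases κ' <;> simp [sgn] at a1 b1 ⊢ <;> linarith
  subst hκ
  refine ⟨rfl, ?_⟩
  by_contra hne
  rcases Nat.lt_or_gt_of_ne hne with h | h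
  · linarith [hmono (show l' + 1 ≤ l from h)]
  · linarith [hmono (show l + 1 ≤ l' from h)]

lemma abs_eq_of_mem_slab (hM : 4 ≤ M) {κ : Bool} {l : ℕ} {x : Plane} (h : x ∈ slab M j κ l) :
    |x j - 1 / 2| = sgn κ * (x j - 1 / 2) := by
  rw [← abs_of_nonneg ((node_nonneg hM l).trans h.1.le), abs_mul, abs_sgn, one_mul]

lemma longCell_unique (hij : i ≠ j) (h0 : 0 ≤ lam) (h1 : lam < 1) (hM : 4 ≤ M) {κ κ' : Bool}
    {l l' σ σ' : ℕ} {x : Plane} (h : x ∈ (longCell lam M n κ l σ).set i j)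
    (h' : x ∈ (longCell lam M n κ' l' σ').set i j) : κ' = κ ∧ l' = l ∧ σ' = σ := by
  rw [mem_longCell_iff hij h1 hM] at h h'
  obtain ⟨rfl, rfl⟩ := slab_unique hM h.1 h'.1
  refine ⟨rfl, rfl, ?_⟩
  have hr := Ioo_subset_Icc_self h.1
  obtain ⟨-, a1, a2⟩ := h
  obtain ⟨-, b1, b2⟩ := h'
  by_contra hne
  rcases Nat.lt_or_gt_of_ne hne with h | h
  · linarith [stripPath_gap (n := n) h0 h1 hM hr h]
  · linarith [stripPath_gap (n := n) h0 h1 hM hr h]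

lemma slab_subset (hM : 4 ≤ M) {κ : Bool} {l : ℕ} {x : Plane} (h : x ∈ slab M j κ l) :
    x j ∈ Ioo (0 : ℝ) 1 := by
  have h2 := node_nonneg hM l
  have h3 := node_lt_half hM (l + 1)
  obtain ⟨a1, a2⟩ := h
  cases κ <;> simp [sgn] at a1 a2 <;> constructor <;> linarith

lemma longCell_subset (hij : i ≠ j) (h0 : 0 ≤ lam) (h1 : lam < 1) (hM : 4 ≤ M) {κ : Bool}
    {l σ : ℕ} (hσ : σ < stripCount M n l) : (longCell lam M n κ l σ).set i j ⊆ unitSquare := by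
  intro x hx
  rw [mem_longCell_iff hij h1 hM] at hx
  rw [Cell.mem_unitSquare_iff hij]
  have hr := Ioo_subset_Icc_self hx.1
  have h2 := (stripPath_bounds (n := n) h0 h1 hM hr σ).1
  have h3 := stripPath_add_le_one (n := n) h0 h1 hM hr hσ
  have : 0 ≤ period M n (l + 1) * σ := mul_nonneg (period_pos hM _).le (Nat.cast_nonneg σ)
  refine ⟨⟨by linarith [hx.2.1], by linarith [hx.2.2]⟩, slab_subset hM hx.1⟩

lemma exists_slab {x : Plane} (hx : |x j - 1 / 2| < node M (n + 1))
    (hne : ∀ l, |x j - 1 / 2| ≠ node M l) : ∃ κ, ∃ l ≤ n, x ∈ slab M j κ l := by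
  have hex : ∃ l, |x j - 1 / 2| < node M l := ⟨_, hx⟩
  classical
  have h0 : Nat.find hex ≠ 0 := by
    intro h
    have := Nat.find_spec hex
    rw [h, node_zero] at this
    exact absurd this (not_lt.2 (abs_nonneg _))
  obtain ⟨l, hl⟩ := Nat.exists_eq_succ_of_ne_zero h0
  have h2 : |x j - 1 / 2| < node M (l + 1) := by
    have := Nat.find_spec hex
    rwa [hl] at this
  have h3 : node M l < |x j - 1 / 2| :=
    lt_of_le_of_ne (not_lt.1 (Nat.find_min hex (by omega))) (hne l).symm
  have h4 : l ≤ n := by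
    have := Nat.find_min' hex hx
    omega
  rcases le_total 0 (x j - 1 / 2) with h | h
  · refine ⟨true, l, h4, ?_⟩
    rw [abs_of_nonneg h] at h2 h3
    simp only [slab, sgn, mem_ofPred_eq, mem_Ioo, if_true, one_mul]
    exact ⟨h3, h2⟩
  · refine ⟨false, l, h4, ?_⟩
    rw [abs_of_nonpos h] at h2 h3
    simp only [slab, sgn, mem_ofPred_eq, mem_Ioo, Bool.false_eq_true, if_false, neg_one_mul]
    exact ⟨h3, h2⟩

/-- The points off the interfaces of the lamination. -/
def OffInterfaces (lam : ℝ) (M n : ℕ) (i j : Fin 2) (x : Plane) : Prop :=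
  (∀ l, |x j - 1 / 2| ≠ node M l) ∧ x i ≠ 0 ∧ x i ≠ 1 ∧
    ∀ (κ : Bool) (l σ : ℕ), x i - stripPath lam M n l σ (sgn κ * (x j - 1 / 2)) ≠ 0 ∧
      x i - stripPath lam M n l σ (sgn κ * (x j - 1 / 2)) ≠ stripWidth lam M n l

lemma ae_offInterfaces (hij : i ≠ j) (hM : 4 ≤ M) : ∀ᵐ x, OffInterfaces lam M n i j x := by
  have h1 : ∀ᵐ x : Plane, ∀ l, |x j - 1 / 2| ≠ node M l := by
    rw [ae_all_iff]
    intro l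
    filter_upwards [ae_coord_ne j (1 / 2 + node M l), ae_coord_ne j (1 / 2 - node M l)]
      with x hx hx' h
    rcases (abs_eq (node_nonneg hM l)).1 h with h | h
    · exact hx (by linarith)
    · exact hx' (by linarith)
  have h2 : ∀ᵐ x : Plane, ∀ (κ : Bool) (l σ : ℕ),
      x i - stripPath lam M n l σ (sgn κ * (x j - 1 / 2)) ≠ 0 ∧
      x i - stripPath lam M n l σ (sgn κ * (x j - 1 / 2)) ≠ stripWidth lam M n l := by
    simp only [ae_all_iff]
    intro κ l σ
    have key : ∀ c, ∀ᵐ x : Plane, x i - stripPath lam M n l σ (sgn κ * (x j - 1 / 2)) ≠ c := by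
      intro c
      filter_upwards [ae_sub_mul_ne hij (stripSlope lam M n l σ * sgn κ)
        (c + startPos lam M n l σ - stripSlope lam M n l σ * (sgn κ / 2 + node M l))] with x hx h
      refine hx ?_
      rw [← h, stripPath]
      ring
    exact (key 0).and (key _)
  filter_upwards [h1, h2, ae_coord_ne i 0, ae_coord_ne i 1] with x a b c d
  exact ⟨a, c, d, b⟩

lemma hasFDerivAt_coord (k : Fin 2) (x : Plane) :
    HasFDerivAt (fun x : Plane => x k) (EuclideanSpace.proj (𝕜 := ℝ) k) x :=
  (EuclideanSpace.proj (𝕜 := ℝ) k).hasFDerivAt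

/-- Inside a layer the sawtooth is the finite sum of `profile_eq`, a sum of ramps of affine
functions. Off the interfaces none of them is at a kink, and a ramp has slope one exactly on its own
strip. -/
lemma hasFDerivAt_sawtooth (hij : i ≠ j) (h1 : lam < 1) (hM : 4 ≤ M) {x : Plane}
    (hx : OffInterfaces lam M n i j x) {κ : Bool} {l : ℕ} (hl : l ≤ n) (hxs : x ∈ slab M j κ l) :
    HasFDerivAt (sawtooth lam M n i j) (sawtoothDi lam M n i j x • EuclideanSpace.proj (𝕜 := ℝ) i
      + sawtoothDj lam M n i j x • EuclideanSpace.proj (𝕜 := ℝ) j) x := by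
  set W := stripWidth lam M n l with hW
  have hW0 : 0 < W := stripWidth_pos h1 hM l
  set ℓ : ℕ → Plane → ℝ := fun σ x => x i - stripPath lam M n l σ (sgn κ * (x j - 1 / 2)) with hℓ
  set s : ℕ → ℝ := fun σ => sgn κ * stripSlope lam M n l σ with hs
  set e : ℕ → ℝ := fun σ => (Ioo 0 W).indicator (fun _ => (1 : ℝ)) (ℓ σ x) with he
  have hℓd : ∀ σ, HasFDerivAt (ℓ σ) (EuclideanSpace.proj (𝕜 := ℝ) i
      - s σ • EuclideanSpace.proj (𝕜 := ℝ) j) x := by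
    intro σ
    have h2 := ((((hasFDerivAt_coord j x).sub_const (1 / 2)).const_mul (sgn κ)).sub_const
      (node M l)).const_mul (stripSlope lam M n l σ)
    refine ((hasFDerivAt_coord i x).sub (h2.const_add (startPos lam M n l σ))).congr_fderiv ?_
    rw [smul_smul, mul_comm]
  have hloc : sawtooth lam M n i j =ᶠ[nhds x] fun y => (1 - lam) * clampR 1 (y i)
      - ∑ σ ∈ Finset.range (stripCount M n l), clampR W (ℓ σ y) := by
    have hopen : IsOpen (slab M j κ l) := by
      refine isOpen_Ioo.preimage ?_
      fun_prop
    filter_upwards [hopen.mem_nhds hxs] with y hy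
    rw [sawtooth, abs_eq_of_mem_slab hM hy, profile_eq h1 hM hl (Ioo_subset_Icc_self hy)]
  refine HasFDerivAt.congr_of_eventuallyEq ?_ hloc
  have hd1 := (hasFDerivAt_clampR zero_le_one (hasFDerivAt_coord i x) hx.2.1 hx.2.2.1).const_mul
    (1 - lam)
  have hd2 := HasFDerivAt.fun_sum (u := Finset.range (stripCount M n l)) fun σ _ =>
    hasFDerivAt_clampR hW0.le (hℓd σ) (hx.2.2.2 κ l σ).1 (hx.2.2.2 κ l σ).2
  refine (hd1.sub hd2).congr_fderiv ?_
  have hzero : ∀ κ' l', (κ' ≠ κ ∨ l' ≠ l) → ∀ σ,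
      ((longCell lam M n κ' l' σ).set i j).indicator (fun _ => (1 : ℝ)) x = 0 := by
    intro κ' l' h σ
    refine indicator_of_notMem (fun hm => ?_) _
    rw [mem_longCell_iff hij h1 hM] at hm
    have := slab_unique hM hxs hm.1
    tauto
  have hind : ∀ σ, ((longCell lam M n κ l σ).set i j).indicator (fun _ => (1 : ℝ)) x = e σ := by
    intro σ
    simp only [he, indicator, mem_longCell_iff hij h1 hM, hxs, true_and, hℓ, hW]
  have hQ : unitSquare.indicator (fun _ => (1 : ℝ)) x
      = (Ioo 0 1).indicator (fun _ => (1 : ℝ)) (x i) := by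
    simp only [indicator, Cell.mem_unitSquare_iff hij, slab_subset hM hxs, and_true]
  have hDi : sawtoothDi lam M n i j x = (1 - lam) * (Ioo 0 1).indicator (fun _ => (1 : ℝ)) (x i)
      - ∑ σ ∈ Finset.range (stripCount M n l), e σ := by
    rw [sawtoothDi, hQ, sum_stripIdx_eq
      (F := fun κ l σ => ((longCell lam M n κ l σ).set i j).indicator (fun _ => (1 : ℝ)) x) hl hzero]
    simp only [hind]
  have hDj : sawtoothDj lam M n i j x = ∑ σ ∈ Finset.range (stripCount M n l), s σ * e σ := by
    rw [sawtoothDj, sum_stripIdx_eq (F := fun κ l σ => (longCell lam M n κ l σ).s *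
      ((longCell lam M n κ l σ).set i j).indicator (fun _ => (1 : ℝ)) x) hl
      (fun κ' l' h σ => by rw [hzero κ' l' h, mul_zero])]
    simp only [hind]
    rfl
  rw [hDi, hDj]
  ext v
  simp only [sub_apply, add_apply, smul_apply, sum_apply, smul_eq_mul, PiLp.proj_apply, sub_mul, Finset.sum_mul, mul_sub, Finset.sum_sub_distrib]
  have key : ∑ σ ∈ Finset.range (stripCount M n l), e σ * (s σ * v j)
      = ∑ σ ∈ Finset.range (stripCount M n l), s σ * e σ * v j :=
    Finset.sum_congr rfl fun σ _ => by ring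
  simp only [he] at key ⊢
  linear_combination key

end Sawtooth

/-- A smooth function equal to `1` at distance at most `a` from `1/2` and to `0` at distance at
least `b`, with scale-invariant derivative bounds. -/
structure IsCutoff (C a b : ℝ) (η : ℝ → ℝ) : Prop where
  smooth : ContDiff ℝ ∞ η
  nonneg : ∀ t, 0 ≤ η t
  le_one : ∀ t, η t ≤ 1
  eq_one : ∀ t, |t - 1 / 2| ≤ a → η t = 1
  eq_zero : ∀ t, b ≤ |t - 1 / 2| → η t = 0
  deriv_le : ∀ t, |deriv η t| ≤ C / (b - a)
  deriv_deriv_le : ∀ t, |deriv (deriv η) t| ≤ C / (b - a) ^ 2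

namespace IsCutoff

variable {C a b : ℝ} {η : ℝ → ℝ}

lemma deriv_eq_zero (h : IsCutoff C a b η) {t : ℝ} (ht : |t - 1 / 2| ≤ a ∨ b ≤ |t - 1 / 2|) :
    deriv η t = 0 := by
  rcases ht with ht | ht
  · refine IsLocalMax.deriv_eq_zero (.of_forall fun u => ?_)
    rw [h.eq_one t ht]
    exact h.le_one u
  · refine IsLocalMin.deriv_eq_zero (.of_forall fun u => ?_)
    rw [h.eq_zero t ht]
    exact h.nonneg u

lemma deriv_deriv_eq_zero (h : IsCutoff C a b η) {t : ℝ}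
    (ht : |t - 1 / 2| < a ∨ b < |t - 1 / 2|) : deriv (deriv η) t = 0 := by
  have hc : Continuous fun u : ℝ => |u - 1 / 2| := by fun_prop
  have : deriv η =ᶠ[nhds t] fun _ => 0 := by
    rcases ht with ht | ht
    · filter_upwards [(isOpen_Iio.preimage hc).mem_nhds ht] with u hu
      exact h.deriv_eq_zero (Or.inl (le_of_lt hu))
    · filter_upwards [(isOpen_Ioi.preimage hc).mem_nhds ht] with u hu
      exact h.deriv_eq_zero (Or.inr (le_of_lt hu))
  rw [this.deriv_eq, deriv_const]

lemma abs_le_one (h : IsCutoff C a b η) (t : ℝ) : |η t| ≤ 1 := by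
  rw [abs_of_nonneg (h.nonneg t)]
  exact h.le_one t

lemma smooth_deriv (h : IsCutoff C a b η) : ContDiff ℝ ∞ (deriv η) :=
  (contDiff_infty_iff_deriv.1 h.smooth).2

lemma hasDerivAt (h : IsCutoff C a b η) (t : ℝ) : HasDerivAt η (deriv η t) t :=
  (h.smooth.differentiable (by simp) t).hasDerivAt

lemma hasDerivAt_deriv (h : IsCutoff C a b η) (t : ℝ) :
    HasDerivAt (deriv η) (deriv (deriv η) t) t :=
  (h.smooth_deriv.differentiable (by simp) t).hasDerivAt

end IsCutoff

lemma exists_isCutoff : ∃ C : ℝ, 0 < C ∧ ∀ a b : ℝ, 0 ≤ a → a < b → ∃ η, IsCutoff C a b η := by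
  obtain ⟨C, hC, h⟩ := exists_cutoff
  refine ⟨C, hC, fun a b ha hab => ?_⟩
  obtain ⟨η, h1, h2, h3, h4, h5, h6⟩ := h a b ha hab
  exact ⟨η, h1, fun t => (h2 t).1, fun t => (h2 t).2, h3, h4, h5, h6⟩

lemma lipschitz_of_deriv_bound {g : ℝ → ℝ} {C : ℝ} (hg : Differentiable ℝ g)
    (hC : ∀ t, |deriv g t| ≤ C) : ∃ K, LipschitzWith K g := by
  refine ⟨C.toNNReal, lipschitzWith_of_nnnorm_deriv_le hg fun t => ?_⟩
  rw [← NNReal.coe_le_coe, coe_nnnorm, Real.norm_eq_abs]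
  exact (hC t).trans (Real.le_coe_toNNReal C)

lemma lipschitzWith_coord (k : Fin 2) : LipschitzWith 1 fun x : Plane => x k := by
  refine LipschitzWith.of_dist_le_mul fun x y => ?_
  rw [NNReal.coe_one, one_mul, Real.dist_eq, dist_eq_norm]
  exact PiLp.norm_apply_le (x - y) k

lemma exists_lipschitz_sum {X ι E : Type*} [PseudoMetricSpace X] [SeminormedAddCommGroup E]
    (s : Finset ι) {F : ι → X → E}
    (h : ∀ c ∈ s, ∃ K, LipschitzWith K (F c)) : ∃ K, LipschitzWith K fun x => ∑ c ∈ s, F c x := by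
  classical
  induction s using Finset.induction_on with
  | empty => exact ⟨0, by simpa using LipschitzWith.const (0 : E)⟩
  | insert a s ha ih =>
    simp only [Finset.sum_insert ha]
    obtain ⟨K, hK⟩ := h a (Finset.mem_insert_self _ _)
    obtain ⟨L, hL⟩ := ih fun c hc => h c (Finset.mem_insert_of_mem hc)
    exact ⟨K + L, hK.add hL⟩

lemma exists_lipschitz_const_mul {X : Type*} [PseudoMetricSpace X] {F : X → ℝ} (c : ℝ)
    (h : ∃ K, LipschitzWith K F) : ∃ K, LipschitzWith K fun x => c * F x := by
  obtain ⟨K, hK⟩ := h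
  exact ⟨_, (lipschitzWith_smul c).comp hK⟩

/-! ### Size, boundary values and variation of the sawtooth -/

section Sawtooth

variable {lam : ℝ} {M n : ℕ} {i j : Fin 2}

lemma exists_lipschitz_sawtooth : ∃ K, LipschitzWith K (sawtooth lam M n i j) := by
  have hr : LipschitzWith 1 fun x : Plane => |x j - 1 / 2| := by
    have h1 : LipschitzWith (1 * (1 + 0)) fun x : Plane => ‖x j - 1 / 2‖ :=
      lipschitzWith_one_norm.comp ((lipschitzWith_coord j).sub (LipschitzWith.const (1 / 2 : ℝ)))
    simpa using h1
  have hcoord : ∀ l, ∃ K, LipschitzWith K fun x : Plane => layerCoord M l |x j - 1 / 2| := by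
    intro l
    obtain ⟨K, hK⟩ := exists_lipschitz_const_mul (1 / layerHeight M l)
      ⟨_, hr.sub (LipschitzWith.const (node M l))⟩
    have e : (fun x : Plane => layerCoord M l |x j - 1 / 2|)
        = fun x : Plane => clampR 1 (1 / layerHeight M l * (|x j - 1 / 2| - node M l)) := by
      funext x
      rw [layerCoord, div_eq_mul_one_div, mul_comm]
    rw [e]
    exact ⟨_, lipschitzWith_clampR.comp hK⟩
  have hpath : ∀ s, ∃ K, LipschitzWith K fun x : Plane => finePath lam M n s |x j - 1 / 2| := by
    intro s
    obtain ⟨K, hK⟩ := exists_lipschitz_sum (Finset.range (n + 1))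
      (F := fun l (x : Plane) => (stripShift M n (l + 1) s - stripShift M n l s)
        * layerCoord M l |x j - 1 / 2|) fun l _ => exists_lipschitz_const_mul _ (hcoord l)
    obtain ⟨L, hL⟩ := exists_lipschitz_const_mul lam
      ⟨_, (LipschitzWith.const (stripShift M n 0 s)).add hK⟩
    simp only [finePath, mul_comm (layerCoord M _ _)]
    exact ⟨_, (LipschitzWith.const (s * stripWidth lam M n n)).add hL⟩
  obtain ⟨K, hK⟩ := exists_lipschitz_const_mul (1 - lam)
    ⟨_, (lipschitzWith_clampR (W := 1)).comp (lipschitzWith_coord i)⟩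
  obtain ⟨L, hL⟩ := exists_lipschitz_sum (Finset.range (stripCount M n n))
    (F := fun s (x : Plane) => clampR (stripWidth lam M n n) (x i - finePath lam M n s |x j - 1 / 2|))
    fun s _ => by
      obtain ⟨L, hL⟩ := hpath s
      exact ⟨_, lipschitzWith_clampR.comp ((lipschitzWith_coord i).sub hL)⟩
  exact ⟨_, hK.sub hL⟩

lemma abs_sawtooth_le (h0 : 0 ≤ lam) (h1 : lam < 1) (hM : 4 ≤ M) (x : Plane) :
    |sawtooth lam M n i j x| ≤ 1 := by
  have hW := (stripWidth_pos (n := n) h1 hM n).le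
  have a1 : 0 ≤ clampR 1 (x i) := clampR_nonneg
  have a2 : clampR 1 (x i) ≤ 1 := clampR_le zero_le_one
  set S := ∑ s ∈ Finset.range (stripCount M n n),
    clampR (stripWidth lam M n n) (x i - finePath lam M n s |x j - 1 / 2|) with hS
  have b1 : 0 ≤ S := Finset.sum_nonneg fun _ _ => clampR_nonneg
  have b2 : S ≤ 1 - lam := by
    calc S ≤ ∑ _s ∈ Finset.range (stripCount M n n), stripWidth lam M n n :=
          Finset.sum_le_sum fun _ _ => clampR_le hW
      _ = 1 - lam := by
          rw [Finset.sum_const, Finset.card_range, nsmul_eq_mul, stripWidth, mul_left_comm,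
            stripCount_mul_period hM, mul_one]
  have e : sawtooth lam M n i j x = (1 - lam) * clampR 1 (x i) - S := rfl
  rw [e, abs_le]
  constructor <;> nlinarith

lemma exists_layer {r : ℝ} (h0 : 0 ≤ r) (hr : r ≤ node M (n + 1)) :
    ∃ l ≤ n, r ∈ Icc (node M l) (node M (l + 1)) := by
  classical
  have hex : ∃ l, r ≤ node M (l + 1) := ⟨n, hr⟩
  refine ⟨Nat.find hex, Nat.find_min' hex hr, ?_, Nat.find_spec hex⟩
  rcases hf : Nat.find hex with _ | l
  · rwa [node_zero]
  · exact (not_le.1 (Nat.find_min hex (m := l) (by omega))).le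

lemma sawtooth_eq_zero (hij : i ≠ j) (h0 : 0 ≤ lam) (h1 : lam < 1) (hM : 4 ≤ M) {x : Plane}
    (hr : |x j - 1 / 2| ≤ node M (n + 1)) (hx : x ∉ unitSquare) : sawtooth lam M n i j x = 0 := by
  obtain ⟨l, hl, hrl⟩ := exists_layer (abs_nonneg _) hr
  have hj : x j ∈ Ioo (0 : ℝ) 1 := by
    have := abs_le.1 hr
    have := node_lt_half hM (n + 1)
    constructor <;> linarith
  rw [Cell.mem_unitSquare_iff hij] at hx
  have hi : x i ∉ Ioo (0 : ℝ) 1 := fun h => hx ⟨h, hj⟩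
  rcases not_and_or.1 hi with h | h
  · exact profile_of_le_zero h0 h1 hM hl hrl (not_lt.1 h)
  · exact profile_of_one_le h0 h1 hM hl hrl (not_lt.1 h)

lemma abs_sawtooth_le_layerHeight (h0 : 0 ≤ lam) (h1 : lam < 1) (hM : 4 ≤ M) {x : Plane}
    (hr : |x j - 1 / 2| ∈ Icc (node M n) (node M (n + 1))) :
    |sawtooth lam M n i j x| ≤ 3 * layerHeight M n := by
  refine (abs_profile_le h0 h1 hM le_rfl hr _).trans ?_
  have := period_le_layerHeight (n := n) hM n
  rwa [div_self (by positivity), mul_one] at this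

lemma longCell_h_ne_zero (hM : 4 ≤ M) (κ : Bool) (l σ : ℕ) : (longCell lam M n κ l σ).h ≠ 0 :=
  mul_ne_zero (sgn_ne_zero κ) (layerHeight_pos hM l).ne'

lemma abs_longCell_h (hM : 4 ≤ M) (κ : Bool) (l σ : ℕ) :
    |(longCell lam M n κ l σ).h| = layerHeight M l := by
  rw [longCell, abs_mul, abs_sgn, one_mul, abs_of_pos (layerHeight_pos hM l)]

lemma abs_longCell_s_le (h0 : 0 ≤ lam) (h1 : lam < 1) (hM : 4 ≤ M) (κ : Bool) (l σ : ℕ) :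
    |(longCell lam M n κ l σ).s| ≤ 3 * ((2 : ℝ) ^ l / 2 ^ n) := by
  rw [longCell, abs_mul, abs_sgn, one_mul]
  exact abs_stripSlope_le h0 h1 hM l σ

lemma abs_longCell_s_le_three (h0 : 0 ≤ lam) (h1 : lam < 1) (hM : 4 ≤ M) (κ : Bool) {l : ℕ}
    (hl : l ≤ n) (σ : ℕ) : |(longCell lam M n κ l σ).s| ≤ 3 :=
  (abs_longCell_s_le h0 h1 hM κ l σ).trans (by linarith [two_pow_div_le_one hl])

lemma sawtoothD_of_mem (hij : i ≠ j) (h0 : 0 ≤ lam) (h1 : lam < 1) (hM : 4 ≤ M) {x : Plane}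
    (c : StripIdx M n) (hx : x ∈ (longCell lam M n c.1 c.2.1 c.2.2).set i j) :
    sawtoothDi lam M n i j x = -lam ∧
      sawtoothDj lam M n i j x = (longCell lam M n c.1 c.2.1 c.2.2).s := by
  have hother : ∀ c' : StripIdx M n, c' ≠ c →
      ((longCell lam M n c'.1 c'.2.1 c'.2.2).set i j).indicator (fun _ => (1 : ℝ)) x = 0 := by
    intro c' hc'
    refine indicator_of_notMem (fun h => hc' ?_) _
    obtain ⟨e1, e2, e3⟩ := longCell_unique hij h0 h1 hM hx h
    obtain ⟨κ, l, σ⟩ := c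
    obtain ⟨κ', l', σ'⟩ := c'
    obtain rfl : κ' = κ := e1
    obtain rfl : l' = l := Fin.ext e2
    obtain rfl : σ' = σ := Fin.ext e3
    rfl
  have hQ := longCell_subset hij h0 h1 hM c.2.2.2 hx
  constructor
  · rw [sawtoothDi, Fintype.sum_eq_single c hother, indicator_of_mem hx, indicator_of_mem hQ]
    ring
  · rw [sawtoothDj, Fintype.sum_eq_single c fun c' hc' => by rw [hother c' hc', mul_zero],
      indicator_of_mem hx, mul_one]

lemma sawtoothD_of_notMem {x : Plane}
    (hx : ∀ c : StripIdx M n, x ∉ (longCell lam M n c.1 c.2.1 c.2.2).set i j) :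
    sawtoothDi lam M n i j x = (1 - lam) * unitSquare.indicator (fun _ => (1 : ℝ)) x ∧
      sawtoothDj lam M n i j x = 0 := by
  constructor
  · rw [sawtoothDi, Finset.sum_eq_zero fun c _ => indicator_of_notMem (hx c) _, sub_zero]
  · exact Finset.sum_eq_zero fun c _ => by rw [indicator_of_notMem (hx c), mul_zero]

lemma sawtoothD_off (hij : i ≠ j) (h0 : 0 ≤ lam) (h1 : lam < 1) (hM : 4 ≤ M) {x : Plane}
    (hx : x ∉ unitSquare) : sawtoothDi lam M n i j x = 0 ∧ sawtoothDj lam M n i j x = 0 := by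
  have := sawtoothD_of_notMem (lam := lam) (M := M) (n := n) (i := i) (j := j) (x := x)
    fun c hc => hx (longCell_subset hij h0 h1 hM c.2.2.2 hc)
  rwa [indicator_of_notMem hx, mul_zero] at this

lemma abs_sawtoothD_le (hij : i ≠ j) (h0 : 0 ≤ lam) (h1 : lam < 1) (hM : 4 ≤ M) (x : Plane) :
    |sawtoothDi lam M n i j x| ≤ 1 ∧ |sawtoothDj lam M n i j x| ≤ 3 := by
  by_cases h : ∃ c : StripIdx M n, x ∈ (longCell lam M n c.1 c.2.1 c.2.2).set i j
  · obtain ⟨c, hc⟩ := h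
    obtain ⟨e1, e2⟩ := sawtoothD_of_mem hij h0 h1 hM c hc
    rw [e1, e2, abs_neg, abs_of_nonneg h0]
    exact ⟨h1.le, abs_longCell_s_le_three h0 h1 hM _ (by omega) _⟩
  · push Not at h
    obtain ⟨e1, e2⟩ := sawtoothD_of_notMem h
    rw [e1, e2, abs_zero]
    refine ⟨?_, by norm_num⟩
    by_cases hQ : x ∈ unitSquare
    · rw [indicator_of_mem hQ, mul_one, abs_of_nonneg (by linarith)]
      linarith
    · rw [indicator_of_notMem hQ, mul_zero, abs_zero]
      norm_num

lemma stripCount_mul_layerHeight_le (hM : 4 ≤ M) (l : ℕ) :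
    (stripCount M n l : ℝ) * layerHeight M l ≤ M * 2 ^ n * (1 / 2) ^ l := by
  have hM0 : (0 : ℝ) < M := by exact_mod_cast (by omega : 0 < M)
  calc (stripCount M n l : ℝ) * layerHeight M l
      ≤ stripCount M n l * (1 / (2 ^ l * M ^ l)) := by
        gcongr
        exact layerHeight_le hM l
    _ = M * 2 ^ n * (1 / 2) ^ l := by
        unfold stripCount
        push_cast
        rw [one_div_pow]
        field_simp
        ring

lemma stripCount_mul_stripWidth (hM : 4 ≤ M) (l : ℕ) :
    (stripCount M n l : ℝ) * stripWidth lam M n l = 1 - lam := by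
  rw [stripWidth, mul_left_comm, stripCount_mul_period hM, mul_one]

/-- Strip lengths in layer `l` add up to at most `M * 2 ^ n * (1 / 2) ^ l`, a geometric series; the
widths of a layer add up to at most one, and `n + 1 ≤ 2 ^ n`. This gives 6 + 1 for each of the two
halves. -/
lemma sum_stripIdx_perimeter_le (h0 : 0 ≤ lam) (hM : 4 ≤ M) :
    ∑ c : StripIdx M n, (3 * |(longCell lam M n c.1 c.2.1 c.2.2).h|
      + (longCell lam M n c.1 c.2.1 c.2.2).w) ≤ 14 * M * 2 ^ n := by
  have hM0 : (4 : ℝ) ≤ M := by exact_mod_cast hM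
  simp only [abs_longCell_h hM, Fintype.sum_prod_type, Fintype.sum_sigma]
  simp only [longCell, Finset.sum_const, Finset.card_univ, Fintype.card_bool, Fintype.card_fin,
    nsmul_eq_mul]
  have h2 : ∑ l : Fin (n + 1), (stripCount M n l : ℝ) * (3 * layerHeight M l + stripWidth lam M n l)
      ≤ ∑ l : Fin (n + 1), (3 * (M * 2 ^ n * (1 / 2 : ℝ) ^ (l : ℕ)) + 1) := by
    refine Finset.sum_le_sum fun l _ => ?_
    rw [mul_add, stripCount_mul_stripWidth hM, mul_left_comm]
    linarith [stripCount_mul_layerHeight_le (n := n) hM l]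
  have h3 : ∑ l : Fin (n + 1), (3 * (M * 2 ^ n * (1 / 2 : ℝ) ^ (l : ℕ)) + 1)
      ≤ 7 * M * 2 ^ n := by
    rw [Finset.sum_add_distrib, ← Finset.mul_sum, ← Finset.mul_sum,
      Fin.sum_univ_eq_sum_range (fun l => (1 / 2 : ℝ) ^ l)]
    have h4 := sum_geometric_two_le (n + 1)
    have h5 : ((n : ℝ) + 1) ≤ 2 ^ n := by exact_mod_cast Nat.lt_two_pow_self (n := n)
    have h6 : (0 : ℝ) < 2 ^ n := by positivity
    simp only [Finset.sum_const, Finset.card_univ, Fintype.card_fin, nsmul_eq_mul, mul_one]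
    push_cast
    have h7 : (M : ℝ) * 2 ^ n * ∑ i ∈ Finset.range (n + 1), (1 / 2 : ℝ) ^ i ≤ M * 2 ^ n * 2 := by
      gcongr
    nlinarith
  push_cast
  linarith

lemma varBound_sawtoothDi (hij : i ≠ j) (h0 : 0 ≤ lam) (h1 : lam < 1) (hM : 4 ≤ M) :
    VarBound (sawtoothDi lam M n i j) (2 + 28 * M * 2 ^ n) := by
  have h := VarBound.sum Finset.univ (F := fun (c : StripIdx M n) =>
    ((longCell lam M n c.1 c.2.1 c.2.2).set i j).indicator fun _ => (1 : ℝ)) fun c _ =>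
    Cell.varBound_indicator hij (stripWidth_pos h1 hM _) (longCell_h_ne_zero hM c.1 c.2.1 c.2.2)
      (abs_longCell_s_le_three h0 h1 hM _ (by omega) _)
  refine ((VarBound.indicator_unitSquare.const_mul (1 - lam)).sub h).mono ?_
  rw [← Finset.sum_mul, abs_of_nonneg (by linarith)]
  linarith [sum_stripIdx_perimeter_le (n := n) h0 hM]

lemma varBound_sawtoothDj (hij : i ≠ j) (h0 : 0 ≤ lam) (h1 : lam < 1) (hM : 4 ≤ M) :
    VarBound (sawtoothDj lam M n i j) (84 * M * 2 ^ n) := by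
  have h := VarBound.sum Finset.univ (F := fun (c : StripIdx M n) x =>
    (longCell lam M n c.1 c.2.1 c.2.2).s *
    ((longCell lam M n c.1 c.2.1 c.2.2).set i j).indicator (fun _ => (1 : ℝ)) x) fun c _ =>
    ((Cell.varBound_indicator hij (stripWidth_pos h1 hM _) (longCell_h_ne_zero hM c.1 c.2.1 c.2.2)
      (abs_longCell_s_le_three h0 h1 hM _ (by omega) _)).const_mul _).mono
      (mul_le_mul_of_nonneg_right (abs_longCell_s_le_three h0 h1 hM _ (by omega) _) (by
        have := (stripWidth_pos (n := n) h1 hM c.2.1).le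
        have : 0 ≤ (longCell lam M n c.1 c.2.1 c.2.2).w := this
        positivity))
  refine h.mono ?_
  rw [← Finset.mul_sum, ← Finset.sum_mul]
  linarith [sum_stripIdx_perimeter_le (n := n) h0 hM]

/-- The neighbourhood of the boundary in which the sawtooth is cut off. -/
def boundaryLayer (M n : ℕ) (j : Fin 2) : Set Plane := {x ∈ unitSquare | node M n ≤ |x j - 1 / 2|}

lemma measurableSet_boundaryLayer : MeasurableSet (boundaryLayer M n j) :=
  measurableSet_unitSquare.inter
    (isClosed_Ici.preimage (f := fun x : Plane => |x j - 1 / 2|) (by fun_prop)).measurableSet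

lemma volume_boundaryLayer_le (hij : i ≠ j) (hM : 4 ≤ M) :
    volume (boundaryLayer M n j) ≤ ENNReal.ofReal ((1 / (2 * M)) ^ n) := by
  have hq : (0 : ℝ) < (1 / (2 * M)) ^ n := by
    have : (0 : ℝ) < M := by exact_mod_cast (by omega : 0 < M)
    positivity
  set q : ℝ := (1 / (2 * M)) ^ n with hq'
  have hbox : ∀ s : Set ℝ, volume {x : Plane | x i ∈ Ioo (0 : ℝ) 1 ∧ x j ∈ s} = volume s := by
    intro s
    fin_cases i <;> fin_cases j <;> simp only [Fin.mk_zero, Fin.mk_one, ne_eq, not_true] at hij ⊢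
    · rw [volume_box]; simp
    · simp_rw [and_comm]
      rw [volume_box]; simp
  have hsub : boundaryLayer M n j ⊆ {x : Plane | x i ∈ Ioo (0 : ℝ) 1 ∧ x j ∈ Icc 0 (q / 2)}
      ∪ {x : Plane | x i ∈ Ioo (0 : ℝ) 1 ∧ x j ∈ Icc (1 - q / 2) 1} := by
    rintro x ⟨hx, hr⟩
    rw [Cell.mem_unitSquare_iff hij] at hx
    have hn : node M n = (1 - q) / 2 := rfl
    rw [hn] at hr
    rcases le_abs.1 hr with h | h
    · exact Or.inr ⟨hx.1, by linarith, hx.2.2.le⟩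
    · exact Or.inl ⟨hx.1, hx.2.1.le, by linarith⟩
  refine (measure_mono hsub).trans ((measure_union_le _ _).trans ?_)
  rw [hbox, hbox, Real.volume_Icc, Real.volume_Icc, ← ENNReal.ofReal_add (by linarith) (by linarith)]
  exact ENNReal.ofReal_le_ofReal (by linarith)

lemma volume_boundaryLayer_le_layerHeight (hij : i ≠ j) (hM : 4 ≤ M) :
    volume.real (boundaryLayer M n j) ≤ 3 * layerHeight M n := by
  have h := layerHeight_pos hM n
  have hM0 : (0 : ℝ) < M := by exact_mod_cast (by omega : 0 < M)
  refine ENNReal.toReal_le_of_le_ofReal (by linarith) ((volume_boundaryLayer_le hij hM).trans ?_)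
  refine ENNReal.ofReal_le_ofReal ?_
  have := pow_ratio_le_layerHeight hM n
  rw [one_div_pow, mul_pow]
  linarith

end Sawtooth

lemma hasFDerivAt_comp_coord {g : ℝ → ℝ} {g' : ℝ} {k : Fin 2} {x : Plane}
    (h : HasDerivAt g g' (x k)) :
    HasFDerivAt (fun x : Plane => g (x k)) (g' • EuclideanSpace.proj (𝕜 := ℝ) k) x :=
  h.comp_hasFDerivAt x (hasFDerivAt_coord k x)

lemma hasCompactSupport_of_eq_zero {f : Plane → ℝ} (h : ∀ x, x ∉ unitSquare → f x = 0) :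
    HasCompactSupport f := by
  have hb : Bornology.IsBounded unitSquare := by
    refine (Metric.isBounded_closedBall (x := (0 : Plane)) (r := 2)).subset fun x hx => ?_
    rw [mem_closedBall_zero_iff, EuclideanSpace.norm_eq, Fin.sum_univ_two]
    have h0 := hx 0
    have h1 := hx 1
    rw [Real.sqrt_le_left (by norm_num), Real.norm_eq_abs, Real.norm_eq_abs, sq_abs, sq_abs]
    nlinarith [h0.1, h0.2, h1.1, h1.2]
  refine HasCompactSupport.intro hb.isCompact_closure fun x hx => h x fun hQ => hx ?_
  exact subset_closure hQ

/-! ### Cutting the sawtooth off near `x j = 0` and `x j = 1` -/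

section CutSawtooth

variable {lam C : ℝ} {M n : ℕ} {i j : Fin 2} {η : ℝ → ℝ}

/-- Near almost every point, either the sawtooth is affine or the cut-off vanishes. -/
lemma ae_sawtooth_cases (hij : i ≠ j) (h1 : lam < 1) (hM : 4 ≤ M) : ∀ᵐ x : Plane,
    node M (n + 1) < |x j - 1 / 2| ∨ ((|x j - 1 / 2| < node M n ∨
      |x j - 1 / 2| ∈ Ioo (node M n) (node M (n + 1))) ∧
      HasFDerivAt (sawtooth lam M n i j) (sawtoothDi lam M n i j x • EuclideanSpace.proj (𝕜 := ℝ) i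
        + sawtoothDj lam M n i j x • EuclideanSpace.proj (𝕜 := ℝ) j) x) := by
  filter_upwards [ae_offInterfaces (lam := lam) (n := n) hij hM] with x hx
  rcases lt_or_gt_of_ne (hx.1 (n + 1)) with h | h
  · obtain ⟨κ, l, hl, hxs⟩ := exists_slab h hx.1
    refine Or.inr ⟨?_, hasFDerivAt_sawtooth hij h1 hM hx hl hxs⟩
    rcases lt_or_gt_of_ne (hx.1 n) with h' | h'
    · exact Or.inl h'
    · exact Or.inr ⟨h', h⟩
  · exact Or.inl h

lemma eventually_far {x : Plane} {b : ℝ} (h : b < |x j - 1 / 2|) :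
    ∀ᶠ y : Plane in nhds x, b < |y j - 1 / 2| :=
  (isOpen_Ioi.preimage (f := fun y : Plane => |y j - 1 / 2|) (by fun_prop)).mem_nhds h

/-- The derivative of the cut-off sawtooth. -/
lemma ae_hasFDerivAt_cut (hij : i ≠ j) (h1 : lam < 1) (hM : 4 ≤ M)
    (hη : IsCutoff C (node M n) (node M (n + 1)) η) : ∀ᵐ x : Plane,
    HasFDerivAt (fun x => η (x j) * sawtooth lam M n i j x)
      ((η (x j) * sawtoothDi lam M n i j x) • EuclideanSpace.proj (𝕜 := ℝ) i
        + (η (x j) * sawtoothDj lam M n i j x + deriv η (x j) * sawtooth lam M n i j x)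
          • EuclideanSpace.proj (𝕜 := ℝ) j) x := by
  filter_upwards [ae_sawtooth_cases (lam := lam) (n := n) hij h1 hM] with x hx
  rcases hx with h | ⟨-, h⟩
  · rw [hη.eq_zero _ h.le, hη.deriv_eq_zero (Or.inr h.le)]
    simp only [zero_mul, zero_smul, add_zero]
    refine (hasFDerivAt_const (0 : ℝ) x).congr_of_eventuallyEq ?_
    filter_upwards [eventually_far h] with y hy
    rw [hη.eq_zero _ hy.le, zero_mul]
  · refine ((hasFDerivAt_comp_coord (hη.hasDerivAt (x j))).mul h).congr_fderiv ?_
    module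

/-- The part of the derivative that comes from the cut-off has bounded variation. -/
lemma varBound_deriv_cutoff_mul (hij : i ≠ j) (h0 : 0 ≤ lam) (h1 : lam < 1) (hM : 4 ≤ M)
    (hη : IsCutoff C (node M n) (node M (n + 1)) η) (hC : 0 < C) :
    VarBound (fun x => deriv η (x j) * sawtooth lam M n i j x) (18 * C) := by
  have hh := layerHeight_pos hM n
  have hd1 : ∀ t, |deriv η t| ≤ C / layerHeight M n := hη.deriv_le
  have hd2 : ∀ t, |deriv (deriv η) t| ≤ C / layerHeight M n ^ 2 := hη.deriv_deriv_le
  have hoff : ∀ x : Plane, x ∉ unitSquare → deriv η (x j) * sawtooth lam M n i j x = 0 := by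
    intro x hx
    rcases le_total |x j - 1 / 2| (node M (n + 1)) with h | h
    · rw [sawtooth_eq_zero hij h0 h1 hM h hx, mul_zero]
    · rw [hη.deriv_eq_zero (Or.inr h), zero_mul]
  obtain ⟨K, hK⟩ : ∃ K, LipschitzWith K fun x : Plane => deriv η (x j) := by
    obtain ⟨K, hK⟩ := lipschitz_of_deriv_bound (hη.smooth_deriv.differentiable (by simp)) hd2
    exact ⟨_, hK.comp (lipschitzWith_coord j)⟩
  obtain ⟨L, hL⟩ := exists_lipschitz_sawtooth (lam := lam) (M := M) (n := n) (i := i) (j := j)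
  obtain ⟨D, hD⟩ := hK.mul_of_bounded hL (fun x => hd1 (x j)) (abs_sawtooth_le h0 h1 hM)
  set g : Fin 2 → Plane → ℝ := fun k x => if k = i then deriv η (x j) * sawtoothDi lam M n i j x
    else deriv η (x j) * sawtoothDj lam M n i j x
      + sawtooth lam M n i j x * deriv (deriv η) (x j) with hg
  have hB := measurableSet_boundaryLayer (M := M) (n := n) (j := j)
  have hBfin : volume (boundaryLayer M n j) ≠ ⊤ :=
    ((volume_boundaryLayer_le hij hM).trans_lt ENNReal.ofReal_lt_top).ne
  refine hD.varBound (g := g)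
    (b := (boundaryLayer M n j).indicator fun _ => 6 * C / layerHeight M n)
    (hasCompactSupport_of_eq_zero hoff) (fun k => ?_) ?_ (fun k => ?_) ?_
  · filter_upwards [ae_sawtooth_cases (lam := lam) (n := n) hij h1 hM] with x hx
    rcases hx with h | ⟨-, h⟩
    · have hgx : g k x = 0 := by
        simp only [hg, hη.deriv_eq_zero (Or.inr h.le), hη.deriv_deriv_eq_zero (Or.inr h), zero_mul,
          mul_zero, add_zero, ite_self]
      rw [hgx]
      have : HasFDerivAt (fun x => deriv η (x j) * sawtooth lam M n i j x)
          (0 : Plane →L[ℝ] ℝ) x := by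
        refine (hasFDerivAt_const (0 : ℝ) x).congr_of_eventuallyEq ?_
        filter_upwards [eventually_far h] with y hy
        rw [hη.deriv_eq_zero (Or.inr hy.le), zero_mul]
      exact this.hasLineDerivAt _
    · have := ((hasFDerivAt_comp_coord (hη.hasDerivAt_deriv (x j))).mul h).hasLineDerivAt
        (EuclideanSpace.single k 1)
      suffices e : g k x = (deriv η (x j) • (sawtoothDi lam M n i j x • EuclideanSpace.proj (𝕜 := ℝ) i
          + sawtoothDj lam M n i j x • EuclideanSpace.proj (𝕜 := ℝ) j) + sawtooth lam M n i j x •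
          deriv (deriv η) (x j) • EuclideanSpace.proj (𝕜 := ℝ) j) (EuclideanSpace.single k 1) by
        rw [e]
        exact this
      rcases (by fin_cases i <;> fin_cases j <;> fin_cases k <;> simp at hij ⊢ : k = i ∨ k = j)
        with rfl | rfl
      · simp [hg, hij.symm]
      · simp [hg, hij, hij.symm]
  · exact (integrable_indicator_iff hB).2 (integrableOn_const hBfin)
  · filter_upwards [ae_sawtooth_cases (lam := lam) (n := n) hij h1 hM] with x hx
    by_cases hxB : x ∈ boundaryLayer M n j
    · rw [indicator_of_mem hxB]
      obtain ⟨b1, b2⟩ := abs_sawtoothD_le (n := n) hij h0 h1 hM x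
      have c1 : |deriv η (x j) * sawtoothDi lam M n i j x| ≤ C / layerHeight M n * 1 := by
        rw [abs_mul]
        gcongr
        exact hd1 _
      have c2 : |deriv η (x j) * sawtoothDj lam M n i j x| ≤ C / layerHeight M n * 3 := by
        rw [abs_mul]
        gcongr
        exact hd1 _
      -- In the last layer the sawtooth is no larger than three layer heights, which cancels one of
      -- the two inverse powers in the bound for η''.
      have c3 : |sawtooth lam M n i j x * deriv (deriv η) (x j)| ≤ 3 * C / layerHeight M n := by
        rcases lt_or_ge (node M (n + 1)) |x j - 1 / 2| with h | h
        · rw [hη.deriv_deriv_eq_zero (Or.inr h), mul_zero, abs_zero]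
          positivity
        · rw [abs_mul]
          calc |sawtooth lam M n i j x| * |deriv (deriv η) (x j)|
              ≤ 3 * layerHeight M n * (C / layerHeight M n ^ 2) := by
                gcongr
                · exact abs_sawtooth_le_layerHeight h0 h1 hM ⟨hxB.2, h⟩
                · exact hd2 _
            _ = 3 * C / layerHeight M n := by field_simp
      have e : 6 * C / layerHeight M n = C / layerHeight M n * 3 + 3 * C / layerHeight M n := by ring
      have hpos : 0 < C / layerHeight M n := by positivity
      have hpos' : 0 < 3 * C / layerHeight M n := by positivity
      simp only [hg]
      split_ifs
      · linarith
      · rw [e]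
        exact (abs_add_le _ _).trans (add_le_add c2 c3)
    · rw [indicator_of_notMem hxB]
      have hz : g k x = 0 := by
        by_cases hQ : x ∈ unitSquare
        · have hlt : |x j - 1 / 2| < node M n := not_le.1 fun h => hxB ⟨hQ, h⟩
          simp only [hg, hη.deriv_eq_zero (Or.inl hlt.le), hη.deriv_deriv_eq_zero (Or.inl hlt),
            zero_mul, mul_zero, add_zero, ite_self]
        · obtain ⟨d1, d2⟩ := sawtoothD_off (n := n) hij h0 h1 hM hQ
          have d3 : sawtooth lam M n i j x * deriv (deriv η) (x j) = 0 := by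
            rcases le_or_gt |x j - 1 / 2| (node M (n + 1)) with h | h
            · rw [sawtooth_eq_zero hij h0 h1 hM h hQ, zero_mul]
            · rw [hη.deriv_deriv_eq_zero (Or.inr h), mul_zero]
          simp only [hg, d1, d2, d3, mul_zero, add_zero, ite_self]
      rw [hz, abs_zero]
  -- The boundary layer has volume at most three layer heights, so a density of order one over the
  -- height integrates to a constant independent of `n`.
  · rw [integral_indicator hB, setIntegral_const, smul_eq_mul]
    calc volume.real (boundaryLayer M n j) * (6 * C / layerHeight M n)
        ≤ 3 * layerHeight M n * (6 * C / layerHeight M n) := by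
          gcongr
          exact volume_boundaryLayer_le_layerHeight hij hM
      _ = 18 * C := by field_simp; norm_num

lemma contDiff_comp_coord (hη : ContDiff ℝ ∞ η) : ContDiff ℝ ∞ fun x : Plane => η (x j) := by
  refine hη.comp ?_
  fun_prop

/-- Cutting off costs a bounded amount of variation. -/
lemma varBound_cutoff_mul (hij : i ≠ j) (hM : 4 ≤ M)
    (hη : IsCutoff C (node M n) (node M (n + 1)) η) (hC : 0 < C) {g : Plane → ℝ} {B : ℝ}
    (hg : VarBound g B) (hg3 : ∀ x, |g x| ≤ 3) (hoff : ∀ x, x ∉ unitSquare → g x = 0) :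
    VarBound (fun x => η (x j) * g x) (B + 9 * C) := by
  have hh := layerHeight_pos hM n
  have hd1 : ∀ t, |deriv η t| ≤ C / layerHeight M n := hη.deriv_le
  have hB := measurableSet_boundaryLayer (M := M) (n := n) (j := j)
  have hBfin : volume (boundaryLayer M n j) ≠ ⊤ :=
    ((volume_boundaryLayer_le hij hM).trans_lt ENNReal.ofReal_lt_top).ne
  refine hg.smooth_mul (b := (boundaryLayer M n j).indicator fun _ => 3 * C / layerHeight M n)
    (contDiff_comp_coord hη.smooth) (fun x => hη.abs_le_one _)
    ((integrable_indicator_iff hB).2 (integrableOn_const hBfin)) (fun k => .of_forall fun x => ?_) ?_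
  · have e : |partialDeriv k (fun x : Plane => η (x j)) x| ≤ |deriv η (x j)| := by
      rw [partialDeriv, (hasFDerivAt_comp_coord (hη.hasDerivAt (x j))).fderiv]
      fin_cases k <;> fin_cases j <;> simp
    by_cases hxB : x ∈ boundaryLayer M n j
    · rw [indicator_of_mem hxB, abs_mul]
      calc |g x| * |partialDeriv k (fun x : Plane => η (x j)) x|
          ≤ 3 * (C / layerHeight M n) := by
            gcongr
            · exact hg3 x
            · exact e.trans (hd1 _)
        _ = 3 * C / layerHeight M n := by ring
    · rw [indicator_of_notMem hxB]
      by_cases hQ : x ∈ unitSquare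
      · have hlt : |x j - 1 / 2| < node M n := not_le.1 fun h => hxB ⟨hQ, h⟩
        rw [hη.deriv_eq_zero (Or.inl hlt.le), abs_zero] at e
        rw [abs_eq_zero.1 (le_antisymm e (abs_nonneg _)), mul_zero, abs_zero]
      · rw [hoff x hQ, zero_mul, abs_zero]
  · rw [integral_indicator hB, setIntegral_const, smul_eq_mul]
    calc volume.real (boundaryLayer M n j) * (3 * C / layerHeight M n)
        ≤ 3 * layerHeight M n * (3 * C / layerHeight M n) := by
          gcongr
          exact volume_boundaryLayer_le_layerHeight hij hM
      _ = 9 * C := by field_simp; norm_num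

end CutSawtooth

/-- A branched lamination at scale `2⁻ⁿ`: a compactly supported scalar function whose derivative is
`(1 - lam, 0)` in directions `(i, j)` outside finitely many cells, `(-lam, s)` in a cell of slope
`s`, up to a small bad set. -/
structure Lamination (lam p C : ℝ) (i j : Fin 2) (n : ℕ) where
  f : Plane → ℝ
  gi : Plane → ℝ
  gj : Plane → ℝ
  bad : Set Plane
  ι : Type
  fintype : Fintype ι
  cell : ι → Cell
  lipschitz : ∃ K, LipschitzWith K f
  f_off : ∀ x, x ∉ unitSquare → f x = 0
  g_off : ∀ x, x ∉ unitSquare → gi x = 0 ∧ gj x = 0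
  hasFDerivAt : ∀ᵐ x, HasFDerivAt f (gi x • EuclideanSpace.proj (𝕜 := ℝ) i
    + gj x • EuclideanSpace.proj (𝕜 := ℝ) j) x
  var_i : VarBound gi (C * 2 ^ n)
  var_j : VarBound gj (C * 2 ^ n)
  g_bound : ∀ x, |gi x| ≤ C ∧ |gj x| ≤ C
  volume_bad : volume bad ≤ ENNReal.ofReal (C * ((2 : ℝ) ^ n) ^ (-p))
  w_pos : ∀ c, 0 < (cell c).w
  w_le : ∀ c, (cell c).w ≤ |(cell c).h|
  h_le : ∀ c, |(cell c).h| ≤ 2 * (cell c).w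
  s_le : ∀ c, |(cell c).s| ≤ 3
  subset : ∀ c, (cell c).set i j ⊆ unitSquare
  unique : ∀ x c c', x ∈ (cell c).set i j → x ∈ (cell c').set i j → c' = c
  g_cell : ∀ c, ∀ x ∈ (cell c).set i j, gi x = -lam ∧ gj x = (cell c).s
  g_rest : ∀ᵐ x, x ∈ unitSquare → (∀ c, x ∉ (cell c).set i j) → x ∉ bad →
    gi x = 1 - lam ∧ gj x = 0
  sum_w : ∑ c, (cell c).w ≤ C * 2 ^ n
  sum_area : ∑ c, |(cell c).h| * (cell c).w ≤ C
  sum_slope : ∑ c, |(cell c).h| * (cell c).w * |(cell c).s| ^ p ≤ C * ((2 : ℝ) ^ n) ^ (-p)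

attribute [instance] Lamination.fintype

/-! ### Pieces of bounded aspect ratio -/

section Pieces

variable (lam : ℝ) (M n : ℕ)

/-- The number of pieces of a strip with aspect ratio between one and two. -/
noncomputable def pieces (l : ℕ) : ℕ := ⌊layerHeight M l / stripWidth lam M n l⌋₊

/-- The pieces of all strips, except those of the last layer. -/
abbrev PieceIdx : Type :=
  Bool × (Σ l : Fin n, Fin (stripCount M n l) × Fin (pieces lam M n l))

/-- A piece of a strip. -/
noncomputable def pieceCell (c : PieceIdx lam M n) : Cell :=
  (longCell lam M n c.1 c.2.1 c.2.2.1).sub (pieces lam M n c.2.1) c.2.2.2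

variable {lam M n}

lemma pieces_pos (h0 : 0 ≤ lam) (h1 : lam < 1) (hM : 4 ≤ M) {l : ℕ} (hl : l ≤ n) :
    0 < pieces lam M n l := by
  rw [pieces, Nat.floor_pos, one_le_div (stripWidth_pos h1 hM l)]
  exact stripWidth_le_layerHeight h0 hM hl

lemma pieces_mul_le (h1 : lam < 1) (hM : 4 ≤ M) (l : ℕ) :
    (pieces lam M n l : ℝ) * stripWidth lam M n l ≤ layerHeight M l := by
  rw [← le_div_iff₀ (stripWidth_pos h1 hM l)]
  exact Nat.floor_le (div_nonneg (layerHeight_pos hM l).le (stripWidth_pos h1 hM l).le)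

lemma le_two_mul_pieces (h0 : 0 ≤ lam) (h1 : lam < 1) (hM : 4 ≤ M) {l : ℕ} (hl : l ≤ n) :
    layerHeight M l ≤ 2 * stripWidth lam M n l * pieces lam M n l := by
  have hW := stripWidth_pos (n := n) h1 hM l
  have h2 : layerHeight M l / stripWidth lam M n l < pieces lam M n l + 1 :=
    Nat.lt_floor_add_one _
  have h3 : (1 : ℝ) ≤ pieces lam M n l := by exact_mod_cast pieces_pos h0 h1 hM hl
  rw [div_lt_iff₀ hW] at h2
  nlinarith

lemma abs_pieceCell_h (hM : 4 ≤ M) (c : PieceIdx lam M n) :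
    |(pieceCell lam M n c).h| = layerHeight M c.2.1 / pieces lam M n c.2.1 := by
  rw [pieceCell, Cell.sub, abs_div, abs_longCell_h hM, Nat.abs_cast]

lemma mem_slab_of_mem_pieceCell {i j : Fin 2} (hij : i ≠ j) (h1 : lam < 1)
    (hM : 4 ≤ M) {c : PieceIdx lam M n} {x : Plane} (hx : x ∈ (pieceCell lam M n c).set i j) :
    x ∈ (longCell lam M n c.1 c.2.1 c.2.2.1).set i j ∧ |x j - 1 / 2| ≤ node M n := by
  have hx' : x ∈ (longCell lam M n c.1 c.2.1 c.2.2.1).set i j :=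
    Cell.sub_subset hij (stripWidth_pos h1 hM _) (longCell_h_ne_zero hM _ _ _) c.2.2.2.2 hx
  have hs := ((mem_longCell_iff hij h1 hM).1 hx').1
  refine ⟨hx', ?_⟩
  rw [abs_eq_of_mem_slab hM hs]
  exact hs.2.le.trans ((node_strictMono hM).monotone c.2.1.2)

lemma sum_pieceIdx (F : ℕ → ℝ) : ∑ c : PieceIdx lam M n, F c.2.1
    = 2 * ∑ l ∈ Finset.range n, (stripCount M n l : ℝ) * (pieces lam M n l * F l) := by
  rw [Fintype.sum_prod_type]
  simp only [Fintype.sum_sigma, Finset.sum_const, Finset.card_univ, Fintype.card_bool,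
    Fintype.card_prod, Fintype.card_fin, nsmul_eq_mul]
  rw [Finset.sum_range]
  push_cast
  simp only [mul_assoc]

/-- The pieces of one strip have total width at most its length, so the sum is controlled by the
total length of the strips. -/
lemma sum_pieceCell_w_le (h1 : lam < 1) (hM : 4 ≤ M) :
    ∑ c : PieceIdx lam M n, (pieceCell lam M n c).w ≤ 4 * M * 2 ^ n := by
  have h := sum_pieceIdx (lam := lam) (M := M) (n := n) fun l => stripWidth lam M n l
  have h2 : ∑ l ∈ Finset.range n,
      (stripCount M n l : ℝ) * (pieces lam M n l * stripWidth lam M n l)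
      ≤ M * 2 ^ n * ∑ l ∈ Finset.range n, (1 / 2 : ℝ) ^ l := by
    rw [Finset.mul_sum]
    refine Finset.sum_le_sum fun l _ => le_trans ?_ (stripCount_mul_layerHeight_le hM l)
    gcongr
    exact pieces_mul_le h1 hM l
  have h3 : (M : ℝ) * 2 ^ n * ∑ l ∈ Finset.range n, (1 / 2 : ℝ) ^ l ≤ M * 2 ^ n * 2 := by
    gcongr
    exact sum_geometric_two_le n
  refine h.trans_le ?_
  linarith

lemma pieces_area (h0 : 0 ≤ lam) (h1 : lam < 1) (hM : 4 ≤ M) {l : ℕ} (hl : l ≤ n) :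
    (stripCount M n l : ℝ) * (pieces lam M n l *
      (layerHeight M l / pieces lam M n l * stripWidth lam M n l)) = (1 - lam) * layerHeight M l := by
  have h3 : (pieces lam M n l : ℝ) ≠ 0 := by exact_mod_cast (pieces_pos h0 h1 hM hl).ne'
  rw [← stripCount_mul_stripWidth (lam := lam) (n := n) hM l]
  field_simp

lemma sum_pieceCell_area_le (h0 : 0 ≤ lam) (h1 : lam < 1) (hM : 4 ≤ M) :
    ∑ c : PieceIdx lam M n, |(pieceCell lam M n c).h| * (pieceCell lam M n c).w ≤ 4 := by
  simp only [abs_pieceCell_h hM]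
  have h := sum_pieceIdx (lam := lam) (M := M) (n := n)
    fun l => layerHeight M l / pieces lam M n l * stripWidth lam M n l
  refine h.trans_le ?_
  rw [Finset.sum_congr rfl fun l hl => pieces_area h0 h1 hM (Finset.mem_range.1 hl).le,
    ← Finset.mul_sum]
  have h2 : ∑ l ∈ Finset.range n, layerHeight M l = node M n := by
    simp only [layerHeight]
    rw [Finset.sum_range_sub (node M), node_zero, sub_zero]
  rw [h2]
  have := node_nonneg hM n
  have := node_lt_half hM n
  nlinarith

/-- Layer `l` has area of order (2M)⁻ˡ and slopes at most 3·2^(l-n). The p-th power produces the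
growth (2^p)ˡ, which `2 ^ p ≤ M` absorbs, leaving 2⁻ᵖⁿ times a geometric series. -/
lemma sum_pieceCell_slope_le {p : ℝ} (hp : 1 ≤ p) (h0 : 0 ≤ lam) (h1 : lam < 1) (hM : 4 ≤ M)
    (hpM : (2 : ℝ) ^ p ≤ M) :
    ∑ c : PieceIdx lam M n, |(pieceCell lam M n c).h| * (pieceCell lam M n c).w
      * |(pieceCell lam M n c).s| ^ p ≤ 4 * 3 ^ p * ((2 : ℝ) ^ n) ^ (-p) := by
  have hM0 : (0 : ℝ) < M := by exact_mod_cast (by omega : 0 < M)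
  have hle : ∀ c : PieceIdx lam M n, |(pieceCell lam M n c).h| * (pieceCell lam M n c).w
      * |(pieceCell lam M n c).s| ^ p
      ≤ layerHeight M c.2.1 / pieces lam M n c.2.1 * stripWidth lam M n c.2.1
        * (3 * ((2 : ℝ) ^ (c.2.1 : ℕ) / 2 ^ n)) ^ p := by
    intro c
    rw [abs_pieceCell_h hM]
    have hW := (stripWidth_pos (n := n) h1 hM c.2.1).le
    have hH := (layerHeight_pos hM c.2.1).le
    have hs := abs_longCell_s_le (n := n) h0 h1 hM c.1 c.2.1 c.2.2.1
    exact mul_le_mul_of_nonneg_left (Real.rpow_le_rpow (abs_nonneg _) hs (by linarith))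
      (mul_nonneg (div_nonneg hH (Nat.cast_nonneg _)) hW)
  refine (Finset.sum_le_sum fun c _ => hle c).trans ?_
  have h := sum_pieceIdx (lam := lam) (M := M) (n := n)
    fun l => layerHeight M l / pieces lam M n l * stripWidth lam M n l
        * (3 * ((2 : ℝ) ^ l / 2 ^ n)) ^ p
  refine h.trans_le ?_
  have hterm : ∀ l ∈ Finset.range n, (stripCount M n l : ℝ) * (pieces lam M n l *
      (layerHeight M l / pieces lam M n l * stripWidth lam M n l * (3 * ((2 : ℝ) ^ l / 2 ^ n)) ^ p))
      ≤ 3 ^ p * ((2 : ℝ) ^ n) ^ (-p) * (1 / 2) ^ l := by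
    intro l hl
    have e1 := pieces_area (n := n) h0 h1 hM (Finset.mem_range.1 hl).le
    have e2 : (3 * ((2 : ℝ) ^ l / 2 ^ n)) ^ p = 3 ^ p * ((2 : ℝ) ^ n) ^ (-p) * ((2 : ℝ) ^ p) ^ l := by
      rw [Real.mul_rpow (by norm_num) (by positivity), Real.div_rpow (by positivity) (by positivity),
        Real.rpow_neg (by positivity), ← Real.rpow_natCast 2 l, ← Real.rpow_mul (by norm_num),
        mul_comm (l : ℝ) p, Real.rpow_mul (by norm_num), Real.rpow_natCast]
      ring
    have e3 : ((2 : ℝ) ^ p) ^ l * layerHeight M l ≤ (1 / 2) ^ l := by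
      calc ((2 : ℝ) ^ p) ^ l * layerHeight M l ≤ (M : ℝ) ^ l * (1 / (2 ^ l * M ^ l)) := by
            gcongr
            · exact (layerHeight_pos hM l).le
            · exact layerHeight_le hM l
        _ = (1 / 2) ^ l := by
            rw [one_div_pow]
            field_simp
    calc _ = ((1 - lam) * layerHeight M l) * (3 * ((2 : ℝ) ^ l / 2 ^ n)) ^ p := by
          rw [← e1]; ring
      _ = (3 ^ p * ((2 : ℝ) ^ n) ^ (-p)) * ((1 - lam) * (((2 : ℝ) ^ p) ^ l * layerHeight M l)) := by
          rw [e2]; ring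
      _ ≤ (3 ^ p * ((2 : ℝ) ^ n) ^ (-p)) * (1 * (1 / 2) ^ l) := by
          have hH := layerHeight_pos hM l
          gcongr
          linarith
      _ = _ := by ring
  have h3 := (Finset.sum_le_sum hterm).trans_eq (Finset.mul_sum _ _ _).symm
  have h4 : 3 ^ p * ((2 : ℝ) ^ n) ^ (-p) * ∑ l ∈ Finset.range n, (1 / 2 : ℝ) ^ l
      ≤ 3 ^ p * ((2 : ℝ) ^ n) ^ (-p) * 2 := by
    gcongr
    exact sum_geometric_two_le n
  linarith

end Pieces

/-- The witness is the sawtooth times the cut-off, with the pieces of the strips as cells. The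
branching ratio `M` depends on `p` alone, hence the constant is uniform in `n`. -/
theorem exists_lamination {lam p : ℝ} (h0 : 0 ≤ lam) (h1 : lam < 1) (hp : 1 ≤ p) {i j : Fin 2}
    (hij : i ≠ j) : ∃ C : ℝ, 0 < C ∧ ∀ n, Nonempty (Lamination lam p C i j n) := by
  obtain ⟨C₀, hC₀, hcut⟩ := exists_isCutoff
  -- `4 ≤ M` serves the geometry of the strips; `2 ^ p ≤ M` makes the elastic energy summable over
  -- the layers and the boundary layer as small as 2⁻ᵖⁿ.
  obtain ⟨M, hM, hpM⟩ : ∃ M : ℕ, 4 ≤ M ∧ (2 : ℝ) ^ p ≤ M := by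
    obtain ⟨M, hM⟩ := exists_nat_ge ((2 : ℝ) ^ p)
    exact ⟨max 4 M, le_max_left _ _, hM.trans (by exact_mod_cast le_max_right _ _)⟩
  have h3p : (0 : ℝ) < 3 ^ p := by positivity
  have hM0 : (0 : ℝ) ≤ M := Nat.cast_nonneg M
  refine ⟨100 * M + 30 * C₀ + 10 + 4 * 3 ^ p, by positivity, fun n => ?_⟩
  obtain ⟨η, hη⟩ := hcut (node M n) (node M (n + 1)) (node_nonneg hM n)
    (node_strictMono hM n.lt_succ_self)
  have h2n : (1 : ℝ) ≤ 2 ^ n := one_le_pow₀ (by norm_num)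
  have h2np : (0 : ℝ) ≤ ((2 : ℝ) ^ n) ^ (-p) := by positivity
  have hmul : ∀ y ≥ (0 : ℝ), y ≤ y * 2 ^ n := fun y hy => le_mul_of_one_le_right hy h2n
  have hlong_unique : ∀ x (c c' : PieceIdx lam M n), x ∈ (pieceCell lam M n c).set i j →
      x ∈ (pieceCell lam M n c').set i j → c' = c := by
    intro x c c' hx hx'
    have a := (mem_slab_of_mem_pieceCell hij h1 hM hx).1
    have a' := (mem_slab_of_mem_pieceCell hij h1 hM hx').1
    obtain ⟨e1, e2, e3⟩ := longCell_unique hij h0 h1 hM a a'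
    obtain ⟨κ, l, σ, q⟩ := c
    obtain ⟨κ', l', σ', q'⟩ := c'
    obtain rfl : κ' = κ := e1
    obtain rfl : l' = l := Fin.ext e2
    obtain rfl : σ' = σ := Fin.ext e3
    have := Cell.sub_index_unique hij (stripWidth_pos h1 hM _) (longCell_h_ne_zero hM _ _ _)
      (pieces_pos h0 h1 hM l'.2.le) hx hx'
    obtain rfl : q' = q := Fin.ext this.symm
    rfl
  have hnear : ∀ x : Plane, |x j - 1 / 2| ≤ node M n →
      η (x j) * sawtoothDi lam M n i j x = sawtoothDi lam M n i j x ∧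
      η (x j) * sawtoothDj lam M n i j x + deriv η (x j) * sawtooth lam M n i j x
        = sawtoothDj lam M n i j x := by
    intro x hx
    rw [hη.eq_one _ hx, hη.deriv_eq_zero (Or.inl hx)]
    constructor <;> ring
  have hoff : ∀ x : Plane, x ∉ unitSquare → deriv η (x j) * sawtooth lam M n i j x = 0 := by
    intro x hx
    rcases le_total |x j - 1 / 2| (node M (n + 1)) with h | h
    · rw [sawtooth_eq_zero hij h0 h1 hM h hx, mul_zero]
    · rw [hη.deriv_eq_zero (Or.inr h), zero_mul]
  have hderiv_mul : ∀ x : Plane, |deriv η (x j) * sawtooth lam M n i j x| ≤ 3 * C₀ := by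
    intro x
    have hh := layerHeight_pos hM n
    by_cases hr : |x j - 1 / 2| ∈ Icc (node M n) (node M (n + 1))
    · rw [abs_mul]
      calc |deriv η (x j)| * |sawtooth lam M n i j x|
          ≤ C₀ / layerHeight M n * (3 * layerHeight M n) := by
            gcongr
            · exact hη.deriv_le _
            · exact abs_sawtooth_le_layerHeight h0 h1 hM hr
        _ = 3 * C₀ := by field_simp
    · have : |x j - 1 / 2| ≤ node M n ∨ node M (n + 1) ≤ |x j - 1 / 2| := by
        rcases not_and_or.1 hr with h | h
        · exact Or.inl (not_le.1 h).le
        · exact Or.inr (not_le.1 h).le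
      rw [hη.deriv_eq_zero this, zero_mul, abs_zero]
      positivity
  have hη_mul : ∀ x : Plane, ∀ y b : ℝ, |y| ≤ b → |η (x j) * y| ≤ b := by
    intro x y b hy
    rw [abs_mul]
    exact (mul_le_of_le_one_left (abs_nonneg _) (hη.abs_le_one _)).trans hy
  refine ⟨{
    f := fun x => η (x j) * sawtooth lam M n i j x
    gi := fun x => η (x j) * sawtoothDi lam M n i j x
    gj := fun x => η (x j) * sawtoothDj lam M n i j x + deriv η (x j) * sawtooth lam M n i j x
    -- The bad set contains the whole last layer `l = n`. Cells come only from layers `l < n`, where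
    -- the cut-off is identically one.
    bad := boundaryLayer M n j
    ι := PieceIdx lam M n
    fintype := inferInstance
    cell := pieceCell lam M n
    lipschitz := ?_
    f_off := fun x hx => ?_
    g_off := fun x hx => ?_
    hasFDerivAt := ae_hasFDerivAt_cut hij h1 hM hη
    var_i := ?_
    var_j := ?_
    g_bound := fun x => ?_
    volume_bad := ?_
    w_pos := fun c => stripWidth_pos h1 hM _
    w_le := fun c => ?_
    h_le := fun c => ?_
    s_le := fun c => abs_longCell_s_le_three h0 h1 hM _ c.2.1.2.le _
    subset := fun c x hx => longCell_subset hij h0 h1 hM c.2.2.1.2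
      (mem_slab_of_mem_pieceCell hij h1 hM hx).1
    unique := hlong_unique
    g_cell := fun c x hx => ?_
    g_rest := ?_
    sum_w := (sum_pieceCell_w_le h1 hM).trans ?_
    sum_area := (sum_pieceCell_area_le h0 h1 hM).trans ?_
    sum_slope := (sum_pieceCell_slope_le hp h0 h1 hM hpM).trans ?_ }⟩
  · obtain ⟨K, hK⟩ := lipschitz_of_deriv_bound (hη.smooth.differentiable (by simp)) hη.deriv_le
    obtain ⟨L, hL⟩ := exists_lipschitz_sawtooth (lam := lam) (M := M) (n := n) (i := i) (j := j)
    exact (hK.comp (lipschitzWith_coord j)).mul_of_bounded hL (fun x => hη.abs_le_one _)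
      (abs_sawtooth_le h0 h1 hM)
  · rcases le_total |x j - 1 / 2| (node M (n + 1)) with h | h
    · simp only [sawtooth_eq_zero hij h0 h1 hM h hx, mul_zero]
    · simp only [hη.eq_zero _ h, zero_mul]
  · obtain ⟨d1, d2⟩ := sawtoothD_off (n := n) hij h0 h1 hM hx
    simp only [d1, d2, hoff x hx, mul_zero, add_zero, and_self]
  · refine (varBound_cutoff_mul hij hM hη hC₀ (varBound_sawtoothDi hij h0 h1 hM)
      (fun x => (abs_sawtoothD_le hij h0 h1 hM x).1.trans (by norm_num))
      fun x hx => (sawtoothD_off hij h0 h1 hM hx).1).mono ?_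
    have := hmul (2 + 9 * C₀) (by positivity)
    have : 0 ≤ (4 * 3 ^ p + 21 * C₀ + 8 + 72 * M) * 2 ^ n := by positivity
    nlinarith
  · refine ((varBound_cutoff_mul hij hM hη hC₀ (varBound_sawtoothDj hij h0 h1 hM)
      (fun x => (abs_sawtoothD_le hij h0 h1 hM x).2)
      fun x hx => (sawtoothD_off hij h0 h1 hM hx).2).add
        (varBound_deriv_cutoff_mul hij h0 h1 hM hη hC₀)).mono ?_
    have := hmul (27 * C₀) (by positivity)
    have : 0 ≤ (4 * 3 ^ p + 3 * C₀ + 10 + 16 * M) * 2 ^ n := by positivity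
    nlinarith
  · obtain ⟨b1, b2⟩ := abs_sawtoothD_le (n := n) hij h0 h1 hM x
    refine ⟨(hη_mul x _ _ b1).trans (by linarith), (abs_add_le _ _).trans ?_⟩
    linarith [hη_mul x _ _ b2, hderiv_mul x]
  · refine (volume_boundaryLayer_le hij hM).trans (ENNReal.ofReal_le_ofReal ?_)
    have e : ((2 : ℝ) ^ n) ^ (-p) = (1 / (2 : ℝ) ^ p) ^ n := by
      rw [Real.rpow_neg (by positivity), ← Real.rpow_natCast, ← Real.rpow_mul (by norm_num),
        mul_comm (n : ℝ) p, Real.rpow_mul (by norm_num), Real.rpow_natCast, one_div, inv_pow]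
    have : (1 / (2 * M) : ℝ) ^ n ≤ ((2 : ℝ) ^ n) ^ (-p) := by
      rw [e]
      have : (0 : ℝ) < M := by exact_mod_cast (by omega : 0 < M)
      gcongr
      linarith
    nlinarith
  · rw [abs_pieceCell_h hM, le_div_iff₀ (by exact_mod_cast pieces_pos h0 h1 hM c.2.1.2.le), mul_comm]
    exact pieces_mul_le h1 hM c.2.1
  · rw [abs_pieceCell_h hM, div_le_iff₀ (by exact_mod_cast pieces_pos h0 h1 hM c.2.1.2.le)]
    exact le_two_mul_pieces h0 h1 hM c.2.1.2.le
  · obtain ⟨a, b⟩ := mem_slab_of_mem_pieceCell hij h1 hM hx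
    obtain ⟨e1, e2⟩ := hnear x b
    simp only [e1, e2]
    exact sawtoothD_of_mem hij h0 h1 hM
      (⟨c.1, ⟨c.2.1, by omega⟩, c.2.2.1⟩ : StripIdx M n) a
  · have hsub : ∀ᵐ x : Plane, ∀ (κ : Bool) (l σ q : ℕ),
        x j ≠ (longCell lam M n κ l σ).b + q * ((longCell lam M n κ l σ).h / pieces lam M n l) := by
      simp only [ae_all_iff]
      exact fun κ l σ q => ae_coord_ne j _
    filter_upwards [hsub] with x hx hQ hcell hbad
    have hlt : |x j - 1 / 2| < node M n := not_le.1 fun h => hbad ⟨hQ, h⟩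
    obtain ⟨e1, e2⟩ := hnear x hlt.le
    simp only [e1, e2]
    -- A point of a strip of a layer `l < n` that avoids the cuts lies in a piece. Thus a point
    -- outside the pieces and the bad set generically lies in no strip at all.
    have hlong : ∀ c : StripIdx M n, x ∉ (longCell lam M n c.1 c.2.1 c.2.2).set i j := by
      intro c hc
      have hs := ((mem_longCell_iff hij h1 hM).1 hc).1
      have hl : (c.2.1 : ℕ) < n := by
        rw [← (node_strictMono hM).lt_iff_lt]
        rw [abs_eq_of_mem_slab hM hs] at hlt
        exact hs.1.trans hlt
      obtain ⟨q, hq, hxq⟩ := Cell.exists_mem_sub hij (stripWidth_pos h1 hM _)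
        (longCell_h_ne_zero hM _ _ _) (pieces_pos h0 h1 hM hl.le) hc (hx _ _ _)
      exact hcell ⟨c.1, ⟨c.2.1, hl⟩, c.2.2, ⟨q, hq⟩⟩ hxq
    obtain ⟨d1, d2⟩ := sawtoothD_of_notMem (lam := lam) hlong
    rw [d1, d2, indicator_of_mem hQ, mul_one]
    exact ⟨rfl, rfl⟩
  · have : 0 ≤ (4 * 3 ^ p + 30 * C₀ + 10 + 96 * M) * 2 ^ n := by positivity
    nlinarith
  · linarith
  · have : 0 ≤ (100 * M + 30 * C₀ + 10) * ((2 : ℝ) ^ n) ^ (-p) := by positivity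
    nlinarith

/-- A microstructure in the unit square with average gradient `F`: the perturbation `φ` of the
linear map `F`, its gradient `G` and the phases `χ`, with elastic energy at most `e` and variation
at most `v`. -/
structure Block (K : Set Mat2) (F : Mat2) (p e v : ℝ) where
  φ : Plane → Plane
  G : Plane → Mat2
  χ : Plane → Mat2
  lipschitz : ∃ L, LipschitzWith L φ
  φ_off : ∀ x, x ∉ unitSquare → φ x = 0
  G_off : ∀ x, x ∉ unitSquare → G x = 0
  hasFDerivAt : ∀ᵐ x, HasFDerivAt φ (Matrix.toEuclideanCLM (𝕜 := ℝ) (G x)) x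
  χ_mem : ∀ x, χ x ∈ K
  energy : ∫⁻ x in unitSquare, ‖F + G x - χ x‖ₑ ^ p ≤ ENNReal.ofReal e
  var_G : ∀ a b, VarBound (fun x => G x a b) v
  var_χ : ∀ M, VarBound ({x | x ∈ unitSquare ∧ χ x = M}.indicator fun _ => (1 : ℝ)) v

/-! ### Matrix norms and gradients transported to a cell -/

section Norm

lemma abs_entry_le_norm (X : Mat2) (k l : Fin 2) : |X k l| ≤ ‖X‖ := by
  rw [Matrix.frobenius_norm_def]
  have h1 : |X k l| = (|X k l| ^ (2 : ℝ)) ^ (1 / 2 : ℝ) := by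
    rw [← Real.rpow_mul (abs_nonneg _)]
    norm_num
  rw [h1]
  refine Real.rpow_le_rpow (by positivity) ?_ (by norm_num)
  refine le_trans ?_ (Finset.single_le_sum (f := fun k => ∑ l, ‖X k l‖ ^ (2 : ℝ))
    (fun _ _ => by positivity) (Finset.mem_univ k))
  exact Finset.single_le_sum (f := fun l => ‖X k l‖ ^ (2 : ℝ))
    (fun _ _ => by positivity) (Finset.mem_univ l)

lemma norm_le_of_abs_entry_le {X : Mat2} {b : ℝ} (h : ∀ k l, |X k l| ≤ b) : ‖X‖ ≤ 2 * b := by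
  have hb : 0 ≤ b := (abs_nonneg _).trans (h 0 0)
  rw [Matrix.frobenius_norm_def]
  have h2 : ∑ k, ∑ l, ‖X k l‖ ^ (2 : ℝ) ≤ (2 * b) ^ (2 : ℝ) := by
    have h3 : ∀ k l, ‖X k l‖ ^ (2 : ℝ) ≤ b ^ 2 := by
      intro k l
      rw [Real.rpow_two]
      exact pow_le_pow_left₀ (norm_nonneg _) (h k l) 2
    simp only [Fin.sum_univ_two]
    simp only [Real.rpow_two] at h3 ⊢
    linarith [h3 0 0, h3 0 1, h3 1 0, h3 1 1]
  calc (∑ k, ∑ l, ‖X k l‖ ^ (2 : ℝ)) ^ (1 / 2 : ℝ) ≤ ((2 * b) ^ (2 : ℝ)) ^ (1 / 2 : ℝ) :=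
        Real.rpow_le_rpow (by positivity) h2 (by norm_num)
    _ = 2 * b := by
        rw [← Real.rpow_mul (by positivity)]
        norm_num

end Norm

namespace Cell

/-- The diagonal scaling of a cell. -/
def scale (i : Fin 2) (c : Cell) : Mat2 := Matrix.diagonal fun k => if k = i then c.w else c.h

variable {i j : Fin 2} {c : Cell}

lemma scale_mul_mul_apply (X : Mat2) (a b : Fin 2) :
    (c.scale i * X * c.mat i j) a b
      = (if a = i then c.w else c.h) * (X a 0 * c.mat i j 0 b + X a 1 * c.mat i j 1 b) := by
  rw [Matrix.mul_apply, Fin.sum_univ_two, scale, Matrix.diagonal_mul, Matrix.diagonal_mul]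
  ring

lemma abs_scale_mul_mat_le (hw : 0 < c.w) (hwh : c.w ≤ |c.h|)
    (hh : |c.h| ≤ 2 * c.w) (hs : |c.s| ≤ 3) (a l b : Fin 2) :
    |(if a = i then c.w else c.h) * c.mat i j l b| ≤ 6 := by
  have h1 : |if a = i then c.w else c.h| ≤ 2 * c.w := by
    split_ifs
    · rw [abs_of_pos hw]; linarith
    · exact hh
  have h2 : |c.mat i j l b| ≤ 3 / c.w := by
    simp only [mat, Matrix.of_apply]
    split_ifs
    · rw [abs_of_pos (by positivity)]
      gcongr
      norm_num
    · rw [abs_div, abs_neg, abs_of_pos hw]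
      gcongr
    · rw [abs_div, abs_one]
      have : 0 < |c.h| := hw.trans_le hwh
      gcongr
      norm_num
    · rw [abs_zero]
      positivity
  rw [abs_mul]
  calc |if a = i then c.w else c.h| * |c.mat i j l b| ≤ 2 * c.w * (3 / c.w) := by gcongr
    _ = 6 := by field_simp; norm_num

/-- The gradient in a cell differs from that of the reference microstructure by the slope. -/
lemma norm_cell_gradient_le (hij : i ≠ j) (hw : 0 < c.w) (hwh : c.w ≤ |c.h|)
    (hh : |c.h| ≤ 2 * c.w) (hs : |c.s| ≤ 3) {J X Y : Mat2} (hJ : J.IsDiag) (hY : Y.IsDiag)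
    {d r : ℝ} (hr : |d| + |J i i| + |Y i i| ≤ r) :
    ‖J + (d * c.s) • Matrix.single i j (1 : ℝ) + c.scale i * X * c.mat i j - Y‖
      ≤ 2 * (8 * ‖J + X - Y‖ + r * |c.s|) := by
  set R := J + X - Y with hR
  have hrs : 0 ≤ r * |c.s| :=
    mul_nonneg (le_trans (by positivity) hr) (abs_nonneg _)
  have hR0 := norm_nonneg R
  have hh0 : c.h ≠ 0 := fun h => by rw [h, abs_zero] at hwh; linarith
  have hhp : 0 < |c.h| := abs_pos.2 hh0
  have b1 : |c.w / c.h| ≤ 1 := by rw [abs_div, abs_of_pos hw, div_le_one hhp]; exact hwh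
  have b2 : |c.h / c.w| ≤ 2 := by rw [abs_div, abs_of_pos hw, div_le_iff₀ hw]; exact hh
  have hRe := abs_entry_le_norm R
  have hXe : ∀ k l, X k l = R k l - J k l + Y k l := by
    intro k l
    simp only [hR, Matrix.sub_apply, Matrix.add_apply]
    ring
  have cover : ∀ k : Fin 2, k = i ∨ k = j := by
    intro k
    fin_cases i <;> fin_cases j <;> fin_cases k <;> simp at hij ⊢
  have hsum : ∀ (a b : Fin 2), X a 0 * c.mat i j 0 b + X a 1 * c.mat i j 1 b
      = X a i * c.mat i j i b + X a j * c.mat i j j b := by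
    intro a b
    fin_cases i <;> fin_cases j <;> simp [add_comm] at hij ⊢
  have hm : c.mat i j i i = 1 / c.w ∧ c.mat i j i j = -c.s / c.w ∧ c.mat i j j i = 0
      ∧ c.mat i j j j = 1 / c.h := by
    simp [mat, hij, hij.symm]
  refine norm_le_of_abs_entry_le fun k l => ?_
  rw [Matrix.sub_apply, Matrix.add_apply, Matrix.add_apply, scale_mul_mul_apply, hsum,
    Matrix.smul_apply, smul_eq_mul]
  -- The entries come in the order ii, ij, ji, jj. Off the diagonal `X` agrees with `R` because `J`
  -- and `Y` are diagonal, and the shear adds `-s` times column `i`, suitably scaled, to column `j`.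
  -- Only in entry ij does the slope meet a quantity not small with `R`, namely `d + J i i - Y i i`;
  -- this is the term with `r`. The coefficients of ‖R‖ are 1, 1 + 3, 2 and 1 + 6, all below 8.
  rcases cover k with rfl | rfl <;> rcases cover l with rfl | rfl
  · have e : J l l + d * c.s * Matrix.single l j (1 : ℝ) l l + (if l = l then c.w else c.h) *
        (X l l * c.mat l j l l + X l j * c.mat l j j l) - Y l l = R l l := by
      rw [hm.1, hm.2.2.1, hXe l l]
      simp [hij.symm]
      field_simp
      ring
    rw [e]
    linarith [hRe l l]
  · have e : J k l + d * c.s * Matrix.single k l (1 : ℝ) k l + (if k = k then c.w else c.h) *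
        (X k k * c.mat k l k l + X k l * c.mat k l l l) - Y k l
        = c.w / c.h * R k l + (-c.s) * R k k + c.s * (d + J k k - Y k k) := by
      rw [hm.2.1, hm.2.2.2, hXe k k, hXe k l, hJ hij, hY hij]
      simp
      field_simp
      ring
    rw [e]
    have t1 : |c.w / c.h * R k l| ≤ 1 * ‖R‖ := by
      rw [abs_mul]; exact mul_le_mul b1 (hRe k l) (abs_nonneg _) zero_le_one
    have t2 : |(-c.s) * R k k| ≤ 3 * ‖R‖ := by
      rw [abs_mul, abs_neg]; exact mul_le_mul hs (hRe k k) (abs_nonneg _) (by norm_num)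
    have t3 : |c.s * (d + J k k - Y k k)| ≤ r * |c.s| := by
      rw [abs_mul, mul_comm]
      refine mul_le_mul_of_nonneg_right ?_ (abs_nonneg _)
      exact ((abs_sub _ _).trans (add_le_add_left (abs_add_le _ _) _)).trans hr
    have := abs_add_le (c.w / c.h * R k l + (-c.s) * R k k) (c.s * (d + J k k - Y k k))
    have := abs_add_le (c.w / c.h * R k l) ((-c.s) * R k k)
    linarith
  · have e : J k l + d * c.s * Matrix.single l k (1 : ℝ) k l + (if k = l then c.w else c.h) *
        (X k l * c.mat l k l l + X k k * c.mat l k k l) - Y k l = c.h / c.w * R k l := by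
      rw [hm.1, hm.2.2.1, hXe k l, hJ hij.symm, hY hij.symm]
      simp [hij, hij.symm]
      field_simp
    rw [e, abs_mul]
    have := mul_le_mul b2 (hRe k l) (abs_nonneg _) (by norm_num)
    linarith
  · have e : J l l + d * c.s * Matrix.single i l (1 : ℝ) l l + (if l = i then c.w else c.h) *
        (X l i * c.mat i l i l + X l l * c.mat i l l l) - Y l l
        = R l l + (-c.s) * (c.h / c.w * R l i) := by
      rw [hm.2.1, hm.2.2.2, hXe l l, hXe l i, hJ hij.symm, hY hij.symm]
      simp [hij, hij.symm]
      field_simp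
      ring
    rw [e]
    have t1 : |c.h / c.w * R l i| ≤ 2 * ‖R‖ := by
      rw [abs_mul]; exact mul_le_mul b2 (hRe l i) (abs_nonneg _) (by norm_num)
    have t2 : |(-c.s) * (c.h / c.w * R l i)| ≤ 3 * (2 * ‖R‖) := by
      rw [abs_mul, abs_neg]; exact mul_le_mul hs t1 (abs_nonneg _) (by norm_num)
    have := abs_add_le (R l l) ((-c.s) * (c.h / c.w * R l i))
    linarith [hRe l l]

/-- 84 = 12 · 7: two entries of `G` enter with coefficients at most 6, and `3 * |h| + w ≤ 7 * w`. -/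
lemma varBound_scaled_gradient (hij : i ≠ j) (hw : 0 < c.w) (hwh : c.w ≤ |c.h|)
    (hh : |c.h| ≤ 2 * c.w) (hs : |c.s| ≤ 3) {G : Plane → Mat2} {v : ℝ}
    (hG : ∀ a b, VarBound (fun x => G x a b) v) (a b : Fin 2) :
    VarBound (fun x => (c.scale i * G (c.map i j x) * c.mat i j) a b) (84 * v * c.w) := by
  have hv := (hG 0 0).nonneg
  have hh0 : c.h ≠ 0 := fun h => by rw [h, abs_zero] at hwh; linarith
  have hb := abs_scale_mul_mat_le (i := i) (j := j) hw hwh hh hs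
  have h1 := ((hG a 0).const_mul ((if a = i then c.w else c.h) * c.mat i j 0 b)).add
    ((hG a 1).const_mul ((if a = i then c.w else c.h) * c.mat i j 1 b))
  have h2 := varBound_comp hij hw hh0 hs (h1.mono (B' := 12 * v) (by nlinarith [hb a 0 b, hb a 1 b]))
  refine (h2.mono (B' := 84 * v * c.w) (by nlinarith)).congr_ae (.of_forall fun x => ?_)
  simp only [scale_mul_mul_apply]
  ring

end Cell

lemma toEuclideanCLM_single (i j : Fin 2) :
    Matrix.toEuclideanCLM (𝕜 := ℝ) (Matrix.single i j (1 : ℝ))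
      = (EuclideanSpace.proj (𝕜 := ℝ) j).smulRight (EuclideanSpace.single i (1 : ℝ)) := by
  ext v a
  simp [Matrix.ofLp_toEuclideanCLM, Matrix.single_mulVec, Function.update_apply]

lemma exists_lipschitz_affMap (T : Mat2) (o : Plane) : ∃ L, LipschitzWith L (affMap T o) :=
  ⟨_, (Matrix.toEuclideanCLM (𝕜 := ℝ) T).lipschitz.comp
    (LipschitzWith.id.sub (LipschitzWith.const o))⟩

/-! ### Filling the cells of a lamination with a microstructure -/

namespace Lamination

variable {lam p C : ℝ} {i j : Fin 2} {n : ℕ} (S : Lamination lam p C i j n)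
variable {K : Set Mat2} {J A : Mat2} {d e v : ℝ} (B : Block K J p e v)

/-- The displacement obtained by copying a microstructure into the cells of a lamination. -/
noncomputable def fillφ (d : ℝ) (x : Plane) : Plane :=
  (d * S.f x) • EuclideanSpace.single i (1 : ℝ)
    + ∑ c, Matrix.toEuclideanCLM (𝕜 := ℝ) ((S.cell c).scale i) (B.φ ((S.cell c).map i j x))

/-- The gradient obtained by copying a microstructure into the cells of a lamination. -/
noncomputable def fillG (d : ℝ) (x : Plane) : Mat2 :=
  (d * S.gi x) • Matrix.single i i (1 : ℝ) + (d * S.gj x) • Matrix.single i j (1 : ℝ)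
    + ∑ c, (S.cell c).scale i * B.G ((S.cell c).map i j x) * (S.cell c).mat i j

open Classical in
/-- The phases obtained by copying a microstructure into the cells of a lamination. -/
noncomputable def fillχ (A : Mat2) (x : Plane) : Mat2 :=
  if h : ∃ c, x ∈ (S.cell c).set i j then B.χ ((S.cell h.choose).map i j x) else A

variable {S B}

lemma fillχ_of_mem {x : Plane} {c : S.ι} (hx : x ∈ (S.cell c).set i j) :
    S.fillχ B A x = B.χ ((S.cell c).map i j x) := by
  have h : ∃ c, x ∈ (S.cell c).set i j := ⟨c, hx⟩
  rw [fillχ, dif_pos h, S.unique x c h.choose hx h.choose_spec]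

lemma fillχ_of_notMem {x : Plane} (hx : ∀ c, x ∉ (S.cell c).set i j) : S.fillχ B A x = A := by
  rw [fillχ, dif_neg (by simpa using hx)]

lemma fillG_of_mem {x : Plane} {c : S.ι} (hx : x ∈ (S.cell c).set i j) :
    S.fillG B d x = (d * -lam) • Matrix.single i i (1 : ℝ)
      + (d * (S.cell c).s) • Matrix.single i j (1 : ℝ)
      + (S.cell c).scale i * B.G ((S.cell c).map i j x) * (S.cell c).mat i j := by
  rw [fillG, (S.g_cell c x hx).1, (S.g_cell c x hx).2, Finset.sum_eq_single c]
  · intro c' _ hc'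
    rw [B.G_off _ fun h => hc' (S.unique x c c' hx h)]
    simp
  · simp

lemma fillG_of_notMem {x : Plane} (hx : ∀ c, x ∉ (S.cell c).set i j) :
    S.fillG B d x = (d * S.gi x) • Matrix.single i i (1 : ℝ)
      + (d * S.gj x) • Matrix.single i j (1 : ℝ) := by
  rw [fillG, Finset.sum_eq_zero, add_zero]
  intro c _
  rw [B.G_off _ (hx c)]
  simp

lemma notMem_cell {x : Plane} (hx : x ∉ unitSquare) (c : S.ι) : x ∉ (S.cell c).set i j :=
  fun h => hx (S.subset c h)

lemma h_ne_zero (c : S.ι) : (S.cell c).h ≠ 0 := fun h => by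
  have := S.w_le c
  rw [h, abs_zero] at this
  linarith [S.w_pos c]

lemma exists_lipschitz_fillφ : ∃ L, LipschitzWith L (S.fillφ B d) := by
  obtain ⟨L, hL⟩ := S.lipschitz
  obtain ⟨L', hL'⟩ := B.lipschitz
  have h1 := (ContinuousLinearMap.toSpanSingleton ℝ
    (d • EuclideanSpace.single i (1 : ℝ) : Plane)).lipschitz.comp hL
  obtain ⟨L₂, h2⟩ := exists_lipschitz_sum Finset.univ (F := fun c x =>
    Matrix.toEuclideanCLM (𝕜 := ℝ) ((S.cell c).scale i) (B.φ ((S.cell c).map i j x))) fun c _ => by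
      obtain ⟨M, hM⟩ := exists_lipschitz_affMap ((S.cell c).mat i j) ((S.cell c).origin i)
      exact ⟨_, (Matrix.toEuclideanCLM (𝕜 := ℝ) ((S.cell c).scale i)).lipschitz.comp (hL'.comp hM)⟩
  refine ⟨_, (funext fun x => ?_ : (fun x => _ + _) = S.fillφ B d) ▸ h1.add h2⟩
  simp [fillφ, smul_smul, mul_comm]

/-- Preimages of null sets under the finitely many invertible affine maps are null, so the chain
rule applies in all cells at once, almost everywhere. -/
lemma hasFDerivAt_fillφ (hij : i ≠ j) : ∀ᵐ x, HasFDerivAt (S.fillφ B d)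
    (Matrix.toEuclideanCLM (𝕜 := ℝ) (S.fillG B d x)) x := by
  have h : ∀ᵐ x, ∀ c, HasFDerivAt B.φ
      (Matrix.toEuclideanCLM (𝕜 := ℝ) (B.G ((S.cell c).map i j x))) ((S.cell c).map i j x) :=
    ae_all_iff.2 fun c =>
      ae_comp_affMap (Cell.det_mat_ne_zero hij (S.w_pos c) (h_ne_zero c)) B.hasFDerivAt
  filter_upwards [S.hasFDerivAt, h] with x h1 h2
  have h3 : ∀ c ∈ Finset.univ, HasFDerivAt (fun x =>
      Matrix.toEuclideanCLM (𝕜 := ℝ) ((S.cell c).scale i) (B.φ ((S.cell c).map i j x)))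
      ((Matrix.toEuclideanCLM (𝕜 := ℝ) ((S.cell c).scale i)).comp
        ((Matrix.toEuclideanCLM (𝕜 := ℝ) (B.G ((S.cell c).map i j x))).comp
          (Matrix.toEuclideanCLM (𝕜 := ℝ) ((S.cell c).mat i j)))) x := fun c _ =>
    (ContinuousLinearMap.hasFDerivAt _).comp x ((h2 c).comp x (hasFDerivAt_affMap x))
  have h4 := (((h1.const_mul d).smul_const (EuclideanSpace.single i (1 : ℝ))).add
    (HasFDerivAt.fun_sum h3))
  refine h4.congr_fderiv ?_
  rw [fillG, map_add, map_add, map_sum, map_smul, map_smul, toEuclideanCLM_single,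
    toEuclideanCLM_single]
  congr 1
  · ext v a
    simp [mul_assoc]
    split_ifs <;> simp
  · refine Finset.sum_congr rfl fun c _ => ?_
    rw [map_mul, map_mul, mul_assoc]
    rfl

lemma varBound_fillG (hij : i ≠ j) (a b : Fin 2) : VarBound (fun x => S.fillG B d x a b)
    (|d| * (C * 2 ^ n) + |d| * (C * 2 ^ n) + 84 * v * (C * 2 ^ n)) := by
  have hC := S.var_i.nonneg
  have hv := (B.var_G 0 0).nonneg
  have hE : ∀ k l a b : Fin 2, |Matrix.single k l (1 : ℝ) a b| ≤ 1 := by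
    intro k l a b
    rw [Matrix.single_apply]
    split_ifs <;> simp
  have h1 := S.var_i.const_mul (d * Matrix.single i i (1 : ℝ) a b)
  have h2 := S.var_j.const_mul (d * Matrix.single i j (1 : ℝ) a b)
  have h3 := VarBound.sum Finset.univ fun c _ => Cell.varBound_scaled_gradient hij (S.w_pos c)
    (S.w_le c) (S.h_le c) (S.s_le c) B.var_G a b
  have b1 : ∀ k l, |d * Matrix.single k l (1 : ℝ) a b| * (C * 2 ^ n) ≤ |d| * (C * 2 ^ n) := by
    intro k l
    rw [abs_mul]
    exact mul_le_mul_of_nonneg_right (mul_le_of_le_one_right (abs_nonneg _) (hE _ _ _ _)) hC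
  have b3 : ∑ c, 84 * v * (S.cell c).w ≤ 84 * v * (C * 2 ^ n) := by
    rw [← Finset.mul_sum]
    exact mul_le_mul_of_nonneg_left S.sum_w (by positivity)
  refine (((h1.mono (b1 _ _)).add (h2.mono (b1 _ _))).add (h3.mono b3)).congr_ae
    (.of_forall fun x => ?_)
  simp only [fillG, Matrix.add_apply, Matrix.smul_apply, smul_eq_mul, Matrix.sum_apply]
  ring

/-- The phase indicator is that of the square minus all cells, present only if `A = M`, plus the
block's own indicators pulled back to the cells. Cutting out the cells costs their perimeters. -/
lemma varBound_fillχ (hij : i ≠ j) (M : Mat2) :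
    VarBound ({x | x ∈ unitSquare ∧ S.fillχ B A x = M}.indicator fun _ => (1 : ℝ))
      (2 + 14 * (C * 2 ^ n) + 7 * v * (C * 2 ^ n)) := by
  classical
  have hv := (B.var_G 0 0).nonneg
  have hb : ∀ c, 3 * |(S.cell c).h| + (S.cell c).w ≤ 7 * (S.cell c).w := fun c => by
    linarith [S.h_le c]
  have h1 := VarBound.sum Finset.univ fun c _ =>
    ((S.cell c).varBound_indicator hij (S.w_pos c) (h_ne_zero c) (S.s_le c)).mono
      (mul_le_mul_of_nonneg_right (hb c) zero_le_two)
  have h2 := VarBound.sum Finset.univ fun c _ =>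
    ((S.cell c).varBound_comp hij (S.w_pos c) (h_ne_zero c) (S.s_le c) (B.var_χ M)).mono
      (mul_le_mul_of_nonneg_right (hb c) hv)
  rw [← Finset.sum_mul, ← Finset.mul_sum] at h1 h2
  have h3 := ((VarBound.indicator_unitSquare.sub h1).const_mul (if A = M then 1 else 0)).add h2
  have hw : 0 ≤ ∑ c, (S.cell c).w := Finset.sum_nonneg fun c _ => (S.w_pos c).le
  refine (h3.mono ?_).congr_ae (.of_forall fun x => ?_)
  · have h4 : |if A = M then (1 : ℝ) else 0| ≤ 1 := by split_ifs <;> simp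
    have h5 := mul_le_mul h4 (le_refl (2 + 7 * (∑ c, (S.cell c).w) * 2)) (by positivity) zero_le_one
    have h6 := mul_le_mul_of_nonneg_right S.sum_w hv
    linarith [S.sum_w]
  · by_cases hx : ∃ c, x ∈ (S.cell c).set i j
    · obtain ⟨c, hc⟩ := hx
      have hz : ∀ c' ≠ c, x ∉ (S.cell c').set i j := fun c' h h' => h (S.unique x c c' hc h')
      have hQ := S.subset c hc
      have hQ' : (S.cell c).map i j x ∈ unitSquare := hc
      simp only
      rw [Finset.sum_eq_single c (fun c' _ h => indicator_of_notMem (hz c' h) _) (by simp),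
        Finset.sum_eq_single c (fun c' _ h => indicator_of_notMem (fun h' => hz c' h h'.1) _)
          (by simp), indicator_of_mem hc, indicator_of_mem hQ]
      simp [indicator, hQ, hQ', fillχ_of_mem hc]
    · push Not at hx
      simp only
      rw [Finset.sum_eq_zero fun c _ => indicator_of_notMem (hx c) _,
        Finset.sum_eq_zero fun c _ => indicator_of_notMem (fun h' => hx c h'.1) _]
      by_cases hQ : x ∈ unitSquare <;> simp [indicator, hQ, fillχ_of_notMem hx]

/-- Change of variables turns the integral into the cell area times the block's energy, plus a slope
term; the factor `2 ^ (p - 1)` comes from convexity, which separates the two. -/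
lemma lintegral_cell_le (hij : i ≠ j) (hp : 1 ≤ p) (hJ : J.IsDiag) (hK : ∀ M ∈ K, M.IsDiag) {r : ℝ}
    (hr : ∀ M ∈ K, |d| + |J i i| + |M i i| ≤ r) (he : 0 ≤ e) (c : S.ι) :
    ∫⁻ x in (S.cell c).set i j,
      ‖J + (lam * d) • Matrix.single i i (1 : ℝ) + S.fillG B d x - S.fillχ B A x‖ₑ ^ p
      ≤ ENNReal.ofReal ((16 + 2 * r) ^ p * 2 ^ (p - 1) * (|(S.cell c).h| * (S.cell c).w * e
        + |(S.cell c).h| * (S.cell c).w * |(S.cell c).s| ^ p)) := by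
  have hr0 : 0 ≤ r := le_trans (by positivity) (hr _ (B.χ_mem 0))
  have hp0 : 0 ≤ p := zero_le_one.trans hp
  have hw := (S.w_pos c).le
  set R : Plane → Mat2 := fun y => J + B.G y - B.χ y with hR
  have hpt : ∀ x ∈ (S.cell c).set i j,
      ‖J + (lam * d) • Matrix.single i i (1 : ℝ) + S.fillG B d x - S.fillχ B A x‖ₑ ^ p
      ≤ ENNReal.ofReal ((16 + 2 * r) ^ p * 2 ^ (p - 1)) * (‖R ((S.cell c).map i j x)‖ₑ ^ p
        + ENNReal.ofReal (|(S.cell c).s| ^ p)) := by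
    intro x hx
    set y := (S.cell c).map i j x
    have h1 := Cell.norm_cell_gradient_le hij (S.w_pos c) (S.w_le c) (S.h_le c) (S.s_le c) hJ
      (hK _ (B.χ_mem y)) (X := B.G y) (hr _ (B.χ_mem y))
    -- In a cell `gi = -lam` cancels the shift `lam * d` of the average, so the block's own mean `J`
    -- reappears.
    have h2 : J + (lam * d) • Matrix.single i i (1 : ℝ) + S.fillG B d x - S.fillχ B A x
        = J + (d * (S.cell c).s) • Matrix.single i j (1 : ℝ)
          + (S.cell c).scale i * B.G y * (S.cell c).mat i j - B.χ y := by
      rw [fillG_of_mem hx, fillχ_of_mem hx]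
      module
    rw [h2]
    have h3 := norm_nonneg (R y)
    have h4 : ‖J + (d * (S.cell c).s) • Matrix.single i j (1 : ℝ)
          + (S.cell c).scale i * B.G y * (S.cell c).mat i j - B.χ y‖ₑ
        ≤ ENNReal.ofReal (16 + 2 * r) * (‖R y‖ₑ + ENNReal.ofReal |(S.cell c).s|) := by
      rw [← ofReal_norm, ← ofReal_norm,
        ← ENNReal.ofReal_add h3 (abs_nonneg _), ← ENNReal.ofReal_mul (by positivity)]
      refine ENNReal.ofReal_le_ofReal (h1.trans ?_)
      have := mul_nonneg hr0 h3
      have := abs_nonneg (S.cell c).s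
      simp only [hR] at *
      nlinarith
    refine (ENNReal.rpow_le_rpow h4 hp0).trans ?_
    rw [ENNReal.mul_rpow_of_nonneg _ _ hp0, ENNReal.ofReal_rpow_of_nonneg (by positivity) hp0,
      ENNReal.ofReal_mul (by positivity), mul_assoc]
    gcongr
    refine (ENNReal.rpow_add_le_mul_rpow_add_rpow _ _ hp).trans (le_of_eq ?_)
    rw [ENNReal.ofReal_rpow_of_nonneg (abs_nonneg _) hp0,
      ← ENNReal.ofReal_rpow_of_nonneg zero_le_two (by linarith), ENNReal.ofReal_ofNat]
  refine (setLIntegral_mono' Cell.isOpen_set.measurableSet hpt).trans ?_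
  have hdet := Cell.det_mat_ne_zero hij (S.w_pos c) (h_ne_zero c)
  have hvol : volume ((S.cell c).set i j) = ENNReal.ofReal (|(S.cell c).h| * (S.cell c).w) := by
    rw [Cell.set, Cell.map, volume_preimage_affMap hdet, volume_unitSquare, mul_one,
      Cell.abs_det_inv hij (S.w_pos c)]
  have hint : ∫⁻ x in (S.cell c).set i j, ‖R ((S.cell c).map i j x)‖ₑ ^ p
      ≤ ENNReal.ofReal (|(S.cell c).h| * (S.cell c).w * e) := by
    rw [ENNReal.ofReal_mul (by positivity), ← Cell.abs_det_inv hij (S.w_pos c)]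
    refine (setLIntegral_comp_affMap hdet unitSquare fun y => ‖R y‖ₑ ^ p).le.trans ?_
    gcongr
    exact B.energy
  rw [lintegral_const_mul' _ _ ENNReal.ofReal_ne_top, lintegral_add_right _ measurable_const,
    setLIntegral_const, hvol, ENNReal.ofReal_mul (p := (16 + 2 * r) ^ p * 2 ^ (p - 1))
    (by positivity), ENNReal.ofReal_add (by positivity) (by positivity), mul_comm
    (ENNReal.ofReal (|(S.cell c).s| ^ p)), ← ENNReal.ofReal_mul (by positivity)]
  gcongr

/-- Off the cells the phase is `A`, and the good values `gi = 1 - lam`, `gj = 0` give the gradient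
`A` exactly. Only the bad set contributes, with a bounded integrand. -/
lemma lintegral_rest_le (h0 : 0 ≤ lam) (h1 : lam ≤ 1) (hp : 1 ≤ p)
    (hA : A = J + d • Matrix.single i i (1 : ℝ)) :
    ∫⁻ x in unitSquare \ ⋃ c, (S.cell c).set i j,
      ‖J + (lam * d) • Matrix.single i i (1 : ℝ) + S.fillG B d x - S.fillχ B A x‖ₑ ^ p
      ≤ ENNReal.ofReal ((4 * |d| * (1 + C)) ^ p * (C * ((2 : ℝ) ^ n) ^ (-p))) := by
  have hC : 0 ≤ C := (abs_nonneg _).trans (S.g_bound 0).1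
  have hp0 : 0 ≤ p := zero_le_one.trans hp
  have heq : ∀ x, (∀ c, x ∉ (S.cell c).set i j) →
      J + (lam * d) • Matrix.single i i (1 : ℝ) + S.fillG B d x - S.fillχ B A x
        = (d * (S.gi x - (1 - lam))) • Matrix.single i i (1 : ℝ)
          + (d * S.gj x) • Matrix.single i j (1 : ℝ) := by
    intro x hx
    rw [fillG_of_notMem hx, fillχ_of_notMem hx, hA]
    module
  have hpt : ∀ᵐ x, x ∈ unitSquare \ ⋃ c, (S.cell c).set i j →
      ‖J + (lam * d) • Matrix.single i i (1 : ℝ) + S.fillG B d x - S.fillχ B A x‖ₑ ^ p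
      ≤ S.bad.indicator (fun _ => ENNReal.ofReal ((4 * |d| * (1 + C)) ^ p)) x := by
    filter_upwards [S.g_rest] with x hx hxQ
    have hxc : ∀ c, x ∉ (S.cell c).set i j := by simpa using hxQ.2
    rw [heq x hxc]
    by_cases hb : x ∈ S.bad
    · rw [indicator_of_mem hb, ← ENNReal.ofReal_rpow_of_nonneg (by positivity) hp0,
        ← ofReal_norm]
      gcongr
      have hE : ∀ k l a b : Fin 2, |Matrix.single k l (1 : ℝ) a b| ≤ 1 := by
        intro k l a b
        rw [Matrix.single_apply]
        split_ifs <;> simp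
      have hgi : |S.gi x - (1 - lam)| ≤ C + 1 := by
        refine (abs_sub _ _).trans (add_le_add (S.g_bound x).1 ?_)
        rw [abs_of_nonneg (by linarith)]
        linarith
      refine (norm_le_of_abs_entry_le (b := |d| * (C + 1) + |d| * (C + 1)) fun k l => ?_).trans
        (le_of_eq (by ring))
      rw [Matrix.add_apply, Matrix.smul_apply, Matrix.smul_apply, smul_eq_mul, smul_eq_mul]
      refine (abs_add_le _ _).trans (add_le_add ?_ ?_)
      · rw [abs_mul, abs_mul]
        refine (mul_le_of_le_one_right (by positivity) (hE _ _ _ _)).trans ?_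
        gcongr
      · rw [abs_mul, abs_mul]
        refine (mul_le_of_le_one_right (by positivity) (hE _ _ _ _)).trans ?_
        gcongr
        linarith [(S.g_bound x).2]
    · obtain ⟨g1, g2⟩ := hx hxQ.1 hxc hb
      rw [g1, g2, indicator_of_notMem hb]
      simp [zero_lt_one.trans_le hp]
  have hmeas : MeasurableSet (unitSquare \ ⋃ c, (S.cell c).set i j) :=
    measurableSet_unitSquare.diff (MeasurableSet.iUnion fun c => Cell.isOpen_set.measurableSet)
  refine (setLIntegral_mono_ae' hmeas hpt).trans ((setLIntegral_le_lintegral _ _).trans ?_)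
  refine (lintegral_indicator_const_le _ _).trans ?_
  rw [ENNReal.ofReal_mul (by positivity)]
  gcongr
  exact S.volume_bad

lemma lintegral_fill_le (hij : i ≠ j) (h0 : 0 ≤ lam) (h1 : lam ≤ 1) (hp : 1 ≤ p) (hJ : J.IsDiag)
    (hK : ∀ M ∈ K, M.IsDiag) {r : ℝ} (hr : ∀ M ∈ K, |d| + |J i i| + |M i i| ≤ r) (he : 0 ≤ e)
    (hA : A = J + d • Matrix.single i i (1 : ℝ)) :
    ∫⁻ x in unitSquare,
      ‖J + (lam * d) • Matrix.single i i (1 : ℝ) + S.fillG B d x - S.fillχ B A x‖ₑ ^ p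
      ≤ ENNReal.ofReal ((16 + 2 * r) ^ p * 2 ^ (p - 1) * (C * e + C * ((2 : ℝ) ^ n) ^ (-p))
        + (4 * |d| * (1 + C)) ^ p * (C * ((2 : ℝ) ^ n) ^ (-p))) := by
  have hr0 : 0 ≤ r := le_trans (by positivity) (hr _ (B.χ_mem 0))
  have hC : 0 ≤ C := (abs_nonneg _).trans (S.g_bound 0).1
  have hsub : unitSquare ⊆ (⋃ c, (S.cell c).set i j) ∪ (unitSquare \ ⋃ c, (S.cell c).set i j) := by
    rw [union_sdiff_self]
    exact subset_union_right
  refine (lintegral_mono_set hsub).trans ((lintegral_union_le _ _ _).trans ?_)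
  rw [ENNReal.ofReal_add (by positivity) (by positivity)]
  refine add_le_add ((lintegral_iUnion_le _ _).trans ?_) (lintegral_rest_le h0 h1 hp hA)
  rw [tsum_fintype]
  refine (Finset.sum_le_sum fun c _ => lintegral_cell_le hij hp hJ hK hr he c).trans ?_
  have hnn : ∀ c, 0 ≤ |(S.cell c).h| * (S.cell c).w := fun c =>
    mul_nonneg (abs_nonneg _) (S.w_pos c).le
  rw [← ENNReal.ofReal_sum_of_nonneg fun c _ => mul_nonneg (by positivity)
    (add_nonneg (mul_nonneg (hnn c) he) (mul_nonneg (hnn c) (by positivity)))]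
  refine ENNReal.ofReal_le_ofReal ?_
  rw [← Finset.mul_sum, Finset.sum_add_distrib, ← Finset.sum_mul]
  gcongr
  · exact S.sum_area
  · exact S.sum_slope

/-- The microstructure obtained by copying `B` into the cells of a lamination. -/
noncomputable def fill (S : Lamination lam p C i j n) (B : Block K J p e v)
    (hij : i ≠ j) (h0 : 0 ≤ lam) (h1 : lam ≤ 1) (hp : 1 ≤ p) (hJ : J.IsDiag)
    (hK : ∀ M ∈ K, M.IsDiag) {r : ℝ} (hr : ∀ M ∈ K, |d| + |J i i| + |M i i| ≤ r) (he : 0 ≤ e)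
    (hAK : A ∈ K) (hA : A = J + d • Matrix.single i i (1 : ℝ)) {e' v' : ℝ}
    (he' : (16 + 2 * r) ^ p * 2 ^ (p - 1) * (C * e + C * ((2 : ℝ) ^ n) ^ (-p))
        + (4 * |d| * (1 + C)) ^ p * (C * ((2 : ℝ) ^ n) ^ (-p)) ≤ e')
    (hv₁ : |d| * (C * 2 ^ n) + |d| * (C * 2 ^ n) + 84 * v * (C * 2 ^ n) ≤ v')
    (hv₂ : 2 + 14 * (C * 2 ^ n) + 7 * v * (C * 2 ^ n) ≤ v') :
    Block K (J + (lam * d) • Matrix.single i i (1 : ℝ)) p e' v' where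
  φ := S.fillφ B d
  G := S.fillG B d
  χ := S.fillχ B A
  lipschitz := exists_lipschitz_fillφ
  φ_off x hx := by
    rw [fillφ, S.f_off x hx, Finset.sum_eq_zero fun c _ => by rw [B.φ_off _ (notMem_cell hx c), map_zero]]
    simp
  G_off x hx := by
    rw [fillG_of_notMem (notMem_cell hx), (S.g_off x hx).1, (S.g_off x hx).2]
    simp
  hasFDerivAt := hasFDerivAt_fillφ hij
  χ_mem x := by
    by_cases hx : ∃ c, x ∈ (S.cell c).set i j
    · obtain ⟨c, hc⟩ := hx
      rw [fillχ_of_mem hc]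
      exact B.χ_mem _
    · push Not at hx
      rwa [fillχ_of_notMem hx]
  energy := (lintegral_fill_le hij h0 h1 hp hJ hK hr he hA).trans (ENNReal.ofReal_le_ofReal he')
  var_G a b := (varBound_fillG hij a b).mono hv₁
  var_χ M := (varBound_fillχ hij M).mono hv₂

end Lamination

/-- There are microstructures with average gradient `F` at every scale `2⁻ⁿ`, with elastic energy of
order `2⁻ᵖⁿ` and variation of order `2ᵏⁿ`. -/
def HasScaling (K : Set Mat2) (F : Mat2) (p : ℝ) (k : ℕ) : Prop :=
  ∃ C : ℝ, 0 < C ∧ ∀ n : ℕ, Nonempty (Block K F p (C * ((2 : ℝ) ^ n) ^ (-p)) (C * ((2 : ℝ) ^ n) ^ k))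

/-! ### Induction on the order of lamination -/

lemma hasScaling_of_mem {K : Set Mat2} {A : Mat2} (hA : A ∈ K) {p : ℝ} (hp : 1 ≤ p) :
    HasScaling K A p 0 := by
  refine ⟨2, two_pos, fun n => ⟨{
    φ := fun _ => 0
    G := fun _ => 0
    χ := fun _ => A
    lipschitz := ⟨0, LipschitzWith.const 0⟩
    φ_off := fun _ _ => rfl
    G_off := fun _ _ => rfl
    hasFDerivAt := .of_forall fun x => by simpa using hasFDerivAt_const (0 : Plane) x
    χ_mem := fun _ => hA
    energy := by
      have h : ‖A + 0 - A‖ₑ = 0 := by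
        rw [← ofReal_norm, add_zero, sub_self, norm_zero, ENNReal.ofReal_zero]
      simp only [h, ENNReal.zero_rpow_of_pos (zero_lt_one.trans_le hp), lintegral_zero, zero_le]
    var_G := fun a b => VarBound.zero.mono (by positivity)
    var_χ := fun M => ?_ }⟩⟩
  by_cases h : A = M
  · simpa [h] using VarBound.indicator_unitSquare
  · simpa [h] using VarBound.zero.mono zero_le_two

/-- The determinant of the diagonal difference vanishes, so one of its diagonal entries is zero and
the other carries the whole difference. -/
lemma exists_eq_add_single {A J : Mat2} (hA : A.IsDiag) (hJ : J.IsDiag) (h : (A - J).rank = 1) :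
    ∃ i, A = J + (A i i - J i i) • Matrix.single i i (1 : ℝ) := by
  have hdet : (A - J).det = 0 := by
    by_contra hne
    rw [Matrix.rank_of_isUnit _ ((Matrix.isUnit_iff_isUnit_det _).2 (isUnit_iff_ne_zero.2 hne))] at h
    simp at h
  have h01 : A 0 1 = 0 := hA (by decide)
  have h10 : A 1 0 = 0 := hA (by decide)
  have j01 : J 0 1 = 0 := hJ (by decide)
  have j10 : J 1 0 = 0 := hJ (by decide)
  rw [Matrix.det_fin_two] at hdet
  simp only [Matrix.sub_apply, h01, j01, sub_zero, zero_mul, mul_eq_zero] at hdet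
  rcases hdet with h | h
  · refine ⟨1, ?_⟩
    ext a b
    fin_cases a <;> fin_cases b <;> simp [h01, h10, j01, j10]
    linarith
  · refine ⟨0, ?_⟩
    ext a b
    fin_cases a <;> fin_cases b <;> simp [h01, h10, j01, j10]
    linarith

/-- Lamination and block are taken at the same scale `n`: their energies, both of order 2⁻ᵖⁿ, add,
whereas the variations multiply to 2ⁿ · 2ᵏⁿ. -/
lemma HasScaling.laminate {K : Set Mat2} (hK : K.Finite) (hKd : ∀ M ∈ K, M.IsDiag) {A J : Mat2}
    {p lam : ℝ} {k : ℕ} (hJ : HasScaling K J p k) (hJd : J.IsDiag) (hA : A ∈ K)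
    (hrank : (A - J).rank = 1) (hlam : lam ∈ Ioo (0 : ℝ) 1) (hp : 1 ≤ p) :
    HasScaling K (lam • A + (1 - lam) • J) p (k + 1) := by
  obtain ⟨i, hi⟩ := exists_eq_add_single (hKd A hA) hJd hrank
  obtain ⟨j, hij⟩ : ∃ j, i ≠ j := ⟨i + 1, by fin_cases i <;> decide⟩
  set d := A i i - J i i with hd
  obtain ⟨r, hr⟩ := (hK.image fun M : Mat2 => |d| + |J i i| + |M i i|).bddAbove
  have hr' : ∀ M ∈ K, |d| + |J i i| + |M i i| ≤ r := fun M hM => hr (mem_image_of_mem _ hM)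
  have hr0 : 0 ≤ r := le_trans (by positivity) (hr' A hA)
  have hF : lam • A + (1 - lam) • J = J + (lam * d) • Matrix.single i i (1 : ℝ) := by
    conv_lhs => rw [hi]
    module
  obtain ⟨C₀, hC₀, hB⟩ := hJ
  obtain ⟨C₁, hC₁, hS⟩ := exists_lamination hlam.1.le hlam.2 hp hij
  rw [hF]
  -- One constant for each of the three bounds required by `Lamination.fill`: energy, gradient
  -- variation, phase variation. Lower powers of 2ⁿ are absorbed into the highest one.
  set D₁ := (16 + 2 * r) ^ p * 2 ^ (p - 1) * (C₁ * C₀ + C₁) + (4 * |d| * (1 + C₁)) ^ p * C₁ with hD₁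
  set D₂ := |d| * C₁ + |d| * C₁ + 84 * C₀ * C₁ with hD₂
  set D₃ := 2 + 14 * C₁ + 7 * C₀ * C₁ with hD₃
  have p1 : 0 ≤ D₁ := by positivity
  have p2 : 0 ≤ D₂ := by positivity
  have p3 : 0 < D₃ := by positivity
  refine ⟨D₁ + D₂ + D₃, by positivity, fun n => ?_⟩
  obtain ⟨B⟩ := hB n
  obtain ⟨S⟩ := hS n
  set N : ℝ := 2 ^ n with hN
  have hN1 : 1 ≤ N := one_le_pow₀ one_le_two
  have hX : 0 ≤ N ^ (-p) := by positivity
  have hNk : 1 ≤ N ^ (k + 1) := one_le_pow₀ hN1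
  have hNN : N ≤ N ^ (k + 1) := le_self_pow₀ hN1 (by omega)
  refine ⟨S.fill B hij hlam.1.le hlam.2.le hp hJd hKd hr' (by positivity) hA hi ?_ ?_ ?_⟩
  · calc _ = D₁ * N ^ (-p) := by rw [hD₁]; ring
      _ ≤ _ := by gcongr; linarith
  · calc _ = |d| * C₁ * N + |d| * C₁ * N + 84 * C₀ * C₁ * N ^ (k + 1) := by ring
      _ ≤ |d| * C₁ * N ^ (k + 1) + |d| * C₁ * N ^ (k + 1) + 84 * C₀ * C₁ * N ^ (k + 1) := by gcongr
      _ = D₂ * N ^ (k + 1) := by rw [hD₂]; ring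
      _ ≤ _ := by gcongr; linarith
  · calc _ = 2 + 14 * C₁ * N + 7 * C₀ * C₁ * N ^ (k + 1) := by ring
      _ ≤ 2 * N ^ (k + 1) + 14 * C₁ * N ^ (k + 1) + 7 * C₀ * C₁ * N ^ (k + 1) := by
        gcongr
        linarith
      _ = D₃ * N ^ (k + 1) := by rw [hD₃]; ring
      _ ≤ _ := by gcongr; linarith

/-! ### Sobolev and BV membership, and the two energies -/

section WeakGradient

variable {u : Plane → Plane} {G : Plane → Mat2} {L : NNReal}

lemma abs_gradient_le (hu : LipschitzWith L u)
    (hG : ∀ᵐ x, HasFDerivAt u (Matrix.toEuclideanCLM (𝕜 := ℝ) (G x)) x) (a i : Fin 2) :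
    ∀ᵐ x, |G x a i| ≤ L := by
  filter_upwards [hG] with x hx
  have h1 : G x a i
      = (Matrix.toEuclideanCLM (𝕜 := ℝ) (G x) (EuclideanSpace.single i (1 : ℝ))) a := by
    simp [Matrix.ofLp_toEuclideanCLM]
  rw [h1, ← Real.norm_eq_abs]
  refine (PiLp.norm_apply_le _ a).trans ((ContinuousLinearMap.le_opNorm _ _).trans ?_)
  simpa using hx.le_of_lipschitz hu

lemma isWeakGradient (hu : LipschitzWith L u)
    (hG : ∀ᵐ x, HasFDerivAt u (Matrix.toEuclideanCLM (𝕜 := ℝ) (G x)) x)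
    (hm : ∀ a i, LocallyIntegrable fun x => G x a i) (Ω : Set Plane) : IsWeakGradient Ω u G := by
  refine ⟨fun a => ?_, fun a i => (hm a i).locallyIntegrableOn _, fun a i φ hφ => ?_⟩
  · have : Continuous fun x => u x a := by
      have := hu.continuous
      fun_prop
    exact this.locallyIntegrable.locallyIntegrableOn _
  · have h0 : ∀ x, x ∉ Ω → φ x = 0 := fun x hx =>
      image_eq_zero_of_notMem_tsupport fun h => hx (hφ.2.2 h)
    have h1 : ∀ x, x ∉ Ω → partialDeriv i φ x = 0 := fun x hx =>
      image_eq_zero_of_notMem_tsupport fun h => hx (hφ.2.2 (tsupport_partialDeriv_subset _ _ h))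
    rw [setIntegral_eq_integral_of_forall_compl_eq_zero fun x hx => by rw [h1 x hx, mul_zero],
      setIntegral_eq_integral_of_forall_compl_eq_zero fun x hx => by rw [h0 x hx, mul_zero]]
    refine ((lipschitzWith_coord a).comp hu).integral_mul_partialDeriv i ?_ hφ.1 hφ.2.1
    filter_upwards [hG] with x hx
    have h2 := ((hasFDerivAt_coord a (u x)).comp x hx).hasLineDerivAt (EuclideanSpace.single i 1)
    have e : ((EuclideanSpace.proj a).comp (Matrix.toEuclideanCLM (𝕜 := ℝ) (G x)))
        (EuclideanSpace.single i (1 : ℝ)) = G x a i := by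
      simp [Matrix.ofLp_toEuclideanCLM]
    rw [e] at h2
    exact h2

lemma memW1Infty_unitSquare (hu : LipschitzWith L u)
    (hG : ∀ᵐ x, HasFDerivAt u (Matrix.toEuclideanCLM (𝕜 := ℝ) (G x)) x)
    (hm : ∀ a i, LocallyIntegrable fun x => G x a i) : MemW1Infty unitSquare u G := by
  refine ⟨isWeakGradient hu hG hm _, fun a => ?_, fun a i => ?_⟩
  · have hc : Continuous fun x => u x a := by
      have := hu.continuous
      fun_prop
    obtain ⟨R, hR⟩ := (isCompact_closedBall (0 : Plane) 2).exists_bound_of_continuousOn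
      hc.continuousOn
    refine memLp_top_of_bound hc.aestronglyMeasurable R
      (ae_restrict_of_forall_mem measurableSet_unitSquare fun x hx => hR x ?_)
    rw [mem_closedBall_zero_iff, EuclideanSpace.norm_eq, Fin.sum_univ_two,
      Real.sqrt_le_left zero_le_two, Real.norm_eq_abs, Real.norm_eq_abs, sq_abs, sq_abs]
    have h0 := hx 0
    have h1 := hx 1
    nlinarith [h0.1, h0.2, h1.1, h1.2]
  · exact memLp_top_of_bound (hm a i).aestronglyMeasurable.restrict L
      (ae_restrict_of_ae (abs_gradient_le hu hG a i))

end WeakGradient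

namespace Block

variable {K : Set Mat2} {F : Mat2} {p e v : ℝ} (B : Block K F p e v)

/-- The deformation of a microstructure. -/
noncomputable def u (x : Plane) : Plane := Matrix.toEuclideanCLM (𝕜 := ℝ) F x + B.φ x

lemma exists_lipschitz_u : ∃ L, LipschitzWith L B.u := by
  obtain ⟨L, hL⟩ := B.lipschitz
  exact ⟨_, (Matrix.toEuclideanCLM (𝕜 := ℝ) F).lipschitz.add hL⟩

lemma hasFDerivAt_u :
    ∀ᵐ x, HasFDerivAt B.u (Matrix.toEuclideanCLM (𝕜 := ℝ) (F + B.G x)) x := by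
  filter_upwards [B.hasFDerivAt] with x hx
  rw [map_add]
  exact (ContinuousLinearMap.hasFDerivAt _).add hx

lemma locallyIntegrable_gradient (a i : Fin 2) : LocallyIntegrable fun x => (F + B.G x) a i :=
  (locallyIntegrable_const (F a i)).add (B.var_G a i).1.locallyIntegrable

/-- On the square χ is the finite combination of the wells with the indicators of the phases as
coefficients, each of bounded variation. -/
lemma memBV (hK : K.Finite) : MemBV unitSquare K B.χ := by
  classical
  have h1 : ∀ q : Fin 2 × Fin 2, VarBound (fun x => ∑ M ∈ hK.toFinset,
      M q.1 q.2 * {x | x ∈ unitSquare ∧ B.χ x = M}.indicator (fun _ => (1 : ℝ)) x)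
      (∑ M ∈ hK.toFinset, |M q.1 q.2| * v) := fun q =>
    VarBound.sum _ fun M _ => (B.var_χ M).const_mul _
  have h2 : ∀ x ∈ unitSquare, ∀ q : Fin 2 × Fin 2, B.χ x q.1 q.2 = ∑ M ∈ hK.toFinset,
      M q.1 q.2 * {x | x ∈ unitSquare ∧ B.χ x = M}.indicator (fun _ => (1 : ℝ)) x := by
    intro x hx q
    rw [Finset.sum_eq_single (B.χ x)]
    · simp [indicator, hx]
    · intro M _ hM
      simp [indicator, hM.symm]
    · intro h
      exact absurd (hK.mem_toFinset.2 (B.χ_mem x)) h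
  refine ⟨fun x _ => B.χ_mem x, fun a i => ?_, ?_⟩
  · exact (h1 (a, i)).1.integrableOn.congr_fun (fun x hx => (h2 x hx (a, i)).symm)
      measurableSet_unitSquare
  · exact (totalVar_le measurableSet_unitSquare h1 fun x hx => funext (h2 x hx)).trans_lt
      ENNReal.ofReal_lt_top

lemma phaseEnergy_le (k : ℕ) (A : ℕ → Mat2) {ε : ℝ} (hε : 0 ≤ ε) (he : 0 ≤ e) :
    phaseEnergy unitSquare k A p ε (fun x => F + B.G x) B.χ
      ≤ ENNReal.ofReal (e + 2 * (k + 1) * (ε * v)) := by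
  have hv := (B.var_G 0 0).nonneg
  have h1 : ∀ j ∈ Finset.Icc 1 (k + 1), totalVarReal unitSquare
      ({x | B.χ x = A j}.indicator fun _ => (1 : ℝ)) ≤ ENNReal.ofReal (2 * v) := by
    intro j _
    refine (totalVar_le measurableSet_unitSquare (fun _ => B.var_χ (A j)) fun x hx => ?_).trans
      (le_of_eq (by simp))
    funext _
    simp [indicator, hx]
  rw [phaseEnergy, ENNReal.ofReal_add he (by positivity)]
  refine add_le_add B.energy ?_
  calc _ ≤ ENNReal.ofReal ε * ∑ j ∈ Finset.Icc 1 (k + 1), ENNReal.ofReal (2 * v) := by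
        gcongr with j hj
        exact h1 j hj
    _ = ENNReal.ofReal (2 * (k + 1) * (ε * v)) := by
        rw [← ENNReal.ofReal_sum_of_nonneg fun _ _ => by positivity, ← ENNReal.ofReal_mul hε]
        congr 1
        simp
        ring

/-- The distance to `K` is at most the distance to χ, so the elastic part is inherited from the
block. For the variation, the constant `F` is extended by zero off the square; this costs 2‖F‖ in
each of four entries, doubled by `totalVar_le` to 16‖F‖. -/
lemma gradientEnergy_le (hp : 0 ≤ p) {ε : ℝ} (hε : 0 ≤ ε) (he : 0 ≤ e) :
    gradientEnergy unitSquare K p ε (fun x => F + B.G x)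
      ≤ ENNReal.ofReal (e + ε * (16 * ‖F‖ + 8 * v)) := by
  have hv := (B.var_G 0 0).nonneg
  rw [gradientEnergy, ENNReal.ofReal_add he (by positivity), ENNReal.ofReal_mul hε]
  refine add_le_add (le_trans ?_ B.energy) (mul_le_mul_right ?_ _)
  · refine lintegral_mono fun x => ENNReal.rpow_le_rpow ?_ hp
    rw [← edist_eq_enorm_sub]
    exact Metric.infEDist_le_edist_of_mem (B.χ_mem x)
  · have h1 : ∀ q : Fin 2 × Fin 2, VarBound (fun x =>
        F q.1 q.2 * unitSquare.indicator (fun _ => (1 : ℝ)) x + B.G x q.1 q.2) (‖F‖ * 2 + v) :=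
      fun q => ((VarBound.indicator_unitSquare.const_mul _).mono
        (mul_le_mul_of_nonneg_right (abs_entry_le_norm F _ _) zero_le_two)).add (B.var_G _ _)
    refine (totalVar_le measurableSet_unitSquare h1 fun x hx => ?_).trans
      (ENNReal.ofReal_le_ofReal (le_of_eq ?_))
    · funext q
      simp [indicator_of_mem hx]
    · simp
      ring

end Block

/-! ### Choice of the scale and conclusion -/

lemma exists_scale {ε p : ℝ} {k : ℕ} (hp : 0 < p) (hε : ε ∈ Ioo (0 : ℝ) 1) :
    ∃ n : ℕ, ((2 : ℝ) ^ n) ^ (-p) ≤ 2 ^ p * ε ^ (p / (k + p)) ∧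
      ε * ((2 : ℝ) ^ n) ^ k ≤ ε ^ (p / (k + p)) := by
  have hkp : 0 < k + p := by positivity
  have ht : 1 ≤ ε ^ (-(1 / (k + p))) :=
    Real.one_le_rpow_of_pos_of_le_one_of_nonpos hε.1 hε.2.le (neg_nonpos.2 (by positivity))
  -- 2ⁿ is the largest power of two not exceeding ε^(-1/(k+p)). The lower bound, which loses a
  -- factor 2 and hence `2 ^ p`, controls the elastic term; the upper bound controls the surface
  -- term.
  obtain ⟨n, h1, h2⟩ := exists_nat_pow_near ht one_lt_two
  refine ⟨n, ?_, ?_⟩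
  · have h3 : ε ^ (-(1 / (k + p))) / 2 ≤ 2 ^ n := by
      rw [pow_succ] at h2
      linarith
    have h4 : 0 < ε ^ (-(1 / (k + p))) := Real.rpow_pos_of_pos hε.1 _
    refine (Real.rpow_le_rpow_of_nonpos (by positivity) h3 (by linarith)).trans (le_of_eq ?_)
    rw [Real.div_rpow h4.le zero_le_two, ← Real.rpow_mul hε.1.le, Real.rpow_neg zero_le_two,
      div_inv_eq_mul, mul_comm]
    congr 2
    ring
  · calc ε * ((2 : ℝ) ^ n) ^ k ≤ ε * (ε ^ (-(1 / (k + p)))) ^ k := by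
          have := hε.1
          gcongr
      _ = ε ^ (1 : ℝ) * ε ^ (-(1 / (k + p)) * k) := by
          rw [Real.rpow_one, ← Real.rpow_natCast, ← Real.rpow_mul hε.1.le]
      _ = ε ^ (p / (k + p)) := by
          rw [← Real.rpow_add hε.1]
          congr 1
          field_simp
          ring

lemma finite_wells (k : ℕ) (A : ℕ → Mat2) : (wells k A).Finite := (finite_Icc _ _).image _

lemma HasScaling.exists_energy_le {k : ℕ} {A : ℕ → Mat2} {F : Mat2} {p : ℝ} (hp : 1 ≤ p)
    (h : HasScaling (wells k A) F p k) :
    ∃ C : ℝ, 0 < C ∧ ∀ ε ∈ Set.Ioo (0 : ℝ) 1,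
      ∃ (u : Plane → Plane) (G χ : Plane → Mat2) (b : Plane),
        Continuous u ∧ IsWeakGradient Set.univ u G ∧
        MemW1Infty unitSquare u G ∧
        MemBV unitSquare (wells k A) χ ∧
        (∀ x, x ∉ unitSquare → u x = Matrix.toEuclideanLin F x + b) ∧
        phaseEnergy unitSquare k A p ε G χ ≤ ENNReal.ofReal (C * ε ^ (p / (k + p))) ∧
        gradientEnergy unitSquare (wells k A) p ε G ≤
          ENNReal.ofReal (C * ε ^ (p / (k + p))) := by
  obtain ⟨C, hC, hB⟩ := h
  have hp0 : 0 < p := zero_lt_one.trans_le hp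
  refine ⟨C * 2 ^ p + 2 * (k + 1) * C + 16 * ‖F‖ + 8 * C, by positivity, fun ε hε => ?_⟩
  obtain ⟨n, h1, h2⟩ := exists_scale (k := k) hp0 hε
  have hBn := hB n
  have hε0 := hε.1.le
  have hF := norm_nonneg F
  set N : ℝ := 2 ^ n
  have hN : 1 ≤ N ^ k := one_le_pow₀ (one_le_pow₀ one_le_two)
  obtain ⟨B⟩ := hBn
  obtain ⟨L, hL⟩ := B.exists_lipschitz_u
  set Y := ε ^ (p / (k + p))
  have hY : 0 ≤ Y := Real.rpow_nonneg hε0 _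
  have h3 : C * N ^ (-p) ≤ C * 2 ^ p * Y := by
    rw [mul_assoc]
    gcongr
  have h4 : ε * (C * N ^ k) ≤ C * Y := by
    rw [mul_left_comm]
    gcongr
  -- Absorbs the contribution ε‖F‖ of the constant part of the gradient.
  have h5 : ε ≤ Y := (le_mul_of_one_le_right hε0 hN).trans h2
  refine ⟨B.u, fun x => F + B.G x, B.χ, 0, hL.continuous,
    isWeakGradient hL B.hasFDerivAt_u B.locallyIntegrable_gradient _,
    memW1Infty_unitSquare hL B.hasFDerivAt_u B.locallyIntegrable_gradient,
    B.memBV (finite_wells k A), fun x hx => ?_, ?_, ?_⟩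
  · rw [Block.u, B.φ_off x hx]
    rfl
  · refine (B.phaseEnergy_le k A hε0 (by positivity)).trans (ENNReal.ofReal_le_ofReal ?_)
    calc _ ≤ C * 2 ^ p * Y + 2 * (k + 1) * (C * Y) := by gcongr
      _ ≤ _ := by
        have : 0 ≤ (16 * ‖F‖ + 8 * C) * Y := by positivity
        linarith
  · refine (B.gradientEnergy_le hp0.le hε0 (by positivity)).trans (ENNReal.ofReal_le_ofReal ?_)
    calc _ = C * N ^ (-p) + (16 * ‖F‖ * ε + 8 * (ε * (C * N ^ k))) := by ring
      _ ≤ C * 2 ^ p * Y + (16 * ‖F‖ * Y + 8 * (C * Y)) := by gcongr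
      _ ≤ _ := by
        have : 0 ≤ 2 * (k + 1) * C * Y := by positivity
        linarith

theorem mainTheorem6 (k : ℕ) (hk : 1 ≤ k)
    (A J : ℕ → Mat2) (lam : ℕ → ℝ) (lam₀ : ℝ) (F : Mat2)
    (hA : ∀ j ∈ Set.Icc 1 (k + 1), (A j).IsDiag)
    (hA12 : (A 1 - A 2).rank = 1)
    (hArank : ∀ j ∈ Set.Icc 2 (k + 1), ∀ j' ∈ Set.Icc 2 (k + 1), j ≠ j' → (A j - A j').rank = 2)
    (hlam : ∀ j ∈ Set.Icc 3 (k + 1), lam j ∈ Set.Ioo (0 : ℝ) 1)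
    (hJ3 : J 3 = lam 3 • A 1 + (1 - lam 3) • A 2)
    (hJ : ∀ j ∈ Set.Icc 3 k, J (j + 1) = lam (j + 1) • A j + (1 - lam (j + 1)) • J j)
    (hJrank : ∀ j ∈ Set.Icc 3 (k + 1), (A j - J j).rank = 1)
    (hlam₀ : lam₀ ∈ Set.Ioo (0 : ℝ) 1)
    (hF : F = if k = 1 then lam₀ • A 1 + (1 - lam₀) • A 2
      else lam₀ • A (k + 1) + (1 - lam₀) • J (k + 1))
    (p : ℝ) (hp : 1 ≤ p) :
    ∃ C : ℝ, 0 < C ∧ ∀ ε ∈ Set.Ioo (0 : ℝ) 1,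
      ∃ (u : Plane → Plane) (G χ : Plane → Mat2) (b : Plane),
        Continuous u ∧ IsWeakGradient Set.univ u G ∧
        MemW1Infty unitSquare u G ∧
        MemBV unitSquare (wells k A) χ ∧
        (∀ x, x ∉ unitSquare → u x = Matrix.toEuclideanLin F x + b) ∧
        phaseEnergy unitSquare k A p ε G χ ≤ ENNReal.ofReal (C * ε ^ (p / (k + p))) ∧
        gradientEnergy unitSquare (wells k A) p ε G ≤
          ENNReal.ofReal (C * ε ^ (p / (k + p))) := by
  refine HasScaling.exists_energy_le hp ?_
  have hmem : ∀ j, 1 ≤ j → j ≤ k + 1 → A j ∈ wells k A := fun j h1 h2 => ⟨j, ⟨h1, h2⟩, rfl⟩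
  have hdiag : ∀ M ∈ wells k A, M.IsDiag := by
    rintro M ⟨j, hj, rfl⟩
    exact hA j hj
  have hfin := finite_wells k A
  have h1 := hmem 1 le_rfl (by omega)
  have h2 := hmem 2 (by omega) (by omega)
  -- The well `A 2` plays the part of the inner matrix, of order 0, and is laminated with `A 1`.
  have hfirst : ∀ l ∈ Ioo (0 : ℝ) 1, HasScaling (wells k A) (l • A 1 + (1 - l) • A 2) p 1 :=
    fun l hl => (hasScaling_of_mem h2 hp).laminate hfin hdiag (hdiag _ h2) h1 hA12 hl hp
  -- The sequence `J` starts at index 3 with a first-order laminate, so `J (m + 3)` has order `m +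
  -- 1`. The last lamination, of `J (k + 1)` with `A (k + 1)`, then has order `k`.
  have hchain : ∀ m, m + 3 ≤ k + 1 →
      HasScaling (wells k A) (J (m + 3)) p (m + 1) ∧ (J (m + 3)).IsDiag := by
    intro m
    induction m with
    | zero =>
      intro hm
      rw [zero_add, hJ3]
      exact ⟨hfirst _ (hlam 3 ⟨le_rfl, hm⟩), ((hdiag _ h1).smul _).add ((hdiag _ h2).smul _)⟩
    | succ m ih =>
      intro hm
      obtain ⟨ih1, ih2⟩ := ih (by omega)
      have hAm := hmem (m + 3) (by omega) (by omega)
      rw [show m + 1 + 3 = m + 3 + 1 by ring, hJ (m + 3) ⟨by omega, by omega⟩]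
      exact ⟨ih1.laminate hfin hdiag ih2 hAm (hJrank _ ⟨by omega, by omega⟩)
        (hlam _ ⟨by omega, by omega⟩) hp, ((hdiag _ hAm).smul _).add (ih2.smul _)⟩
  by_cases h : k = 1
  · rw [hF, if_pos h]
    subst h
    exact hfirst _ hlam₀
  · obtain ⟨m, rfl⟩ : ∃ m, k = m + 2 := ⟨k - 2, by omega⟩
    rw [hF, if_neg h]
    obtain ⟨h3, h4⟩ := hchain m (by omega)
    exact h3.laminate hfin hdiag h4 (hmem _ (by omega) le_rfl) (hJrank _ ⟨by omega, le_rfl⟩) hlam₀ hp
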